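/- **Conventions.** Let $K$ be a field with algebraic closure $\overline K$. An elliptic curve $E$ over $K$ is given by a nonsingular Weierstrass equation $Y^2Z+a_1XYZ+a_3YZ^2=X^3+a_2X^2Z+a_4XZ^2+a_6Z^3$ with $a_i\in K$, and has origin $O=[0:1:0]$. An *algebraic map over $K$* from $E$ to $E'$ is a function $\alpha:E(\overline K)\to E'(\overline K)$ such that for each $P\in E(\overline K)$ there are homogeneous polynomials $f_1,f_2,f_3\in K[X,Y,Z]$ of the same degree, not all vanishing at $P$, with $\alpha(Q)=[f_1(Q):f_2(Q):f_3(Q)]$ for every $Q\in E(\overline K)$ at which they do not all vanish; we say that $(f_1,f_2,f_3)$ represents $\alpha$ at $P$. An *isogeny over $K$* is a nonconstant algebraic map over $K$ that takes the origin to the origin, and $\mathrm{Isog}(E,E')$ is the set of isogenies over $K$ from $E$ to $E'$ together with the constant zero map. Put $t=-X/Y$, $s=-Z/Y$. Let $S(\tau)=\tau^3+\cdots\in\tau K[[\tau]]$ be the expansion of $s$ in the uniformizer $t$ at $O$, that is, the unique power series without constant term with $S=\tau^3+a_1\tau S+a_2\tau^2S+a_3S^2+a_4\tau S^2+a_6S^3$.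 The formal group law of $E$ is $$F(t_1,t_2)=\frac{-t_3}{1-a_1t_3-a_3(mt_3+b)}\in K[[t_1,t_2]],\qquad t_3=-t_1-t_2-\frac{a_1m+a_2b+a_3m^2+2a_4mb+3a_6m^2b}{1+a_2m+a_4m^2+a_6m^3},$$ where $m=\dfrac{S(t_1)-S(t_2)}{t_1-t_2}$ and $b=S(t_1)-mt_1$. For formal group laws $F,F'$ over $K$, $\mathrm{Hom}(F,F')$ is the set of $U\in\tau K[[\tau]]$ with $U(F(X,Y))=F'(U(X),U(Y))$, with the addition $U\oplus_{F'}V=F'(U,V)$. **Proposition 5.1.** Let $E,E',E''$ be elliptic curves over $K$. The associated power series $F,F',F''$ are commutative formal group laws over $K$. Let $I\in\mathrm{Isog}(E,E')$. If $(f_1,f_2,f_3)$ represents $I$ at the origin, then $f_2(\tau,-1,S(\tau))$ is invertible in $K[[\tau]]$, and the power series $$U(\tau)=-\frac{f_1(\tau,-1,S(\tau))}{f_2(\tau,-1,S(\tau))},$$ the expansion of $-f_1/f_2$ in the uniformizer $t=-X/Y$ at the origin of $E$, belongs to $\mathrm{Hom}(F,F')$ and depends only on $I$. The set $\mathrm{Isog}(E,E')$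 is a group under pointwise addition, $\mathrm{Hom}(F,F')$ is an abelian group under $\oplus_{F'}$, and $I\mapsto U$ is an injective group homomorphism $\mathrm{Isog}(E,E')\hookrightarrow\mathrm{Hom}(F,F')$. If moreover $I'\in\mathrm{Isog}(E',E'')$ corresponds to $U'\in\mathrm{Hom}(F',F'')$, then $I'\circ I$ belongs to $\mathrm{Isog}(E,E'')$ and corresponds to $U'\circ U\in\mathrm{Hom}(F,F'')$. -/

import Mathlib

/-! Elliptic curves are given by Weierstrass equations over a field `K`, their points over the
algebraic closure by projective coordinates `[X : Y : Z]` (coordinates `0`, `1`, `2`), and the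
origin is `[0 : 1 : 0]`. -/

noncomputable section

namespace EllipticFormal

open scoped PowerSeries

universe u

variable {K : Type u} [Field K]

/-! ### Homomorphisms of formal group laws -/

/-- `F` is the power series of a one-dimensional commutative formal group law. -/
def IsCommFormalGroupLaw (F : MvPowerSeries (Fin 2) K) : Prop :=
  ∃ G : FormalGroup K, G.toPowerSeries = F ∧ G.IsComm

/-- `F(g, h)`, for one-variable power series `g` and `h` without constant term. -/
def formalAdd (F : MvPowerSeries (Fin 2) K) (g h : K⟦X⟧) : K⟦X⟧ :=
  MvPowerSeries.subst (![g, h] : Fin 2 → MvPowerSeries Unit K) F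

/-- `Hom(F, F')`: the power series `U` without constant term such that
`U(F(X, Y)) = F'(U(X), U(Y))`. -/
def FormalHom (F F' : MvPowerSeries (Fin 2) K) : Set K⟦X⟧ :=
  {U | PowerSeries.constantCoeff U = 0 ∧
    PowerSeries.subst F U =
      MvPowerSeries.subst
        (![PowerSeries.subst (MvPowerSeries.X 0 : MvPowerSeries (Fin 2) K) U,
          PowerSeries.subst (MvPowerSeries.X 1 : MvPowerSeries (Fin 2) K) U] :
          Fin 2 → MvPowerSeries (Fin 2) K) F'}

/-! ### The formal group law of an elliptic curve -/

/-- The right-hand side of the Weierstrass equation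
`s = t³ + a₁ts + a₂t²s + a₃s² + a₄ts² + a₆s³` in the coordinates `t = -X/Y`, `s = -Z/Y`. -/
def sStep (E : WeierstrassCurve K) (s : K⟦X⟧) : K⟦X⟧ :=
  PowerSeries.X ^ 3 + PowerSeries.C E.a₁ * PowerSeries.X * s
    + PowerSeries.C E.a₂ * PowerSeries.X ^ 2 * s + PowerSeries.C E.a₃ * s ^ 2
    + PowerSeries.C E.a₄ * PowerSeries.X * s ^ 2 + PowerSeries.C E.a₆ * s ^ 3

/-- The expansion `S(τ) = τ³ + ⋯` of `s = -Z/Y` in the uniformizer `t = -X/Y`, obtained by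
substituting approximations into the Weierstrass equation: the `n`-th coefficient no longer changes
after `n` steps. The two lemmas after the definition characterize `S`. -/
def sSeries (E : WeierstrassCurve K) : K⟦X⟧ :=
  PowerSeries.mk fun n => PowerSeries.coeff n ((sStep E)^[n] 0)

lemma sStep_sub (E : WeierstrassCurve K) {n : ℕ} {f g : K⟦X⟧} (hf : PowerSeries.X ∣ f)
    (hg : PowerSeries.X ∣ g) (h : PowerSeries.X ^ n ∣ f - g) :
    PowerSeries.X ^ (n + 1) ∣ sStep E f - sStep E g := by
  obtain ⟨a, rfl⟩ := hf
  obtain ⟨b, rfl⟩ := hg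
  obtain ⟨c, hc⟩ := h
  refine ⟨c * (PowerSeries.C E.a₁ + PowerSeries.C E.a₂ * PowerSeries.X
    + PowerSeries.C E.a₃ * (a + b) + PowerSeries.C E.a₄ * PowerSeries.X * (a + b)
    + PowerSeries.C E.a₆ * PowerSeries.X * (a ^ 2 + a * b + b ^ 2)), ?_⟩
  simp only [sStep]
  linear_combination (PowerSeries.X * (PowerSeries.C E.a₁ + PowerSeries.C E.a₂ * PowerSeries.X
    + PowerSeries.C E.a₃ * (a + b) + PowerSeries.C E.a₄ * PowerSeries.X * (a + b)
    + PowerSeries.C E.a₆ * PowerSeries.X * (a ^ 2 + a * b + b ^ 2))) * hc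

lemma X_dvd_iterate (E : WeierstrassCurve K) (n : ℕ) :
    (PowerSeries.X : K⟦X⟧) ∣ (sStep E)^[n] 0 := by
  induction n with
  | zero => simp
  | succ n ih =>
    rw [Function.iterate_succ_apply']
    obtain ⟨a, ha⟩ := ih
    rw [ha]
    exact ⟨PowerSeries.X ^ 2 + PowerSeries.C E.a₁ * PowerSeries.X * a
      + PowerSeries.C E.a₂ * PowerSeries.X ^ 2 * a + PowerSeries.C E.a₃ * PowerSeries.X * a ^ 2
      + PowerSeries.C E.a₄ * PowerSeries.X ^ 2 * a ^ 2
      + PowerSeries.C E.a₆ * PowerSeries.X ^ 2 * a ^ 3, by simp only [sStep]; ring⟩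

lemma iterate_sub (E : WeierstrassCurve K) (n k : ℕ) :
    (PowerSeries.X : K⟦X⟧) ^ (n + 1) ∣ (sStep E)^[n + k] 0 - (sStep E)^[n] 0 := by
  induction n with
  | zero => simpa using X_dvd_iterate E k
  | succ n ih =>
    rw [show n + 1 + k = (n + k) + 1 by ring, Function.iterate_succ_apply',
      Function.iterate_succ_apply']
    exact sStep_sub E (X_dvd_iterate E _) (X_dvd_iterate E _) ih

lemma X_pow_dvd_sSeries_sub (E : WeierstrassCurve K) (n : ℕ) :
    (PowerSeries.X : K⟦X⟧) ^ (n + 1) ∣ sSeries E - (sStep E)^[n] 0 := by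
  rw [PowerSeries.X_pow_dvd_iff]
  intro m hm
  obtain ⟨k, rfl⟩ := Nat.exists_eq_add_of_le (Nat.lt_succ_iff.mp hm)
  have := (PowerSeries.X_pow_dvd_iff.mp (iterate_sub E m k)) m (Nat.lt_succ_self m)
  rw [map_sub, sub_eq_zero] at this ⊢
  rw [sSeries, PowerSeries.coeff_mk, this]

/-- `S` has no constant term. -/
lemma constantCoeff_sSeries (E : WeierstrassCurve K) :
    PowerSeries.constantCoeff (sSeries E) = 0 := by
  have := X_pow_dvd_sSeries_sub E 0
  simpa [PowerSeries.X_dvd_iff] using this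

/-- `S` satisfies the Weierstrass equation. -/
lemma sStep_sSeries (E : WeierstrassCurve K) : sStep E (sSeries E) = sSeries E := by
  rw [← sub_eq_zero]
  ext n
  have hS : (PowerSeries.X : K⟦X⟧) ∣ sSeries E :=
    PowerSeries.X_dvd_iff.mpr (constantCoeff_sSeries E)
  have h1 := sStep_sub E hS (X_dvd_iterate E n) (X_pow_dvd_sSeries_sub E n)
  have h2 := X_pow_dvd_sSeries_sub E (n + 1)
  rw [Function.iterate_succ_apply'] at h2
  have h3 := dvd_sub h1 h2
  rw [sub_sub_sub_cancel_right] at h3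
  simpa using (PowerSeries.X_pow_dvd_iff.mp h3) n (by omega)

/-- The formal group law `F(t₁, t₂)` of `E`. The line through `(t₁, -1, S(t₁))` and
`(t₂, -1, S(t₂))` is `s = mt + b`, where `m = (S(t₁) - S(t₂)) / (t₁ - t₂)` has the coefficient
`s_{i+j+1}` at `t₁ⁱt₂ʲ`. Its third point of intersection with `E` is `(t₃, -1, s₃)`, and
`F(t₁, t₂)` is the first coordinate of the negative `(-t₃/(1 - a₁t₃ - a₃s₃), -1, ⋯)` of that point.
Both denominators have constant term `1`. -/
def formalGroupLaw (E : WeierstrassCurve K) : MvPowerSeries (Fin 2) K :=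
  let c : K → MvPowerSeries (Fin 2) K := fun a => MvPowerSeries.C a
  let t₁ : MvPowerSeries (Fin 2) K := MvPowerSeries.X 0
  let t₂ : MvPowerSeries (Fin 2) K := MvPowerSeries.X 1
  let m : MvPowerSeries (Fin 2) K := fun e => PowerSeries.coeff (e 0 + e 1 + 1) (sSeries E)
  let b : MvPowerSeries (Fin 2) K := PowerSeries.subst t₁ (sSeries E) - m * t₁
  let A : MvPowerSeries (Fin 2) K := 1 + c E.a₂ * m + c E.a₄ * m ^ 2 + c E.a₆ * m ^ 3
  let t₃ : MvPowerSeries (Fin 2) K :=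
    -t₁ - t₂ - (c E.a₁ * m + c E.a₂ * b + c E.a₃ * m ^ 2 + 2 * c E.a₄ * m * b
      + 3 * c E.a₆ * m ^ 2 * b) * A⁻¹
  let s₃ : MvPowerSeries (Fin 2) K := m * t₃ + b
  let F : MvPowerSeries (Fin 2) K := -t₃ * (1 - c E.a₁ * t₃ - c E.a₃ * s₃)⁻¹
  F

/-! ### Isogenies -/

/-- The points of `E` over the algebraic closure of `K`, with Mathlib's group law. -/
abbrev GeomPoint (E : WeierstrassCurve K) : Type u :=
  (E.map (algebraMap K (AlgebraicClosure K))).toProjective.Point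

/-- The values at `q` of a triple of polynomials over `K`. -/
def evalTriple (f : Fin 3 → MvPolynomial (Fin 3) K) (q : Fin 3 → AlgebraicClosure K) :
    Fin 3 → AlgebraicClosure K :=
  fun i => MvPolynomial.aeval q (f i)

/-- `f₁, f₂, f₃` are homogeneous polynomials over `K` of the same degree `d`, and
`α(Q) = [f₁(Q) : f₂(Q) : f₃(Q)]` for all points `Q` of `E` over the algebraic closure at which
`f₁, f₂, f₃` do not all vanish. -/
structure Represents (E E' : WeierstrassCurve K) (α : GeomPoint E → GeomPoint E') (d : ℕ)
    (f : Fin 3 → MvPolynomial (Fin 3) K) : Prop where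
  homogeneous : ∀ i, (f i).IsHomogeneous d
  eq_point : ∀ (Q : GeomPoint E) (q : Fin 3 → AlgebraicClosure K), Q.point = ⟦q⟧ →
    evalTriple f q ≠ 0 → (α Q).point = ⟦evalTriple f q⟧

/-- `α` is an algebraic map from `E` to `E'` that is defined over `K`: in a neighbourhood of every
point it is given by homogeneous polynomials over `K`. -/
def IsAlgebraicMap (E E' : WeierstrassCurve K) (α : GeomPoint E → GeomPoint E') : Prop :=
  ∀ (P : GeomPoint E) (p : Fin 3 → AlgebraicClosure K), P.point = ⟦p⟧ →
    ∃ (d : ℕ) (f : Fin 3 → MvPolynomial (Fin 3) K), Represents E E' α d f ∧ evalTriple f p ≠ 0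

/-- An isogeny over `K`: a nonconstant algebraic map over `K` that takes the origin to the
origin. -/
structure IsIsogeny (E E' : WeierstrassCurve K) (α : GeomPoint E → GeomPoint E') : Prop where
  algebraic : IsAlgebraicMap E E' α
  map_origin : α 0 = 0
  nonconstant : ∃ P Q, α P ≠ α Q

/-- `Isog(E, E')`: the isogenies over `K` together with the constant zero map. -/
def Isog (E E' : WeierstrassCurve K) : Set (GeomPoint E → GeomPoint E') :=
  {α | IsIsogeny E E' α ∨ α = 0}

/-! ### The local expansion at the origin -/

/-- `α` is represented by `f₁, f₂, f₃`, which do not all vanish at the origin `[0 : 1 : 0]`. -/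
def RepresentsAtOrigin (E E' : WeierstrassCurve K) (α : GeomPoint E → GeomPoint E') (d : ℕ)
    (f : Fin 3 → MvPolynomial (Fin 3) K) : Prop :=
  Represents E E' α d f ∧ evalTriple f ![0, 1, 0] ≠ 0

/-- `g(τ, -1, S(τ))`. -/
def expand (E : WeierstrassCurve K) (g : MvPolynomial (Fin 3) K) : K⟦X⟧ :=
  MvPolynomial.aeval (![PowerSeries.X, -1, sSeries E] : Fin 3 → K⟦X⟧) g

/-- The expansion `U(τ) = -f₁(τ, -1, S(τ)) / f₂(τ, -1, S(τ))` of the function `-f₁/f₂`, the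
composite of `-X/Y` on `E'` with `[f₁ : f₂ : f₃]`, in the uniformizer `-X/Y` of `E`. -/
def localExpansion (E : WeierstrassCurve K) (f : Fin 3 → MvPolynomial (Fin 3) K) : K⟦X⟧ :=
  -expand E (f 0) * (expand E (f 1))⁻¹

/-- The map `α` corresponds to the power series `U`. -/
def IsExpansion (E E' : WeierstrassCurve K) (α : GeomPoint E → GeomPoint E') (U : K⟦X⟧) : Prop :=
  ∃ (d : ℕ) (f : Fin 3 → MvPolynomial (Fin 3) K),
    RepresentsAtOrigin E E' α d f ∧ U = localExpansion E f

end EllipticFormal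

end

noncomputable section

namespace EllipticFormal

open scoped PowerSeries
open Polynomial

/-! ### Rational curves on a nonsingular cubic are constant -/

/-! Every identity between power series is deduced from an identity between points over the
algebraic closure. On the affine curve a form becomes `a(x) + b(x) y`, whose norm is a polynomial in
`x`; since `x = τ / S(τ)` is the inverse of a nonzero series without constant term, no nonzero
polynomial vanishes at it. Hence a form vanishes on the curve exactly when its expansion at the
origin vanishes (`expand_eq_zero_iff`). Replacing geometric points one at a time by `(g, -1, S(g))`,
with `g` without constant term, gives `aeval_chartPoints_eq_zero_of_geometric`: a polynomial
relation valid for all tuples of geometric points holds for these power series points.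

The group law enters through `originLaw`, a polynomial addition law defined near `(O, O)`. At `(g,
-1, S(g))` and `(h, -1, S(h))` its value is a unit times the point with parameter `F(g, h)`
(`originAdd_chartPoint`). As a point in this chart is determined up to scalars by its parameter,
associativity, commutativity, the unit and inverses for `F` are inherited from the curve. Likewise a
triple representing an isogeny takes the point with parameter `g` to a unit times the point with
parameter `U(g)` (`RepresentsAtOrigin.aeval_chartPoint`). So additivity of the isogeny becomes
`U(F(X, Y)) = F'(U(X), U(Y))`, and sums and composites expand as expected. If `U = 0`, the outer two
forms vanish on the curve, so the isogeny is zero wherever the middle one is nonzero, hence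
everywhere (`eq_of_agree`).

Two facts about algebraic maps are needed. They are closed under addition because every pair of
points lies in the domain of a chord, tangent or origin law (`exists_isAddLaw`). And they are
additive if they preserve the origin (`map_add_of_map_zero`). For the latter, an even map factors
through the `x`-coordinate and so traces a rational curve, which is constant (`eq_const_of_even`).
Applied to `P ↦ α(Q + P) + α(Q - P)`, this shows that the defect `α(P + Q) - α(P) - α(Q)` is killed
by 2; it follows that the defect is even in `P`, hence constant, hence zero.

Rational curves are constant because the invariant differential has no nonzero regular pullback to
the line. In polynomial terms, the cross product of a primitive solution `v` and its derivative is a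
multiple of the gradient along `v`, and its degree is too small for a nonzero multiple. In
characteristic `p` the conclusion `v' = 0` only says that `v` is a polynomial in `X ^ p`, and a
descent on the degree finishes the proof. -/

/-- Every nonzero triple on an elliptic curve over a field is a nonsingular point. -/
lemma nonsingular_of_equation {k : Type*} [Field k] (W : WeierstrassCurve k) [W.IsElliptic]
    {q : Fin 3 → k} (hq : q ≠ 0) (h : W.toProjective.Equation q) :
    W.toProjective.Nonsingular q := by
  by_cases hz : q 2 = 0
  · have hx : q 0 = 0 := WeierstrassCurve.Projective.X_eq_zero_of_Z_eq_zero h hz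
    have hy : q 1 ≠ 0 := fun hy => hq (by ext i; fin_cases i <;> simp [hx, hy, hz])
    rw [WeierstrassCurve.Projective.nonsingular_of_Z_eq_zero hz]
    exact ⟨h, Or.inr (by simp [hx, hy])⟩
  · rw [WeierstrassCurve.Projective.nonsingular_of_Z_ne_zero hz]
    rw [WeierstrassCurve.Projective.equation_of_Z_ne_zero hz] at h
    exact WeierstrassCurve.Affine.equation_iff_nonsingular.mp h

/-- The gradient of the homogeneous Weierstrass equation. -/
def gradient {R : Type*} [CommRing R] (W : WeierstrassCurve R) (q : Fin 3 → R) : Fin 3 → R :=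
  ![W.a₁ * q 1 * q 2 - (3 * q 0 ^ 2 + 2 * W.a₂ * q 0 * q 2 + W.a₄ * q 2 ^ 2),
    2 * q 1 * q 2 + W.a₁ * q 0 * q 2 + W.a₃ * q 2 ^ 2,
    q 1 ^ 2 + W.a₁ * q 0 * q 1 + 2 * W.a₃ * q 1 * q 2
      - (W.a₂ * q 0 ^ 2 + 2 * W.a₄ * q 0 * q 2 + 3 * W.a₆ * q 2 ^ 2)]

lemma gradient_ne_zero {k : Type*} [Field k] (W : WeierstrassCurve k) [W.IsElliptic]
    {q : Fin 3 → k} (hq : q ≠ 0) (h : W.toProjective.Equation q) : gradient W q ≠ 0 := by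
  intro h0
  have h1 := nonsingular_of_equation W hq h
  rw [WeierstrassCurve.Projective.nonsingular_iff] at h1
  have e0 := congrFun h0 0
  have e1 := congrFun h0 1
  have e2 := congrFun h0 2
  simp only [gradient, Matrix.cons_val, Pi.zero_apply] at e0 e1 e2
  obtain ⟨-, h1 | h1 | h1⟩ := h1
  · exact h1 (by linear_combination e0)
  · exact h1 (by linear_combination e1)
  · exact h1 (by linear_combination e2)

lemma gradient_map {R S : Type*} [CommRing R] [CommRing S] (φ : R →+* S) (W : WeierstrassCurve R)
    (q : Fin 3 → R) (i : Fin 3) : gradient (W.map φ) (φ ∘ q) i = φ (gradient W q i) := by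
  fin_cases i <;>
    simp only [gradient, Function.comp_apply, WeierstrassCurve.map_a₁, WeierstrassCurve.map_a₂,
      WeierstrassCurve.map_a₃, WeierstrassCurve.map_a₄, WeierstrassCurve.map_a₆, Matrix.cons_val,
      map_add, map_sub, map_mul, map_pow, map_ofNat, Fin.zero_eta, Fin.mk_one, Fin.reduceFinMk]

/-- A criterion for two triples to be proportional. -/
lemma mul_comm_of_cross {R : Type*} [CommRing R] {x y : Fin 3 → R} (h01 : x 0 * y 1 = x 1 * y 0)
    (h02 : x 0 * y 2 = x 2 * y 0) (h12 : x 1 * y 2 = x 2 * y 1) (a b : Fin 3) :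
    x a * y b = x b * y a := by
  fin_cases a <;> fin_cases b <;>
    first | rfl | exact h01 | exact h02 | exact h12 | exact h01.symm | exact h02.symm | exact h12.symm

/-- The ideal of the entries is principal. Its generator `g` divides every entry and is itself a
combination of them, so cancelling `g` leaves a triple that generates the unit ideal. -/
lemma exists_primitive {k : Type*} [Field k] {v : Fin 3 → k[X]} (hv : v ≠ 0) :
    ∃ (g : k[X]) (w y : Fin 3 → k[X]), g ≠ 0 ∧ v = g • w ∧ ∑ i, y i * w i = 1 := by
  obtain ⟨g, hg⟩ := (IsPrincipalIdealRing.principal (Ideal.span (Set.range v))).principal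
  have h1 : ∀ i, ∃ w, v i = g * w := fun i => by
    have : v i ∈ Ideal.span (Set.range v) := Ideal.subset_span ⟨i, rfl⟩
    rw [hg] at this
    exact Ideal.mem_span_singleton.mp this
  choose w hw using h1
  have h2 : g ∈ Ideal.span (Set.range v) := hg ▸ Ideal.mem_span_singleton_self g
  obtain ⟨y, hy⟩ := (Ideal.mem_span_range_iff_exists_fun).mp h2
  have hg0 : g ≠ 0 := by
    rintro rfl
    exact hv (by ext1 i; simp [hw i])
  refine ⟨g, w, y, hg0, by ext1 i; simp [hw i], mul_left_cancel₀ hg0 ?_⟩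
  rw [mul_one, Finset.mul_sum]
  conv_rhs => rw [← hy]
  exact Finset.sum_congr rfl fun i _ => by rw [hw i]; ring

/-- A common divisor of positive degree would have a root, at which all entries vanish. -/
lemma exists_bezout {k : Type*} [Field k] [IsAlgClosed k] {v : Fin 3 → k[X]}
    (h : ∀ r : k, (fun i => (v i).eval r) ≠ 0) : ∃ y : Fin 3 → k[X], ∑ i, y i * v i = 1 := by
  have hv : v ≠ 0 := by
    rintro rfl
    exact h 0 (by ext; simp)
  obtain ⟨g, w, y, hg0, hw, hy⟩ := exists_primitive hv
  have hg : g.degree = 0 := by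
    by_contra hd
    obtain ⟨r, hr⟩ := IsAlgClosed.exists_root g hd
    refine h r ?_
    ext i
    rw [hw]
    simp [hr.eq_zero]
  obtain ⟨u, hu⟩ := (Polynomial.isUnit_iff_degree_eq_zero.mpr hg).exists_left_inv
  refine ⟨fun i => u * y i, ?_⟩
  rw [← hy]
  refine Finset.sum_congr rfl fun i _ => ?_
  rw [hw]
  simp only [Pi.smul_apply, smul_eq_mul]
  linear_combination (y i * w i) * hu

/-- `f` has degree at most `n` and coefficient `a` at `X ^ n`. -/
def TopCoeff {k : Type*} [Field k] (n : ℕ) (f : k[X]) (a : k) : Prop :=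
  f.natDegree ≤ n ∧ f.coeff n = a

namespace TopCoeff

variable {k : Type*} [Field k] {n m : ℕ} {f g : k[X]} {a b : k}

lemma mul (hf : TopCoeff n f a) (hg : TopCoeff m g b) : TopCoeff (n + m) (f * g) (a * b) := by
  refine ⟨natDegree_mul_le_of_le hf.1 hg.1, ?_⟩
  rw [coeff_mul_add_eq_of_natDegree_le hf.1 hg.1, hf.2, hg.2]

lemma add (hf : TopCoeff n f a) (hg : TopCoeff n g b) : TopCoeff n (f + g) (a + b) :=
  ⟨natDegree_add_le_of_degree_le hf.1 hg.1, by rw [coeff_add, hf.2, hg.2]⟩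

lemma sub (hf : TopCoeff n f a) (hg : TopCoeff n g b) : TopCoeff n (f - g) (a - b) :=
  ⟨(natDegree_sub_le_of_le hf.1 hg.1).trans (max_self n).le, by rw [coeff_sub, hf.2, hg.2]⟩

lemma cmul (c : k) (hf : TopCoeff n f a) : TopCoeff n (C c * f) (c * a) :=
  ⟨(natDegree_C_mul_le c f).trans hf.1, by rw [coeff_C_mul, hf.2]⟩

end TopCoeff

/-- The coefficients at `X ^ n` are the value of the parametrized curve at infinity. The equation is
a cubic form, so its coefficient at `X ^ (3n)` is the equation for these values. -/
lemma equation_coeff {k : Type*} [Field k] (W : WeierstrassCurve k) {n : ℕ} {v : Fin 3 → k[X]}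
    (hn : ∀ i, (v i).natDegree ≤ n) (h : (W.map C).toProjective.Equation v) :
    W.toProjective.Equation (fun i => (v i).coeff n) := by
  have T : ∀ i, TopCoeff n (v i) ((v i).coeff n) := fun i => ⟨hn i, rfl⟩
  rw [WeierstrassCurve.Projective.equation_iff] at h ⊢
  simp only [WeierstrassCurve.map_a₁, WeierstrassCurve.map_a₂, WeierstrassCurve.map_a₃,
    WeierstrassCurve.map_a₄, WeierstrassCurve.map_a₆] at h
  have H := (((((T 1).mul (T 1)).mul (T 2)).add ((((T 0).mul (T 1)).mul (T 2)).cmul W.a₁)).add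
    ((((T 1).mul (T 2)).mul (T 2)).cmul W.a₃)).sub
    (((((((T 0).mul (T 0)).mul (T 0))).add ((((T 0).mul (T 0)).mul (T 2)).cmul W.a₂)).add
    ((((T 0).mul (T 2)).mul (T 2)).cmul W.a₄)).add ((((T 2).mul (T 2)).mul (T 2)).cmul W.a₆))
  have e := H.2
  rw [sub_eq_zero.mpr (by linear_combination h), coeff_zero] at e
  linear_combination -e

/-- The entries of the gradient are quadratic forms, so their values at infinity are read off in
degree `2n`. -/
lemma gradient_coeff {k : Type*} [Field k] (W : WeierstrassCurve k) {n : ℕ} {v : Fin 3 → k[X]}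
    (hn : ∀ i, (v i).natDegree ≤ n) (i : Fin 3) :
    (gradient (W.map C) v i).coeff (n + n) = gradient W (fun i => (v i).coeff n) i := by
  have T : ∀ i, TopCoeff n (v i) ((v i).coeff n) := fun i => ⟨hn i, rfl⟩
  have H0 := (((T 1).mul (T 2)).cmul W.a₁).sub ((((((T 0).mul (T 0)).cmul 3)).add
    (((T 0).mul (T 2)).cmul (2 * W.a₂))).add (((T 2).mul (T 2)).cmul W.a₄))
  have H1 := ((((T 1).mul (T 2)).cmul 2).add (((T 0).mul (T 2)).cmul W.a₁)).add
    (((T 2).mul (T 2)).cmul W.a₃)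
  have H2 := ((((T 1).mul (T 1))).add (((T 0).mul (T 1)).cmul W.a₁) |>.add
    (((T 1).mul (T 2)).cmul (2 * W.a₃))).sub ((((T 0).mul (T 0)).cmul W.a₂).add
    (((T 0).mul (T 2)).cmul (2 * W.a₄)) |>.add (((T 2).mul (T 2)).cmul (3 * W.a₆)))
  simp only [map_mul, map_ofNat] at H0 H1 H2
  fin_cases i
  · refine (congrArg (coeff · (n + n)) ?_).trans (H0.2.trans ?_) <;> simp [gradient] <;> ring
  · refine (congrArg (coeff · (n + n)) ?_).trans (H1.2.trans ?_) <;> simp [gradient] <;> ring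
  · refine (congrArg (coeff · (n + n)) ?_).trans (H2.2.trans ?_) <;> simp [gradient] <;> ring

/-- The chain rule applied to the equation along `v`. -/
lemma sum_gradient_mul_derivative {k : Type*} [Field k] (W : WeierstrassCurve k) {v : Fin 3 → k[X]}
    (h : (W.map C).toProjective.Equation v) :
    ∑ i, gradient (W.map C) v i * derivative (v i) = 0 := by
  rw [WeierstrassCurve.Projective.equation_iff] at h
  simp only [WeierstrassCurve.map_a₁, WeierstrassCurve.map_a₂, WeierstrassCurve.map_a₃,
    WeierstrassCurve.map_a₄, WeierstrassCurve.map_a₆] at h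
  have e := congrArg (fun f => derivative f) h
  simp only [derivative_sub, derivative_zero, derivative_add, derivative_mul, derivative_C, derivative_pow] at e
  simp only [Fin.sum_univ_three, gradient, Matrix.cons_val, WeierstrassCurve.map_a₁,
    WeierstrassCurve.map_a₂, WeierstrassCurve.map_a₃, WeierstrassCurve.map_a₄,
    WeierstrassCurve.map_a₆]
  norm_num at e
  simp only [map_ofNat] at e
  linear_combination e

/-- Euler's relation for a cubic form. -/
lemma sum_gradient_mul_self {R : Type*} [CommRing R] (W : WeierstrassCurve R) {v : Fin 3 → R}
    (h : W.toProjective.Equation v) : ∑ i, gradient W v i * v i = 0 := by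
  rw [WeierstrassCurve.Projective.equation_iff] at h
  simp only [Fin.sum_univ_three, gradient, Matrix.cons_val]
  linear_combination 3 * h

/-- The derivative of a primitive polynomial solution of a nonsingular Weierstrass equation
vanishes. -/
lemma derivative_eq_zero_of_equation {k : Type*} [Field k] [IsAlgClosed k] (W : WeierstrassCurve k)
    [W.IsElliptic] {v y : Fin 3 → k[X]} (hy : ∑ i, y i * v i = 1)
    (h : (W.map C).toProjective.Equation v) (i : Fin 3) : derivative (v i) = 0 := by
  obtain ⟨m, -, hm⟩ := Finset.exists_max_image (Finset.univ : Finset (Fin 3))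
    (fun i => (v i).natDegree) Finset.univ_nonempty
  set n := (v m).natDegree with hn
  have hm : ∀ i, (v i).natDegree ≤ n := fun i => hm i (Finset.mem_univ i)
  rcases Nat.eq_zero_or_pos n with h0 | hpos
  · exact derivative_of_natDegree_zero (Nat.le_zero.mp (h0 ▸ hm i))
  have hv0 : ∀ r : k, (fun i => (v i).eval r) ≠ 0 := by
    intro r hr
    have := congrArg (eval r) hy
    rw [eval_finsetSum] at this
    simp only [eval_mul, show ∀ i, (v i).eval r = 0 from congrFun hr] at this
    simp at this
  have hW : ∀ r : k, (W.map C).map (evalRingHom r) = W := by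
    intro r
    rw [WeierstrassCurve.map_map]
    convert W.map_id
    ext x
    simp
  -- Nonsingularity: the gradient has no zero along the curve, so its entries generate the unit
  -- ideal.
  have hN0 : ∀ r : k, (fun i => (gradient (W.map C) v i).eval r) ≠ 0 := by
    intro r hr
    have e : W.toProjective.Equation (fun i => (v i).eval r) := by
      have := h.map (evalRingHom r)
      rwa [WeierstrassCurve.Projective.map, hW] at this
    refine gradient_ne_zero W (hv0 r) e ?_
    rw [← hr]
    ext j
    have := gradient_map (evalRingHom r) (W.map C) v j
    rwa [hW] at this
  obtain ⟨x, hx⟩ := exists_bezout hN0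
  -- The curve is nonsingular at the value at infinity too, so some entry `l` of the gradient has
  -- degree at least `2n`.
  have hc0 : (fun i => (v i).coeff n) ≠ 0 := by
    intro hc
    have := congrFun hc m
    simp only [Pi.zero_apply, hn, coeff_natDegree, leadingCoeff_eq_zero] at this
    rw [hn, this, natDegree_zero] at hpos
    exact lt_irrefl _ hpos
  obtain ⟨l, hl⟩ := Function.ne_iff.mp (gradient_ne_zero W hc0 (equation_coeff W hm h))
  have hNl : n + n ≤ (gradient (W.map C) v l).natDegree := by
    refine le_natDegree_of_ne_zero ?_
    rw [gradient_coeff W hm]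
    exact hl
  set N := gradient (W.map C) v with hN
  have e1 := sum_gradient_mul_derivative W h
  have e2 := sum_gradient_mul_self _ h
  rw [← hN] at e1 e2
  -- The cross product of `v` and its derivative. The gradient is orthogonal to both, hence parallel
  -- to `c`.
  set c : Fin 3 → k[X] := ![v 1 * derivative (v 2) - v 2 * derivative (v 1),
    v 2 * derivative (v 0) - v 0 * derivative (v 2),
    v 0 * derivative (v 1) - v 1 * derivative (v 0)] with hc
  have hdeg : ∀ a b, (v a * derivative (v b)).natDegree ≤ n + n - 1 := by
    intro a b
    have h1 := natDegree_mul_le_of_le (hm a) ((natDegree_derivative_le (v b)).trans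
      (Nat.sub_le_sub_right (hm b) 1))
    omega
  have hcdeg : ∀ j, (c j).natDegree ≤ n + n - 1 := by
    intro j
    fin_cases j <;> exact (natDegree_sub_le_of_le (hdeg _ _) (hdeg _ _)).trans (max_self _).le
  simp only [Fin.sum_univ_three] at e1 e2 hx hy
  have hpar : ∀ a b, N a * c b = N b * c a := by
    have h01 : N 0 * c 1 = N 1 * c 0 := by
      simp only [hc, Matrix.cons_val]
      linear_combination v 2 * e1 - derivative (v 2) * e2
    have h02 : N 0 * c 2 = N 2 * c 0 := by
      simp only [hc, Matrix.cons_val]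
      linear_combination -v 1 * e1 + derivative (v 1) * e2
    have h12 : N 1 * c 2 = N 2 * c 1 := by
      simp only [hc, Matrix.cons_val]
      linear_combination v 0 * e1 - derivative (v 0) * e2
    exact mul_comm_of_cross h01 h02 h12
  -- The Bezout relation for the gradient turns parallelism into `c = w N` with a polynomial factor
  -- `w`.
  set w := x 0 * c 0 + x 1 * c 1 + x 2 * c 2 with hw
  have hcw : ∀ j, c j = N j * w := by
    intro j
    rw [hw]
    linear_combination (-c j) * hx + x 0 * hpar 0 j + x 1 * hpar 1 j + x 2 * hpar 2 j
  -- The degrees of the entries of `c` are at most `2n - 1`, whereas `N l` has degree at least `2n`.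
  have hw0 : w = 0 := by
    by_contra hw0
    have hNl0 : N l ≠ 0 := by
      intro h0
      rw [h0, natDegree_zero] at hNl
      omega
    have h1 := hcdeg l
    rw [hcw, natDegree_mul hNl0 hw0] at h1
    omega
  have hc' : ∀ j, c j = 0 := fun j => by rw [hcw, hw0, mul_zero]
  have c0 := hc' 0
  have c1 := hc' 1
  have c2 := hc' 2
  simp only [hc, Matrix.cons_val] at c0 c1 c2
  have hpar' : ∀ a b, v a * derivative (v b) = v b * derivative (v a) := by
    exact mul_comm_of_cross (y := fun i => derivative (v i)) (by linear_combination c2)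
      (by linear_combination -c1) (by linear_combination c0)
  -- Now `v` and its derivative are parallel and `v` is primitive, so the derivative is a multiple
  -- of `v`; its smaller degree makes it zero.
  have hdvd : v i ∣ derivative (v i) := by
    refine ⟨y 0 * derivative (v 0) + y 1 * derivative (v 1) + y 2 * derivative (v 2), ?_⟩
    linear_combination (-derivative (v i)) * hy + y 0 * hpar' 0 i + y 1 * hpar' 1 i + y 2 * hpar' 2 i
  by_contra hne
  have hvi : v i ≠ 0 := by
    intro h0
    exact hne (by rw [h0, derivative_zero])
  exact absurd (degree_le_of_dvd hdvd hne) (not_le.mpr (degree_derivative_lt hvi))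

/-- The derivative vanishes. In characteristic zero this makes `v` constant. In characteristic `p`
it gives `v = u(X ^ p)`, where `u` solves the same equation because `X ↦ X ^ p` is injective and
fixes the coefficients; as its degree is at most `n / p`, induction applies. -/
lemma eq_C_of_equation {k : Type*} [Field k] [IsAlgClosed k] (W : WeierstrassCurve k)
    [W.IsElliptic] (n : ℕ) {v y : Fin 3 → k[X]} (hn : ∀ i, (v i).natDegree ≤ n)
    (hy : ∑ i, y i * v i = 1) (h : (W.map C).toProjective.Equation v) :
    ∃ c : Fin 3 → k, v = C ∘ c := by
  induction n using Nat.strong_induction_on generalizing v y with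
  | _ n ih =>
  have hd := derivative_eq_zero_of_equation W hy h
  rcases Nat.eq_zero_or_pos n with h0 | hpos
  · exact ⟨fun i => (v i).coeff 0, funext fun i =>
      eq_C_of_natDegree_eq_zero (Nat.le_zero.mp (h0 ▸ hn i))⟩
  obtain ⟨p, hp⟩ := CharP.exists k
  rcases CharP.char_is_prime_or_zero k p with hp' | rfl
  · have := hp
    have : Fact p.Prime := ⟨hp'⟩
    set u : Fin 3 → k[X] := fun i => contract p (v i) with hu
    have hvu : ∀ i, v i = Polynomial.expand k p (u i) := fun i =>
      (expand_contract p (hd i) hp'.ne_zero).symm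
    have hue : (W.map C).toProjective.Equation u := by
      have hW : (W.map C).map (Polynomial.expand k p : k[X] →+* k[X]) = W.map C := by
        rw [WeierstrassCurve.map_map]
        congr 1
        ext x
        simp
      have hinj : Function.Injective (Polynomial.expand k p : k[X] →+* k[X]) := expand_injective hp'.pos
      rw [← WeierstrassCurve.Projective.map_equation (W.map C).toProjective hinj]
      rw [WeierstrassCurve.Projective.map, hW]
      convert h
      ext1 i
      exact (hvu i).symm
    -- Every `r` is a `p`-th power `s ^ p`, so a common zero `r` of `u` would give a common zero `s`
    -- of `v`.
    have hu0 : ∀ r : k, (fun i => (u i).eval r) ≠ 0 := by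
      intro r hr
      obtain ⟨s, hs⟩ := IsAlgClosed.exists_pow_nat_eq r hp'.pos
      have := congrArg (eval s) hy
      rw [eval_finsetSum] at this
      simp only [eval_mul, hvu, expand_eval, hs, show ∀ i, (u i).eval r = 0 from congrFun hr]
        at this
      simp at this
    obtain ⟨z, hz⟩ := exists_bezout hu0
    have hun : ∀ i, (u i).natDegree ≤ n / p := by
      intro i
      have := hn i
      rw [hvu, natDegree_expand] at this
      exact (Nat.le_div_iff_mul_le hp'.pos).mpr this
    obtain ⟨c, hc⟩ := ih (n / p) (Nat.div_lt_self hpos hp'.one_lt) hun hz hue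
    refine ⟨c, funext fun i => ?_⟩
    rw [hvu, hc]
    simp
  · have := CharP.charP_to_charZero k
    exact ⟨fun i => (v i).coeff 0, funext fun i =>
      eq_C_of_natDegree_eq_zero (derivative_eq_zero.mp (hd i))⟩

/-- There is no nonconstant rational curve on an elliptic curve. -/
theorem exists_const_of_equation {k : Type*} [Field k] [IsAlgClosed k] (W : WeierstrassCurve k)
    [W.IsElliptic] {v : Fin 3 → k[X]} (hv : v ≠ 0) (h : (W.map C).toProjective.Equation v) :
    ∃ (c : Fin 3 → k) (u : k[X]), c ≠ 0 ∧ u ≠ 0 ∧ ∀ i, v i = C (c i) * u := by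
  obtain ⟨g, w, y, hg0, hw, hy⟩ := exists_primitive hv
  have hwe : (W.map C).toProjective.Equation w := by
    rw [WeierstrassCurve.Projective.equation_iff] at h ⊢
    rw [hw] at h
    simp only [Pi.smul_apply, smul_eq_mul] at h
    refine mul_left_cancel₀ (pow_ne_zero 3 hg0) ?_
    linear_combination h
  obtain ⟨n, hn⟩ : ∃ n, ∀ i, (w i).natDegree ≤ n :=
    ⟨Finset.univ.sup fun i => (w i).natDegree, fun i =>
      Finset.le_sup (f := fun i => (w i).natDegree) (Finset.mem_univ i)⟩
  obtain ⟨c, hc⟩ := eq_C_of_equation W n hn hy hwe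
  refine ⟨c, g, ?_, hg0, fun i => by rw [hw, hc]; simp [mul_comm]⟩
  rintro rfl
  rw [hc] at hy
  simp at hy

end EllipticFormal

end

noncomputable section

namespace EllipticFormal

open scoped PowerSeries

universe u

/-! ### Addition laws -/

section Points

variable {F : Type*} [Field F] {W : WeierstrassCurve F}

lemma point_eq_iff {P Q : W.toProjective.Point} : P = Q ↔ P.point = Q.point :=
  ⟨fun h => h ▸ rfl, fun h => WeierstrassCurve.Projective.Point.ext h⟩

lemma mk_smul_eq {u : F} (hu : u ≠ 0) (q : Fin 3 → F) :
    (⟦u • q⟧ : WeierstrassCurve.Projective.PointClass F) = ⟦q⟧ :=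
  WeierstrassCurve.Projective.smul_eq q hu.isUnit

lemma mk_eq_mk_iff {p q : Fin 3 → F} :
    (⟦p⟧ : WeierstrassCurve.Projective.PointClass F) = ⟦q⟧ ↔ ∃ u : F, u ≠ 0 ∧ u • q = p := by
  rw [Quotient.eq]
  constructor
  · rintro ⟨u, hu⟩
    exact ⟨u, u.ne_zero, hu⟩
  · rintro ⟨u, hu, h⟩
    exact ⟨Units.mk0 u hu, h⟩

lemma nonsingular_of_point {P : W.toProjective.Point} {p : Fin 3 → F} (hP : P.point = ⟦p⟧) :
    W.toProjective.Nonsingular p := by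
  have := P.nonsingular
  rwa [hP] at this

lemma eq_zero_of_Z_eq_zero {P : W.toProjective.Point} {p : Fin 3 → F} (hP : P.point = ⟦p⟧)
    (hz : p 2 = 0) : P = 0 := by
  rw [point_eq_iff, hP, WeierstrassCurve.Projective.Point.zero_point, Quotient.eq]
  exact WeierstrassCurve.Projective.equiv_zero_of_Z_eq_zero (nonsingular_of_point hP) hz

lemma toAffineLift_of_point {P : W.toProjective.Point} {p : Fin 3 → F} (hP : P.point = ⟦p⟧)
    (hz : p 2 ≠ 0) : ∃ h : W.toAffine.Nonsingular (p 0 / p 2) (p 1 / p 2),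
      P.toAffineLift = .some _ _ h := by
  obtain ⟨h⟩ := P
  subst hP
  exact ⟨_, WeierstrassCurve.Projective.Point.toAffineLift_of_Z_ne_zero hz⟩

lemma toAffineLift_injective :
    Function.Injective (WeierstrassCurve.Projective.Point.toAffineLift (W := W.toProjective)) := by
  classical
  exact (WeierstrassCurve.Projective.Point.toAffineAddEquiv W.toProjective).injective

lemma point_of_toAffineLift {P : W.toProjective.Point} {x y : F} {h : W.toAffine.Nonsingular x y}
    (hP : P.toAffineLift = .some x y h) : P.point = ⟦![x, y, 1]⟧ := by
  classical
  have h1 := (WeierstrassCurve.Projective.Point.toAffineAddEquiv W.toProjective).left_inv P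
  rw [← h1]
  simp only [WeierstrassCurve.Projective.Point.toAffineAddEquiv]
  rw [hP]
  rfl

end Points

/-! ### Chords and tangents in affine coordinates. -/

section Slope

variable {F : Type*} [Field F] [DecidableEq F] {W : WeierstrassCurve F}

/-- A characterization of the slope that is uniform for chords and tangents. -/
lemma slope_eq_of {x₁ x₂ y₁ y₂ l : F} (h₁ : W.toAffine.Equation x₁ y₁)
    (h₂ : W.toAffine.Equation x₂ y₂) (hxy : ¬(x₁ = x₂ ∧ y₁ = W.toAffine.negY x₂ y₂))
    (hc : y₁ - y₂ = l * (x₁ - x₂))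
    (ht : l * (y₁ + y₂ + W.a₁ * x₂ + W.a₃) =
      x₁ ^ 2 + x₁ * x₂ + x₂ ^ 2 + W.a₂ * (x₁ + x₂) + W.a₄ - W.a₁ * y₁) :
    W.toAffine.slope x₁ x₂ y₁ y₂ = l := by
  by_cases hx : x₁ = x₂
  · have hy : y₁ ≠ W.toAffine.negY x₂ y₂ := fun h => hxy ⟨hx, h⟩
    have hy' := WeierstrassCurve.Affine.Y_eq_of_Y_ne h₁ h₂ hx hy
    rw [WeierstrassCurve.Affine.slope_of_Y_ne hx hy]
    subst hx hy'
    rw [div_eq_iff (sub_ne_zero.mpr hy)]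
    simp only [WeierstrassCurve.Affine.negY]
    linear_combination -ht
  · rw [WeierstrassCurve.Affine.slope_of_X_ne hx, hc, mul_div_cancel_right₀ _ (sub_ne_zero.mpr hx)]

/-- Three points in which a line of finite slope meets the curve add up to zero. -/
lemma add_eq_neg_of_line {x₁ x₂ x₃ l μ : F}
    {h₁ : W.toAffine.Nonsingular x₁ (l * x₁ + μ)} {h₂ : W.toAffine.Nonsingular x₂ (l * x₂ + μ)}
    {h₃ : W.toAffine.Nonsingular x₃ (l * x₃ + μ)}
    (e₁ : x₁ + x₂ + x₃ = l ^ 2 + W.a₁ * l - W.a₂)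
    (e₂ : x₁ * x₂ + x₁ * x₃ + x₂ * x₃ = -(2 * l * μ + W.a₁ * μ + W.a₃ * l - W.a₄)) :
    (.some _ _ h₁ + .some _ _ h₂ : W.toAffine.Point) = -.some _ _ h₃ := by
  -- This results from eliminating `x₃` from the two symmetric functions.
  have ht : l * ((l * x₁ + μ) + (l * x₂ + μ) + W.a₁ * x₂ + W.a₃) =
      x₁ ^ 2 + x₁ * x₂ + x₂ ^ 2 + W.a₂ * (x₁ + x₂) + W.a₄ - W.a₁ * (l * x₁ + μ) := by
    linear_combination e₂ - (x₁ + x₂) * e₁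
  by_cases hxy : x₁ = x₂ ∧ l * x₁ + μ = W.toAffine.negY x₂ (l * x₂ + μ)
  -- If the first two points were opposite with equal abscissas, `ht` would make both partial
  -- derivatives vanish at the first one.
  · exfalso
    obtain ⟨rfl, hy⟩ := hxy
    simp only [WeierstrassCurve.Affine.negY] at hy
    have hns := (WeierstrassCurve.Affine.nonsingular_iff' _ _).mp h₁
    rcases hns.2 with h | h
    · refine h ?_
      linear_combination ht - l * hy
    · refine h ?_
      linear_combination hy
  · have hs := slope_eq_of h₁.1 h₂.1 hxy (by ring) ht
    rw [WeierstrassCurve.Affine.Point.add_some hxy, WeierstrassCurve.Affine.Point.neg_some]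
    have hX : W.toAffine.addX x₁ x₂ (W.toAffine.slope x₁ x₂ (l * x₁ + μ) (l * x₂ + μ)) = x₃ := by
      rw [hs, WeierstrassCurve.Affine.addX]
      linear_combination -e₁
    have hY : W.toAffine.addY x₁ x₂ (l * x₁ + μ)
        (W.toAffine.slope x₁ x₂ (l * x₁ + μ) (l * x₂ + μ)) =
        W.toAffine.negY x₃ (l * x₃ + μ) := by
      rw [WeierstrassCurve.Affine.addY, WeierstrassCurve.Affine.negAddY, hX, hs]
      congr 1
      ring
    simp only [hX, hY]

end Slope

/-! ### Collinear points in the chart at the origin. -/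

section Collinear

variable {F : Type*} [Field F] {W : WeierstrassCurve F}

lemma equation_chart {t s : F} : W.toProjective.Equation ![t, -1, s] ↔
    s = t ^ 3 + W.a₁ * t * s + W.a₂ * t ^ 2 * s + W.a₃ * s ^ 2 + W.a₄ * t * s ^ 2
      + W.a₆ * s ^ 3 := by
  rw [WeierstrassCurve.Projective.equation_iff]
  simp only [Matrix.cons_val]
  constructor <;> intro h <;> linear_combination h

/-- The line `s = m t` has a third intersection with the curve at the origin. For `m ≠ 0` it is the
vertical line `x = 1 / m`, which meets the curve in opposite points; for `m = 0` both points are the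
origin itself. -/
lemma add_eq_zero_of_line_through_origin {m : F} (hA : 1 + W.a₂ * m + W.a₄ * m ^ 2 + W.a₆ * m ^ 3 ≠ 0)
    {t₁ t₂ : F} {P₁ P₂ : W.toProjective.Point}
    (h₁ : P₁.point = ⟦![t₁, -1, m * t₁]⟧) (h₂ : P₂.point = ⟦![t₂, -1, m * t₂]⟧)
    (e₁ : (1 + W.a₂ * m + W.a₄ * m ^ 2 + W.a₆ * m ^ 3) * (t₁ + t₂) =
      -(W.a₁ * m + W.a₃ * m ^ 2))
    (e₂ : (1 + W.a₂ * m + W.a₄ * m ^ 2 + W.a₆ * m ^ 3) * (t₁ * t₂) = -m) : P₁ + P₂ = 0 := by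
  classical
  set A := 1 + W.a₂ * m + W.a₄ * m ^ 2 + W.a₆ * m ^ 3 with hAdef
  by_cases hm : m = 0
  · rw [eq_zero_of_Z_eq_zero h₁ (by simp [hm]), eq_zero_of_Z_eq_zero h₂ (by simp [hm]), add_zero]
  · have ht : t₁ * t₂ ≠ 0 := fun h => hm (by rw [h] at e₂; linear_combination e₂)
    have ht₁ := left_ne_zero_of_mul ht
    have ht₂ := right_ne_zero_of_mul ht
    obtain ⟨n₁, l₁⟩ := toAffineLift_of_point h₁ (by simp [hm, ht₁])
    obtain ⟨n₂, l₂⟩ := toAffineLift_of_point h₂ (by simp [hm, ht₂])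
    apply toAffineLift_injective
    rw [WeierstrassCurve.Projective.Point.toAffineLift_add, l₁, l₂,
      WeierstrassCurve.Projective.Point.toAffineLift_zero]
    refine WeierstrassCurve.Affine.Point.add_of_Y_eq ?_ ?_
    · simp only [Matrix.cons_val]
      field_simp
    · simp only [WeierstrassCurve.Affine.negY, Matrix.cons_val]
      field_simp
      refine mul_left_cancel₀ hA ?_
      refine mul_left_cancel₀ hm ?_
      linear_combination -m * e₁ + (m * W.a₁ + m ^ 2 * W.a₃) * e₂

/-- Three points in which a line meets the curve in the chart `t = -X/Y`, `s = -Z/Y` add up to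
zero. -/
lemma add_eq_zero_of_collinear {m b t₁ t₂ t₃ : F} {P₁ P₂ P₃ : W.toProjective.Point}
    (hA : 1 + W.a₂ * m + W.a₄ * m ^ 2 + W.a₆ * m ^ 3 ≠ 0)
    (h₁ : P₁.point = ⟦![t₁, -1, m * t₁ + b]⟧) (h₂ : P₂.point = ⟦![t₂, -1, m * t₂ + b]⟧)
    (h₃ : P₃.point = ⟦![t₃, -1, m * t₃ + b]⟧)
    (e₁ : (1 + W.a₂ * m + W.a₄ * m ^ 2 + W.a₆ * m ^ 3) * (t₁ + t₂ + t₃) =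
      -(W.a₁ * m + W.a₂ * b + W.a₃ * m ^ 2 + 2 * W.a₄ * m * b + 3 * W.a₆ * m ^ 2 * b))
    (e₂ : (1 + W.a₂ * m + W.a₄ * m ^ 2 + W.a₆ * m ^ 3) * (t₁ * t₂ + t₁ * t₃ + t₂ * t₃) =
      W.a₁ * b + 2 * W.a₃ * m * b + W.a₄ * b ^ 2 + 3 * W.a₆ * m * b ^ 2 - m)
    (e₃ : (1 + W.a₂ * m + W.a₄ * m ^ 2 + W.a₆ * m ^ 3) * (t₁ * t₂ * t₃) =
      -(W.a₃ * b ^ 2 + W.a₆ * b ^ 3 - b)) : P₁ + P₂ + P₃ = 0 := by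
  classical
  by_cases hb : b = 0
  -- The line passes through the origin. By `e₃` one of the points is the origin, and the other two
  -- are opposite.
  · subst hb
    simp only [add_zero] at h₁ h₂ h₃
    rw [show -(W.a₃ * 0 ^ 2 + W.a₆ * 0 ^ 3 - 0) = 0 by ring] at e₃
    have h := (mul_eq_zero.mp e₃).resolve_left hA
    rcases mul_eq_zero.mp h with h | rfl
    · rcases mul_eq_zero.mp h with rfl | rfl
      · rw [eq_zero_of_Z_eq_zero h₁ (by simp), zero_add]
        exact add_eq_zero_of_line_through_origin hA h₂ h₃ (by linear_combination e₁)
          (by linear_combination e₂)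
      · rw [eq_zero_of_Z_eq_zero h₂ (by simp), add_zero]
        exact add_eq_zero_of_line_through_origin hA h₁ h₃ (by linear_combination e₁)
          (by linear_combination e₂)
    · rw [eq_zero_of_Z_eq_zero h₃ (by simp), add_zero]
      exact add_eq_zero_of_line_through_origin hA h₁ h₂ (by linear_combination e₁)
        (by linear_combination e₂)
  -- For `b ≠ 0` this product shows that no point is the origin. With `x = t / s`, `y = -1 / s` the
  -- line becomes `y = (m / b) x - 1 / b`, and `f₁`, `f₂` below supply the symmetric functions of
  -- the abscissas.
  · have hs : (1 + W.a₂ * m + W.a₄ * m ^ 2 + W.a₆ * m ^ 3) *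
        ((m * t₁ + b) * (m * t₂ + b) * (m * t₃ + b)) = b ^ 3 := by
      linear_combination m ^ 3 * e₃ + m ^ 2 * b * e₂ + m * b ^ 2 * e₁
    have hs0 := right_ne_zero_of_mul (hs ▸ pow_ne_zero 3 hb)
    have s₃ := right_ne_zero_of_mul hs0
    have s₁ := left_ne_zero_of_mul (left_ne_zero_of_mul hs0)
    have s₂ := right_ne_zero_of_mul (left_ne_zero_of_mul hs0)
    obtain ⟨n₁, l₁⟩ := toAffineLift_of_point h₁ (by simpa using s₁)
    obtain ⟨n₂, l₂⟩ := toAffineLift_of_point h₂ (by simpa using s₂)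
    obtain ⟨n₃, l₃⟩ := toAffineLift_of_point h₃ (by simpa using s₃)
    simp only [Matrix.cons_val] at n₁ n₂ n₃ l₁ l₂ l₃
    have hy : ∀ t : F, m * t + b ≠ 0 → -1 / (m * t + b) = m / b * (t / (m * t + b)) + -1 / b := by
      intro t ht
      field_simp
      ring
    simp only [hy t₁ s₁] at n₁ l₁
    simp only [hy t₂ s₂] at n₂ l₂
    simp only [hy t₃ s₃] at n₃ l₃
    apply toAffineLift_injective
    rw [WeierstrassCurve.Projective.Point.toAffineLift_add,
      WeierstrassCurve.Projective.Point.toAffineLift_add, l₁, l₂, l₃,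
      WeierstrassCurve.Projective.Point.toAffineLift_zero, ← eq_neg_iff_add_eq_zero]
    set u₁ := m * t₁ + b with hu₁
    set u₂ := m * t₂ + b with hu₂
    set u₃ := m * t₃ + b with hu₃
    set A := 1 + W.a₂ * m + W.a₄ * m ^ 2 + W.a₆ * m ^ 3 with hAdef
    have f₁ : A * (t₁ * u₂ * u₃ + t₂ * u₁ * u₃ + t₃ * u₁ * u₂) =
        m ^ 2 * b + W.a₁ * m * b ^ 2 - W.a₂ * b ^ 3 := by
      rw [hu₁, hu₂, hu₃]
      linear_combination 3 * m ^ 2 * e₃ + 2 * m * b * e₂ + b ^ 2 * e₁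
    have f₂ : A * (t₁ * t₂ * u₃ + t₁ * t₃ * u₂ + t₂ * t₃ * u₁) =
        2 * m * b - W.a₃ * m * b ^ 2 + W.a₁ * b ^ 2 + W.a₄ * b ^ 3 := by
      rw [hu₁, hu₂, hu₃]
      linear_combination 3 * m * e₃ + b * e₂
    apply add_eq_neg_of_line
    · have : t₁ / u₁ + t₂ / u₂ + t₃ / u₃ =
          (A * (t₁ * u₂ * u₃ + t₂ * u₁ * u₃ + t₃ * u₁ * u₂)) / (A * (u₁ * u₂ * u₃)) := by
        field_simp
      rw [this, f₁, hs]
      field_simp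
    · have : t₁ / u₁ * (t₂ / u₂) + t₁ / u₁ * (t₃ / u₃) + t₂ / u₂ * (t₃ / u₃) =
          (A * (t₁ * t₂ * u₃ + t₁ * t₃ * u₂ + t₂ * t₃ * u₁)) / (A * (u₁ * u₂ * u₃)) := by
        field_simp
      rw [this, f₂, hs]
      field_simp
      ring

end Collinear

/-- Bihomogeneous polynomial formulas, with coefficients that depend on a Weierstrass curve, which
compute the sum of two points of an elliptic curve over a field whenever they do not all vanish. -/
structure IsAddLaw (e : ℕ)
    (L : ∀ {R : Type u} [CommRing R], WeierstrassCurve R → (Fin 3 → R) → (Fin 3 → R) → Fin 3 → R) :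
    Prop where
  pos : 0 < e
  map : ∀ {R S : Type u} [CommRing R] [CommRing S] (φ : R →+* S) (W : WeierstrassCurve R)
    (p q : Fin 3 → R), L (W.map φ) (φ ∘ p) (φ ∘ q) = φ ∘ L W p q
  smul : ∀ {R : Type u} [CommRing R] (W : WeierstrassCurve R) (a b : R) (p q : Fin 3 → R),
    L W (a • p) (b • q) = (a * b) ^ e • L W p q
  add_point : ∀ {F : Type u} [Field F] (W : WeierstrassCurve F) [W.IsElliptic] {P Q : W.toProjective.Point}
    {p q : Fin 3 → F}, P.point = ⟦p⟧ → Q.point = ⟦q⟧ → L W p q ≠ 0 → (P + Q).point = ⟦L W p q⟧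

/-- The chord formula. -/
def chordLaw {R : Type u} [CommRing R] (W : WeierstrassCurve R) (p q : Fin 3 → R) : Fin 3 → R :=
  W.toProjective.addXYZ p q

/-- The chord formula vanishes on proportional triples, so wherever it is nonzero the points are
distinct and it computes the sum. -/
lemma isAddLaw_chordLaw : IsAddLaw.{u} 2 chordLaw where
  pos := by norm_num
  map φ W p q := WeierstrassCurve.Projective.map_addXYZ φ p q
  smul W a b p q := WeierstrassCurve.Projective.addXYZ_smul p q a b
  add_point W _ P Q p q hP hQ h := by
    rw [WeierstrassCurve.Projective.Point.add_point, hP, hQ,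
      WeierstrassCurve.Projective.addMap_eq, WeierstrassCurve.Projective.add_of_not_equiv]
    · rfl
    · rintro ⟨a, rfl⟩
      refine h ?_
      have := WeierstrassCurve.Projective.addXYZ_smul (W' := W.toProjective) q q (a : _) 1
      rw [one_smul, WeierstrassCurve.Projective.addXYZ_self] at this
      refine Eq.trans this ?_
      ext i
      fin_cases i <;> simp

/-- For distinct points the formula yields a nonsingular triple, and the zero triple is not
nonsingular. -/
lemma chordLaw_ne_zero {F : Type u} [Field F] (W : WeierstrassCurve F) {P Q : W.toProjective.Point}
    {p q : Fin 3 → F} (hP : P.point = ⟦p⟧) (hQ : Q.point = ⟦q⟧) (h : P ≠ Q) :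
    chordLaw W p q ≠ 0 := by
  have := WeierstrassCurve.Projective.nonsingular_add (nonsingular_of_point hP)
    (nonsingular_of_point hQ)
  rw [WeierstrassCurve.Projective.add_of_not_equiv fun h0 =>
    h (point_eq_iff.mpr (by rw [hP, hQ, Quotient.eq]; exact h0))] at this
  intro h0
  change W.toProjective.addXYZ p q = 0 at h0
  rw [h0, WeierstrassCurve.Projective.nonsingular_iff] at this
  simp at this

/-- The numerator of the slope of the chord or tangent. -/
def slopeNum {R : Type u} [CommRing R] (W : WeierstrassCurve R) (p q : Fin 3 → R) : R :=
  p 0 ^ 2 * q 2 ^ 2 + p 0 * q 0 * p 2 * q 2 + q 0 ^ 2 * p 2 ^ 2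
    + W.a₂ * (p 0 * q 2 + q 0 * p 2) * p 2 * q 2 + W.a₄ * p 2 ^ 2 * q 2 ^ 2
    - W.a₁ * p 1 * p 2 * q 2 ^ 2

/-- The denominator of the slope of the chord or tangent. -/
def slopeDen {R : Type u} [CommRing R] (W : WeierstrassCurve R) (p q : Fin 3 → R) : R :=
  (p 1 * q 2 + q 1 * p 2 + W.a₁ * q 0 * p 2 + W.a₃ * p 2 * q 2) * p 2 * q 2

/-- An addition law that is defined on the diagonal, except at the origin. -/
def tangentLaw {R : Type u} [CommRing R] (W : WeierstrassCurve R) (p q : Fin 3 → R) : Fin 3 → R :=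
  let n := slopeNum W p q
  let d := slopeDen W p q
  let x := d * (n ^ 2 * p 2 * q 2 + W.a₁ * n * d * p 2 * q 2
    - (W.a₂ * p 2 * q 2 + p 0 * q 2 + q 0 * p 2) * d ^ 2)
  let z := d ^ 3 * p 2 * q 2
  ![x, -n * (n ^ 2 + W.a₁ * n * d - W.a₂ * d ^ 2) * p 2 * q 2
      + n * d ^ 2 * (2 * p 0 * q 2 + q 0 * p 2) - p 1 * q 2 * d ^ 3 - W.a₁ * x - W.a₃ * z, z]

lemma toAffineLift_eq_some {F : Type u} [Field F] {W : WeierstrassCurve F}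
    {P : W.toProjective.Point} {x y : F} (hP : P.point = ⟦![x, y, 1]⟧) :
    ∃ h : W.toAffine.Nonsingular x y, P.toAffineLift = .some _ _ h := by
  obtain ⟨h, e⟩ := toAffineLift_of_point hP (by simp)
  simp only [Matrix.cons_val, div_one] at h e
  exact ⟨h, e⟩

/-- The relation `d (y₁ - y₂) = n (x₁ - x₂)` holds on the curve, so for `d ≠ 0` the quotient `n / d`
is the slope of the chord or tangent. For `d = 0` the law is nonzero only if `n ≠ 0`; then the
points are opposite and the law returns `(0, -n ^ 3, 0)`. -/
lemma tangentLaw_add_point {F : Type u} [Field F] {W : WeierstrassCurve F}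
    {P Q : W.toProjective.Point} {x₁ y₁ x₂ y₂ : F} (hP : P.point = ⟦![x₁, y₁, 1]⟧)
    (hQ : Q.point = ⟦![x₂, y₂, 1]⟧) (h : tangentLaw W ![x₁, y₁, 1] ![x₂, y₂, 1] ≠ 0) :
    (P + Q).point = ⟦tangentLaw W ![x₁, y₁, 1] ![x₂, y₂, 1]⟧ := by
  classical
  obtain ⟨h₁, l₁⟩ := toAffineLift_eq_some hP
  obtain ⟨h₂, l₂⟩ := toAffineLift_eq_some hQ
  set n := slopeNum W ![x₁, y₁, 1] ![x₂, y₂, 1] with hn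
  set d := slopeDen W ![x₁, y₁, 1] ![x₂, y₂, 1] with hd
  have hL : tangentLaw W ![x₁, y₁, 1] ![x₂, y₂, 1] =
      ![d * (n ^ 2 + W.a₁ * n * d - (W.a₂ + x₁ + x₂) * d ^ 2),
        -n * (n ^ 2 + W.a₁ * n * d - W.a₂ * d ^ 2) + n * d ^ 2 * (2 * x₁ + x₂) - y₁ * d ^ 3
          - W.a₁ * (d * (n ^ 2 + W.a₁ * n * d - (W.a₂ + x₁ + x₂) * d ^ 2)) - W.a₃ * d ^ 3,
        d ^ 3] := by
    simp only [tangentLaw, ← hn, ← hd, Matrix.cons_val]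
    ring_nf
  simp only [slopeNum, Matrix.cons_val] at hn
  simp only [slopeDen, Matrix.cons_val] at hd
  have E₁ := (WeierstrassCurve.Affine.equation_iff _ _).mp h₁.1
  have E₂ := (WeierstrassCurve.Affine.equation_iff _ _).mp h₂.1
  have hnd : d * (y₁ - y₂) = n * (x₁ - x₂) := by
    rw [hn, hd]
    linear_combination E₁ - E₂
  rw [hL] at h ⊢
  by_cases hd0 : d = 0
  · have hn0 : n ≠ 0 := by
      rintro hn0
      refine h ?_
      rw [hd0, hn0]
      ext i
      fin_cases i <;> simp
    have hx : x₁ = x₂ := by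
      rw [hd0, zero_mul] at hnd
      exact sub_eq_zero.mp ((mul_eq_zero.mp hnd.symm).resolve_left hn0)
    have hs : P + Q = 0 := by
      apply toAffineLift_injective
      rw [WeierstrassCurve.Projective.Point.toAffineLift_add, l₁, l₂,
        WeierstrassCurve.Projective.Point.toAffineLift_zero]
      refine WeierstrassCurve.Affine.Point.add_of_Y_eq hx ?_
      rw [WeierstrassCurve.Affine.negY]
      rw [hd0] at hd
      linear_combination -hd
    rw [hs, WeierstrassCurve.Projective.Point.zero_point, mk_eq_mk_iff]
    refine ⟨(-n ^ 3)⁻¹, inv_ne_zero (neg_ne_zero.mpr (pow_ne_zero 3 hn0)), ?_⟩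
    rw [hd0]
    ext i
    fin_cases i
    · simp
    · simp only [Pi.smul_apply, smul_eq_mul, Fin.mk_one, Matrix.cons_val]
      field_simp
      ring
    · simp
  · have hxy : ¬(x₁ = x₂ ∧ y₁ = W.toAffine.negY x₂ y₂) := by
      rintro ⟨-, hy⟩
      refine hd0 ?_
      rw [hd, hy, WeierstrassCurve.Affine.negY]
      ring
    have hs : W.toAffine.slope x₁ x₂ y₁ y₂ = n / d := by
      refine slope_eq_of h₁.1 h₂.1 hxy ?_ ?_
      · field_simp
        linear_combination hnd
      · rw [show y₁ + y₂ + W.a₁ * x₂ + W.a₃ = d by rw [hd]; ring, div_mul_cancel₀ _ hd0, hn]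
        ring
    have hsum := WeierstrassCurve.Projective.Point.toAffineLift_add P Q
    rw [l₁, l₂, WeierstrassCurve.Affine.Point.add_some hxy] at hsum
    rw [point_of_toAffineLift hsum, mk_eq_mk_iff]
    refine ⟨(d ^ 3)⁻¹, inv_ne_zero (pow_ne_zero 3 hd0), ?_⟩
    ext i
    fin_cases i
    · simp only [hs, Pi.smul_apply, smul_eq_mul, Fin.zero_eta, Matrix.cons_val,
        WeierstrassCurve.Affine.addX]
      field_simp
      ring
    · simp only [hs, Pi.smul_apply, smul_eq_mul, Fin.mk_one, Matrix.cons_val,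
        WeierstrassCurve.Affine.addX, WeierstrassCurve.Affine.addY,
        WeierstrassCurve.Affine.negAddY, WeierstrassCurve.Affine.negY]
      field_simp
      ring
    · simp [hd0]

lemma eq_smul_affine {F : Type u} [Field F] {p : Fin 3 → F} (hz : p 2 ≠ 0) :
    p = p 2 • ![p 0 / p 2, p 1 / p 2, 1] := by
  ext i
  fin_cases i <;> simp [mul_div_cancel₀ _ hz]

/-- Numerator and denominator have bidegree `(2, 2)`, and each coordinate has degree three in them
with an additional factor of bidegree `(1, 1)`. -/
lemma tangentLaw_smul {R : Type u} [CommRing R] (W : WeierstrassCurve R) (a b : R)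
    (p q : Fin 3 → R) : tangentLaw W (a • p) (b • q) = (a * b) ^ 7 • tangentLaw W p q := by
  have hn : slopeNum W (a • p) (b • q) = (a * b) ^ 2 * slopeNum W p q := by
    simp only [slopeNum, Pi.smul_apply, smul_eq_mul]
    ring
  have hd : slopeDen W (a • p) (b • q) = (a * b) ^ 2 * slopeDen W p q := by
    simp only [slopeDen, Pi.smul_apply, smul_eq_mul]
    ring
  ext i
  simp only [tangentLaw, hn, hd]
  generalize slopeNum W p q = n
  generalize slopeDen W p q = d
  fin_cases i <;> simp only [Pi.smul_apply, smul_eq_mul, Fin.zero_eta, Fin.mk_one, Fin.reduceFinMk,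
    Matrix.cons_val] <;> ring

lemma isAddLaw_tangentLaw : IsAddLaw.{u} 7 tangentLaw where
  pos := by norm_num
  map φ W p q := by
    ext i
    fin_cases i <;> simp only [tangentLaw, slopeNum, slopeDen, Function.comp_apply,
      WeierstrassCurve.map_a₁, WeierstrassCurve.map_a₂, WeierstrassCurve.map_a₃,
      WeierstrassCurve.map_a₄, Matrix.cons_val, map_add, map_sub, map_mul, map_pow, map_neg,
      map_ofNat, Fin.zero_eta, Fin.mk_one, Fin.reduceFinMk]
  smul := tangentLaw_smul
  add_point W _ P Q p q hP hQ h := by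
    have hp : p 2 ≠ 0 := by
      intro hz
      have hx := WeierstrassCurve.Projective.X_eq_zero_of_Z_eq_zero (nonsingular_of_point hP).1 hz
      refine h ?_
      ext i
      fin_cases i <;> simp [tangentLaw, slopeNum, slopeDen, hz, hx]
    have hq : q 2 ≠ 0 := by
      intro hz
      have hx := WeierstrassCurve.Projective.X_eq_zero_of_Z_eq_zero (nonsingular_of_point hQ).1 hz
      refine h ?_
      ext i
      fin_cases i <;> simp [tangentLaw, slopeNum, slopeDen, hz, hx]
    have hu : (p 2 * q 2) ^ 7 ≠ 0 := pow_ne_zero 7 (mul_ne_zero hp hq)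
    rw [eq_smul_affine hp, mk_smul_eq hp] at hP
    rw [eq_smul_affine hq, mk_smul_eq hq] at hQ
    rw [eq_smul_affine hp, eq_smul_affine hq, tangentLaw_smul] at h ⊢
    rw [mk_smul_eq hu]
    exact tangentLaw_add_point hP hQ fun h0 => h (by rw [h0, smul_zero])

/-- The tangent law is defined at `(P, P)` for `P` different from the origin. -/
lemma tangentLaw_ne_zero {F : Type u} [Field F] (W : WeierstrassCurve F) {P : W.toProjective.Point}
    {p q : Fin 3 → F} (hP : P.point = ⟦p⟧) (hQ : P.point = ⟦q⟧) (h0 : P ≠ 0) :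
    tangentLaw W p q ≠ 0 := by
  have hp : p 2 ≠ 0 := fun hz => h0 (eq_zero_of_Z_eq_zero hP hz)
  obtain ⟨a, ha, rfl⟩ := mk_eq_mk_iff.mp (hQ.symm.trans hP)
  have hP' := hP
  rw [eq_smul_affine hp, mk_smul_eq hp] at hP'
  obtain ⟨h₁, -⟩ := toAffineLift_eq_some hP'
  set x := p 0 / p 2
  set y := p 1 / p 2
  have h₁ := (WeierstrassCurve.Affine.nonsingular_iff' _ _).mp h₁
  intro h
  have e : tangentLaw W ((p 2) • ![x, y, 1]) ((a * p 2) • ![x, y, 1]) = 0 := by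
    rw [mul_smul, ← eq_smul_affine hp, h]
  rw [tangentLaw_smul, smul_eq_zero] at e
  replace e := e.resolve_left (pow_ne_zero 7 (mul_ne_zero hp (mul_ne_zero ha hp)))
  have ez := congrFun e 2
  have ey := congrFun e 1
  simp only [tangentLaw, Matrix.cons_val, Pi.zero_apply, mul_one] at ez ey
  have hd : slopeDen W ![x, y, 1] ![x, y, 1] = 0 := by simpa using ez
  rw [hd] at ey
  have hn : slopeNum W ![x, y, 1] ![x, y, 1] = 0 := by
    refine pow_eq_zero_iff (n := 3) (by norm_num) |>.mp ?_
    linear_combination -ey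
  simp only [slopeDen, slopeNum, Matrix.cons_val] at hd hn
  -- On the diagonal `n` and `d` are, up to sign, the two partial derivatives of the affine
  -- equation.
  rcases h₁.2 with h | h
  · exact h (by linear_combination -hn)
  · exact h (by linear_combination hd)

/-! ### The addition law near the origin. -/

section OriginLaw

variable {R : Type u} [CommRing R] (W : WeierstrassCurve R) (p q : Fin 3 → R)

/-- The homogenized numerator of the slope in the coordinates `t = -X/Y`, `s = -Z/Y`. -/
def chartNum : R :=
  p 0 ^ 2 * q 1 ^ 2 + p 0 * q 0 * p 1 * q 1 + q 0 ^ 2 * p 1 ^ 2 - W.a₁ * p 2 * p 1 * q 1 ^ 2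
    + W.a₂ * (p 0 * q 1 + q 0 * p 1) * p 2 * q 1 + W.a₄ * p 2 ^ 2 * q 1 ^ 2

/-- The homogenized denominator of the slope in the coordinates `t = -X/Y`, `s = -Z/Y`. -/
def chartDen : R :=
  p 1 ^ 2 * q 1 ^ 2 + W.a₁ * q 0 * q 1 * p 1 ^ 2 - W.a₂ * q 0 ^ 2 * p 1 ^ 2
    + W.a₃ * (p 2 * q 1 + q 2 * p 1) * p 1 * q 1 - W.a₄ * q 0 * (p 2 * q 1 + q 2 * p 1) * p 1
    - W.a₆ * (p 2 ^ 2 * q 1 ^ 2 + p 2 * q 2 * p 1 * q 1 + q 2 ^ 2 * p 1 ^ 2)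

/-- The homogenized intercept of the line. -/
def chartIntercept : R := p 0 * chartNum W p q - p 2 * chartDen W p q

/-- The homogenized leading coefficient of the cubic polynomial on the line. -/
def chartLead : R :=
  chartDen W p q ^ 3 + W.a₂ * chartNum W p q * chartDen W p q ^ 2
    + W.a₄ * chartNum W p q ^ 2 * chartDen W p q + W.a₆ * chartNum W p q ^ 3

/-- The homogenized `t`-coordinate of the third point on the line. -/
def chartThird : R :=
  (p 0 * q 1 + q 0 * p 1) * chartLead W p q
    - p 1 * q 1 * (W.a₁ * chartNum W p q * chartDen W p q ^ 2
      + W.a₃ * chartNum W p q ^ 2 * chartDen W p q)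
    - q 1 * (W.a₂ * chartDen W p q ^ 2 + 2 * W.a₄ * chartNum W p q * chartDen W p q
      + 3 * W.a₆ * chartNum W p q ^ 2) * chartIntercept W p q

/-- The homogenized `s`-coordinate of the third point on the line. -/
def chartThird' : R :=
  chartNum W p q * chartThird W p q + q 1 * chartIntercept W p q * chartLead W p q

/-- An addition law that is defined in a neighbourhood of the origin. -/
def originLaw : Fin 3 → R :=
  (p 1 * q 1 * chartLead W p q * chartDen W p q) •
    ![chartDen W p q * chartThird W p q,
      p 1 * q 1 * chartLead W p q * chartDen W p q - W.a₁ * (chartDen W p q * chartThird W p q)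
        - W.a₃ * chartThird' W p q,
      chartThird' W p q]

end OriginLaw

lemma originLaw_map {R S : Type u} [CommRing R] [CommRing S] (φ : R →+* S) (W : WeierstrassCurve R)
    (p q : Fin 3 → R) : originLaw (W.map φ) (φ ∘ p) (φ ∘ q) = φ ∘ originLaw W p q := by
  ext i
  fin_cases i <;> simp only [originLaw, chartThird', chartThird, chartLead, chartIntercept,
    chartDen, chartNum, Function.comp_apply, WeierstrassCurve.map_a₁, WeierstrassCurve.map_a₂,
    WeierstrassCurve.map_a₃, WeierstrassCurve.map_a₄, WeierstrassCurve.map_a₆, Matrix.cons_val,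
    Pi.smul_apply, smul_eq_mul, map_add, map_sub, map_mul, map_pow, map_ofNat, Fin.zero_eta,
    Fin.mk_one, Fin.reduceFinMk]

/-- The scalar factor and the triple both have bidegree `(9, 9)`. The auxiliary intercept has the
asymmetric bidegree `(3, 2)`, which the factors `q 1` compensate. -/
lemma originLaw_smul {R : Type u} [CommRing R] (W : WeierstrassCurve R) (a b : R)
    (p q : Fin 3 → R) : originLaw W (a • p) (b • q) = (a * b) ^ 18 • originLaw W p q := by
  have hn : chartNum W (a • p) (b • q) = (a * b) ^ 2 * chartNum W p q := by
    simp only [chartNum, Pi.smul_apply, smul_eq_mul]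
    ring
  have hd : chartDen W (a • p) (b • q) = (a * b) ^ 2 * chartDen W p q := by
    simp only [chartDen, Pi.smul_apply, smul_eq_mul]
    ring
  have hi : chartIntercept W (a • p) (b • q) = a ^ 3 * b ^ 2 * chartIntercept W p q := by
    simp only [chartIntercept, hn, hd, Pi.smul_apply, smul_eq_mul]
    ring
  have hl : chartLead W (a • p) (b • q) = (a * b) ^ 6 * chartLead W p q := by
    simp only [chartLead, hn, hd]
    ring
  have ht : chartThird W (a • p) (b • q) = (a * b) ^ 7 * chartThird W p q := by
    simp only [chartThird, hn, hd, hi, hl, Pi.smul_apply, smul_eq_mul]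
    generalize chartNum W p q = n
    generalize chartDen W p q = d
    generalize chartIntercept W p q = i
    generalize chartLead W p q = l
    ring
  have ht' : chartThird' W (a • p) (b • q) = (a * b) ^ 9 * chartThird' W p q := by
    simp only [chartThird', hn, hi, hl, ht, Pi.smul_apply, smul_eq_mul]
    ring
  ext i
  simp only [originLaw, hd, hl, ht, ht', Pi.smul_apply, smul_eq_mul]
  fin_cases i <;> simp only [Fin.zero_eta, Fin.mk_one, Fin.reduceFinMk, Matrix.cons_val] <;> ring

/-- The intersection of the curve with the line through two of its points in the chart
`t = -X/Y`, `s = -Z/Y`. -/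
lemma chart_cubic {F : Type u} [Field F] {W : WeierstrassCurve F} {t₁ s₁ t₂ s₂ : F}
    (h₁ : W.toProjective.Equation ![t₁, -1, s₁]) (h₂ : W.toProjective.Equation ![t₂, -1, s₂])
    {m b t₃ : F}
    (hm : m * chartDen W ![t₁, -1, s₁] ![t₂, -1, s₂] = chartNum W ![t₁, -1, s₁] ![t₂, -1, s₂])
    (hb : b = s₁ - m * t₁) (hd : chartDen W ![t₁, -1, s₁] ![t₂, -1, s₂] ≠ 0)
    (e₁ : (1 + W.a₂ * m + W.a₄ * m ^ 2 + W.a₆ * m ^ 3) * (t₁ + t₂ + t₃) =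
      -(W.a₁ * m + W.a₂ * b + W.a₃ * m ^ 2 + 2 * W.a₄ * m * b + 3 * W.a₆ * m ^ 2 * b)) :
    s₂ = m * t₂ + b ∧
    (1 + W.a₂ * m + W.a₄ * m ^ 2 + W.a₆ * m ^ 3) * (t₁ * t₂ + t₁ * t₃ + t₂ * t₃) =
      W.a₁ * b + 2 * W.a₃ * m * b + W.a₄ * b ^ 2 + 3 * W.a₆ * m * b ^ 2 - m ∧
    (1 + W.a₂ * m + W.a₄ * m ^ 2 + W.a₆ * m ^ 3) * (t₁ * t₂ * t₃) =
      -(W.a₃ * b ^ 2 + W.a₆ * b ^ 3 - b) ∧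
    W.toProjective.Equation ![t₃, -1, m * t₃ + b] := by
  rw [equation_chart] at h₁ h₂ ⊢
  simp only [chartDen, chartNum, Matrix.cons_val] at hm hd
  -- Subtracting the two curve equations gives numerator times `t₁ - t₂` equal to denominator times
  -- `s₁ - s₂`. Since only the denominator is cancelled, this covers coinciding points.
  have hs : s₂ = m * t₂ + b := by
    refine mul_left_cancel₀ hd ?_
    rw [hb]
    linear_combination h₂ - h₁ + (t₁ - t₂) * hm
  have e₂ : (1 + W.a₂ * m + W.a₄ * m ^ 2 + W.a₆ * m ^ 3) * (t₁ * t₂ + t₁ * t₃ + t₂ * t₃) =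
      W.a₁ * b + 2 * W.a₃ * m * b + W.a₄ * b ^ 2 + 3 * W.a₆ * m * b ^ 2 - m := by
    have hs₁ : s₁ = m * t₁ + b := by rw [hb]; ring
    rw [hs, hs₁] at hm
    linear_combination (t₁ + t₂) * e₁ + hm
  refine ⟨hs, e₂, ?_, ?_⟩
  · have hs₁ : s₁ = m * t₁ + b := by rw [hb]; ring
    rw [hs₁] at h₁
    linear_combination t₁ * e₂ - t₁ ^ 2 * e₁ - h₁
  · have hs₁ : s₁ = m * t₁ + b := by rw [hb]; ring
    rw [hs₁] at h₁
    linear_combination h₁ + (t₃ - t₁) * e₂ - (t₃ ^ 2 - t₁ ^ 2) * e₁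

/-- Dehomogenizing gives the line of slope `n / d` and intercept `-i / d`, whose third intersection
has parameter `T / l`; the law is the negative of that point up to a scalar. The scalar factor in
`originLaw` contains `l d`, so nonvanishing of the law permits all the divisions. -/
lemma originLaw_add_point {F : Type u} [Field F] {W : WeierstrassCurve F} [W.IsElliptic]
    {P Q : W.toProjective.Point} {t₁ s₁ t₂ s₂ : F} (hP : P.point = ⟦![t₁, -1, s₁]⟧)
    (hQ : Q.point = ⟦![t₂, -1, s₂]⟧) (h : originLaw W ![t₁, -1, s₁] ![t₂, -1, s₂] ≠ 0) :
    (P + Q).point = ⟦originLaw W ![t₁, -1, s₁] ![t₂, -1, s₂]⟧ := by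
  set n := chartNum W ![t₁, -1, s₁] ![t₂, -1, s₂] with hn
  set d := chartDen W ![t₁, -1, s₁] ![t₂, -1, s₂] with hd
  set l := d ^ 3 + W.a₂ * n * d ^ 2 + W.a₄ * n ^ 2 * d + W.a₆ * n ^ 3 with hl
  set i := t₁ * n - s₁ * d with hi
  set T := -(t₁ + t₂) * l - (W.a₁ * n * d ^ 2 + W.a₃ * n ^ 2 * d)
    + (W.a₂ * d ^ 2 + 2 * W.a₄ * n * d + 3 * W.a₆ * n ^ 2) * i with hT
  set S := n * T - i * l with hS
  have hlead : chartLead W ![t₁, -1, s₁] ![t₂, -1, s₂] = l := by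
    rw [chartLead, ← hn, ← hd]
  have hint : chartIntercept W ![t₁, -1, s₁] ![t₂, -1, s₂] = i := by
    rw [chartIntercept, ← hn, ← hd]
    simp [hi]
  have hthird : chartThird W ![t₁, -1, s₁] ![t₂, -1, s₂] = T := by
    rw [chartThird, ← hn, ← hd, hint, hlead]
    simp only [hT, Matrix.cons_val]
    ring
  have hthird' : chartThird' W ![t₁, -1, s₁] ![t₂, -1, s₂] = S := by
    rw [chartThird', ← hn, hint, hlead, hthird]
    simp only [hS, Matrix.cons_val]
    ring
  have hL : originLaw W ![t₁, -1, s₁] ![t₂, -1, s₂] =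
      (l * d) • ![d * T, l * d - W.a₁ * (d * T) - W.a₃ * S, S] := by
    rw [originLaw, hlead, hthird, hthird', ← hd]
    simp
  have hld : l * d ≠ 0 := fun h0 => h (by rw [hL, h0, zero_smul])
  have hl0 := left_ne_zero_of_mul hld
  have hd0 := right_ne_zero_of_mul hld
  have hA : 1 + W.a₂ * (n / d) + W.a₄ * (n / d) ^ 2 + W.a₆ * (n / d) ^ 3 = l / d ^ 3 := by
    rw [hl]
    field_simp
  have hb : s₁ - n / d * t₁ = -i / d := by
    rw [hi]
    field_simp
    ring
  have e₁ : (1 + W.a₂ * (n / d) + W.a₄ * (n / d) ^ 2 + W.a₆ * (n / d) ^ 3) * (t₁ + t₂ + T / l) =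
      -(W.a₁ * (n / d) + W.a₂ * (-i / d) + W.a₃ * (n / d) ^ 2 + 2 * W.a₄ * (n / d) * (-i / d)
        + 3 * W.a₆ * (n / d) ^ 2 * (-i / d)) := by
    rw [hA]
    have : (t₁ + t₂ + T / l) = (-(W.a₁ * n * d ^ 2 + W.a₃ * n ^ 2 * d)
      + (W.a₂ * d ^ 2 + 2 * W.a₄ * n * d + 3 * W.a₆ * n ^ 2) * i) / l := by
      rw [hT]
      generalize l = l at hl0
      field_simp
      ring
    rw [this]
    generalize l = l at hl0
    field_simp
    ring
  obtain ⟨hs₂, e₂, e₃, heq⟩ := chart_cubic (nonsingular_of_point hP).1 (nonsingular_of_point hQ).1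
    (div_mul_cancel₀ n hd0) hb.symm hd0 e₁
  have hs₁ : s₁ = n / d * t₁ + -i / d := by rw [← hb]; ring
  have hne : (![T / l, -1, n / d * (T / l) + -i / d] : Fin 3 → F) ≠ 0 := fun h0 => by
    simpa using congrFun h0 1
  let P₃ : W.toProjective.Point :=
    ⟨(WeierstrassCurve.Projective.nonsingularLift_iff _).mpr (nonsingular_of_equation W hne heq)⟩
  have hsum : P + Q + P₃ = 0 := by
    refine add_eq_zero_of_collinear ?_ ?_ ?_ rfl e₁ e₂ e₃
    · rw [hA]
      exact div_ne_zero hl0 (pow_ne_zero 3 hd0)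
    · rw [hP]
      conv_lhs => rw [hs₁]
    · rw [hQ]
      conv_lhs => rw [hs₂]
  rw [eq_neg_of_add_eq_zero_left hsum, WeierstrassCurve.Projective.Point.neg_point,
    WeierstrassCurve.Projective.negMap_eq, hL, mk_smul_eq hld, mk_eq_mk_iff]
  refine ⟨(l * d)⁻¹, inv_ne_zero hld, ?_⟩
  have hSd : n / d * (T / l) + -i / d = S / (l * d) := by
    rw [hS]
    generalize l = l at hl0
    field_simp
    ring
  rw [hSd]
  generalize S = S
  generalize T = T
  generalize l = l at hl0 hld
  ext j
  fin_cases j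
  · simp only [Pi.smul_apply, smul_eq_mul, Fin.zero_eta, Matrix.cons_val,
      WeierstrassCurve.Projective.neg]
    field_simp
  · simp only [Pi.smul_apply, smul_eq_mul, Fin.mk_one, Matrix.cons_val,
      WeierstrassCurve.Projective.neg, WeierstrassCurve.Projective.negY]
    field_simp
  · simp only [Pi.smul_apply, smul_eq_mul, Fin.reduceFinMk, Matrix.cons_val,
      WeierstrassCurve.Projective.neg]
    field_simp

lemma eq_smul_chart {F : Type u} [Field F] {p : Fin 3 → F} (hy : p 1 ≠ 0) :
    p = (-p 1) • ![-p 0 / p 1, -1, -p 2 / p 1] := by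
  ext i
  fin_cases i <;> simp <;> field_simp

lemma isAddLaw_originLaw : IsAddLaw.{u} 18 originLaw where
  pos := by norm_num
  map := originLaw_map
  smul := originLaw_smul
  add_point W _ P Q p q hP hQ h := by
    have hp : p 1 ≠ 0 := fun h0 => h (by rw [originLaw, h0, zero_mul, zero_mul, zero_mul, zero_smul])
    have hq : q 1 ≠ 0 := fun h0 => h (by rw [originLaw, h0, mul_zero, zero_mul, zero_mul, zero_smul])
    have hu : (-p 1 * -q 1) ^ 18 ≠ 0 :=
      pow_ne_zero 18 (mul_ne_zero (neg_ne_zero.mpr hp) (neg_ne_zero.mpr hq))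
    rw [eq_smul_chart hp, mk_smul_eq (neg_ne_zero.mpr hp)] at hP
    rw [eq_smul_chart hq, mk_smul_eq (neg_ne_zero.mpr hq)] at hQ
    rw [eq_smul_chart hp, eq_smul_chart hq, originLaw_smul] at h ⊢
    rw [mk_smul_eq hu]
    exact originLaw_add_point hP hQ fun h0 => h (by rw [h0, smul_zero])

lemma originLaw_origin {R : Type u} [CommRing R] (W : WeierstrassCurve R) :
    originLaw W ![0, 1, 0] ![0, 1, 0] = ![0, 1, 0] := by
  ext i
  fin_cases i <;> simp [originLaw, chartThird', chartThird, chartLead, chartIntercept,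
    chartDen, chartNum]

/-- Every pair of points has a neighbourhood in which one of three addition laws is defined. -/
lemma exists_isAddLaw {F : Type u} [Field F] (W : WeierstrassCurve F) [W.IsElliptic]
    {P Q : W.toProjective.Point} {p q : Fin 3 → F} (hP : P.point = ⟦p⟧) (hQ : Q.point = ⟦q⟧) :
    ∃ (e : ℕ) (L : ∀ {R : Type u} [CommRing R], WeierstrassCurve R → (Fin 3 → R) → (Fin 3 → R) →
      Fin 3 → R), IsAddLaw.{u} e L ∧ L W p q ≠ 0 := by
  by_cases hPQ : P = Q
  · subst hPQ
    by_cases h0 : P = 0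
    · refine ⟨_, _, isAddLaw_originLaw, ?_⟩
      rw [h0, WeierstrassCurve.Projective.Point.zero_point] at hP hQ
      obtain ⟨a, ha, rfl⟩ := mk_eq_mk_iff.mp hP.symm
      obtain ⟨b, hb, rfl⟩ := mk_eq_mk_iff.mp hQ.symm
      rw [originLaw_smul, originLaw_origin]
      refine smul_ne_zero (pow_ne_zero 18 (mul_ne_zero ha hb)) fun h => ?_
      simpa using congrFun h 1
    · exact ⟨_, _, isAddLaw_tangentLaw, tangentLaw_ne_zero W hP hQ h0⟩
  · exact ⟨_, _, isAddLaw_chordLaw, chordLaw_ne_zero W hP hQ hPQ⟩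

/-! ### Homogeneous polynomials -/

section Homogeneous

variable {σ : Type*} {K : Type u} [Field K]

lemma aeval_smul_of_isHomogeneous {R : Type*} [CommRing R] [Algebra K R] {g : MvPolynomial σ K}
    {d : ℕ} (hg : g.IsHomogeneous d) (c : R) (q : σ → R) :
    MvPolynomial.aeval (c • q) g = c ^ d * MvPolynomial.aeval q g := by
  rw [MvPolynomial.aeval_def, MvPolynomial.aeval_def, MvPolynomial.eval₂_eq, MvPolynomial.eval₂_eq,
    Finset.mul_sum]
  refine Finset.sum_congr rfl fun m hm => ?_
  have hm' : m.degree = d := by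
    by_contra h
    exact (MvPolynomial.mem_support_iff.mp hm) (hg.coeff_eq_zero h)
  rw [← hm', Finsupp.degree_apply]
  simp only [Pi.smul_apply, smul_eq_mul, mul_pow, Finset.prod_mul_distrib, Finset.prod_pow_eq_pow_sum]
  ring

/-- Comparing the coefficients of the `n`-th power of the scaling variable identifies `g` with its
homogeneous component of degree `n`. -/
lemma isHomogeneous_of_scale {g : MvPolynomial σ K} {n : ℕ}
    (h : MvPolynomial.aeval
      ((Polynomial.X : Polynomial (MvPolynomial σ K)) • fun i => Polynomial.C (MvPolynomial.X i)) g =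
        Polynomial.X ^ n * Polynomial.C g) : g.IsHomogeneous n := by
  have hC : ∀ p : MvPolynomial σ K, MvPolynomial.aeval
      (fun i => (Polynomial.C (MvPolynomial.X i) : Polynomial (MvPolynomial σ K))) p =
        Polynomial.C p := by
    intro p
    have := MvPolynomial.aeval_algebraMap_apply (Polynomial (MvPolynomial σ K))
      (fun i => (MvPolynomial.X i : MvPolynomial σ K)) p
    rw [MvPolynomial.aeval_X_left_apply] at this
    exact this
  have h1 := congrArg (Polynomial.coeff · n) h
  conv_lhs at h1 => rw [← MvPolynomial.sum_homogeneousComponent g]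
  simp only [map_sum] at h1
  rw [Finset.sum_congr rfl fun i _ => by
    rw [aeval_smul_of_isHomogeneous (MvPolynomial.homogeneousComponent_isHomogeneous i g), hC]] at h1
  simp only [Polynomial.finsetSum_coeff, Polynomial.coeff_X_pow_mul', Polynomial.coeff_C,
    le_refl, if_true, Nat.sub_self] at h1
  rw [← h1]
  refine MvPolynomial.IsHomogeneous.sum _ _ _ fun i _ => ?_
  split_ifs with hi hi'
  · rw [show i = n by omega]
    exact MvPolynomial.homogeneousComponent_isHomogeneous _ _
  · exact MvPolynomial.isHomogeneous_zero _ _ _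
  · exact MvPolynomial.isHomogeneous_zero _ _ _

end Homogeneous

/-! ### Uniqueness of the expansion of `s` -/

section Uniqueness

variable {σ : Type*} {K : Type u} [Field K]

lemma isUnit_one_add {f : MvPowerSeries σ K} (hf : MvPowerSeries.constantCoeff f = 0) :
    IsUnit (1 + f) := by
  rw [MvPowerSeries.isUnit_iff_constantCoeff]
  simp [hf]

/-- A solution of the Weierstrass equation in the chart `t = -X/Y`, `s = -Z/Y` without constant
term is determined by `t`. -/
lemma eq_of_chart_equation (a₁ a₂ a₃ a₄ a₆ : K) {t s s' : MvPowerSeries σ K}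
    (ht : MvPowerSeries.constantCoeff t = 0) (hs : MvPowerSeries.constantCoeff s = 0)
    (hs' : MvPowerSeries.constantCoeff s' = 0)
    (h : s = t ^ 3 + MvPowerSeries.C a₁ * t * s + MvPowerSeries.C a₂ * t ^ 2 * s
      + MvPowerSeries.C a₃ * s ^ 2 + MvPowerSeries.C a₄ * t * s ^ 2 + MvPowerSeries.C a₆ * s ^ 3)
    (h' : s' = t ^ 3 + MvPowerSeries.C a₁ * t * s' + MvPowerSeries.C a₂ * t ^ 2 * s'
      + MvPowerSeries.C a₃ * s' ^ 2 + MvPowerSeries.C a₄ * t * s' ^ 2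
      + MvPowerSeries.C a₆ * s' ^ 3) : s = s' := by
  -- The difference of the two equations is `s - s'` times this factor, whose constant term is `1`.
  have hu : IsUnit (1 + -(MvPowerSeries.C a₁ * t + MvPowerSeries.C a₂ * t ^ 2
      + MvPowerSeries.C a₃ * (s + s') + MvPowerSeries.C a₄ * t * (s + s')
      + MvPowerSeries.C a₆ * (s ^ 2 + s * s' + s' ^ 2))) :=
    isUnit_one_add (by simp [ht, hs, hs'])
  rw [← sub_eq_zero, ← hu.mul_left_eq_zero]
  linear_combination h - h'

end Uniqueness

lemma map_sStep {K k : Type u} [Field K] [Field k] (φ : K →+* k) (E : WeierstrassCurve K)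
    (f : PowerSeries K) : PowerSeries.map φ (sStep E f) = sStep (E.map φ) (PowerSeries.map φ f) := by
  simp [sStep]

lemma map_sSeries {K k : Type u} [Field K] [Field k] (φ : K →+* k) (E : WeierstrassCurve K) :
    PowerSeries.map φ (sSeries E) = sSeries (E.map φ) := by
  have h : ∀ n, PowerSeries.map φ ((sStep E)^[n] 0) = (sStep (E.map φ))^[n] 0 := by
    intro n
    induction n with
    | zero => simp
    | succ n ih => rw [Function.iterate_succ_apply', Function.iterate_succ_apply', map_sStep, ih]
  ext n
  rw [PowerSeries.coeff_map, sSeries, sSeries, PowerSeries.coeff_mk, PowerSeries.coeff_mk, ← h,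
    PowerSeries.coeff_map]

/-- The expansion of `s` is divisible by `τ ^ 2`. -/
lemma exists_sSeries_eq {K : Type u} [Field K] (E : WeierstrassCurve K) :
    ∃ y : PowerSeries K, sSeries E = PowerSeries.X * y ∧ PowerSeries.constantCoeff y = 0 ∧ y ≠ 0 := by
  obtain ⟨y, hy⟩ := X_pow_dvd_sSeries_sub E 1
  have h1 : sSeries E = PowerSeries.X * (PowerSeries.X * y + PowerSeries.X ^ 2) := by
    rw [sub_eq_iff_eq_add] at hy
    rw [hy]
    simp [sStep]
    ring
  refine ⟨_, h1, by simp, fun h0 => ?_⟩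
  have h2 := sStep_sSeries E
  rw [h1, h0] at h2
  simp [sStep] at h2

lemma sSeries_ne_zero {K : Type u} [Field K] (E : WeierstrassCurve K) : sSeries E ≠ 0 := by
  obtain ⟨y, h, -, hy⟩ := exists_sSeries_eq E
  rw [h]
  exact mul_ne_zero PowerSeries.X_ne_zero hy

/-! ### Forms on the curve and their expansions -/

section NormalForm

variable {k : Type u} [Field k] (W : WeierstrassCurve k)

/-- The affine Weierstrass equation over an algebra over the base field. -/
def AffineEquation {R : Type*} [CommRing R] [Algebra k R] (x y : R) : Prop :=
  y ^ 2 + algebraMap k R W.a₁ * x * y + algebraMap k R W.a₃ * y =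
    x ^ 3 + algebraMap k R W.a₂ * x ^ 2 + algebraMap k R W.a₄ * x + algebraMap k R W.a₆

/-- On the affine curve every polynomial has the form `a(x) + b(x) y`. -/
lemma exists_normal_form (g : MvPolynomial (Fin 3) k) : ∃ a b : Polynomial k,
    ∀ {R : Type u} [CommRing R] [Algebra k R] (x y : R), AffineEquation W x y →
      MvPolynomial.aeval ![x, y, 1] g = Polynomial.aeval x a + Polynomial.aeval x b * y := by
  induction g using MvPolynomial.induction_on with
  | C c => exact ⟨Polynomial.C c, 0, fun x y _ => by simp⟩
  | add p q hp hq =>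
    obtain ⟨a, b, h⟩ := hp
    obtain ⟨a', b', h'⟩ := hq
    refine ⟨a + a', b + b', fun x y e => ?_⟩
    rw [map_add, h x y e, h' x y e, map_add, map_add]
    ring
  | mul_X p i hp =>
    obtain ⟨a, b, h⟩ := hp
    fin_cases i
    · refine ⟨Polynomial.X * a, Polynomial.X * b, fun x y e => ?_⟩
      rw [map_mul, h x y e]
      simp
      ring
    · refine ⟨b * (Polynomial.X ^ 3 + Polynomial.C W.a₂ * Polynomial.X ^ 2
        + Polynomial.C W.a₄ * Polynomial.X + Polynomial.C W.a₆),
        a - b * (Polynomial.C W.a₁ * Polynomial.X + Polynomial.C W.a₃), fun x y e => ?_⟩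
      rw [map_mul, h x y e]
      simp only [MvPolynomial.aeval_X, Fin.mk_one, Matrix.cons_val, map_add, map_mul, map_sub,
        map_pow, Polynomial.aeval_X, Polynomial.aeval_C]
      rw [AffineEquation] at e
      linear_combination (Polynomial.aeval x b) * e
    · refine ⟨a, b, fun x y e => ?_⟩
      rw [map_mul, h x y e]
      simp

/-- The norm of `a(x) + b(x) y`. -/
def normForm (a b : Polynomial k) : Polynomial k :=
  a ^ 2 - a * b * (Polynomial.C W.a₁ * Polynomial.X + Polynomial.C W.a₃)
    - b ^ 2 * (Polynomial.X ^ 3 + Polynomial.C W.a₂ * Polynomial.X ^ 2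
      + Polynomial.C W.a₄ * Polynomial.X + Polynomial.C W.a₆)

/-- The conjugation is the negation of the curve, `y ↦ -y - a₁ x - a₃`. -/
lemma aeval_normForm {R : Type*} [CommRing R] [Algebra k R] (a b : Polynomial k) {x y : R}
    (h : AffineEquation W x y) : Polynomial.aeval x (normForm W a b) =
      (Polynomial.aeval x a + Polynomial.aeval x b * y) *
        (Polynomial.aeval x a + Polynomial.aeval x b *
          (-y - algebraMap k R W.a₁ * x - algebraMap k R W.a₃)) := by
  simp only [normForm, map_add, map_mul, map_sub, map_pow, Polynomial.aeval_X, Polynomial.aeval_C]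
  rw [AffineEquation] at h
  linear_combination (Polynomial.aeval x b) ^ 2 * h

/-- The norm has degree `max (2 deg a) (2 deg b + 3)`: the leading terms cannot cancel because their
degrees have different parity. -/
lemma eq_zero_of_normForm_eq_zero {a b : Polynomial k} (h : normForm W a b = 0) :
    a = 0 ∧ b = 0 := by
  have h1 := WeierstrassCurve.Affine.CoordinateRing.degree_norm_smul_basis (W' := W.toAffine) a b
  rw [WeierstrassCurve.Affine.CoordinateRing.norm_smul_basis] at h1
  change (normForm W a b).degree = _ at h1
  rw [h, Polynomial.degree_zero, eq_comm, max_eq_bot] at h1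
  constructor
  · rw [← Polynomial.degree_eq_bot]
    by_contra ha
    obtain ⟨n, hn⟩ := WithBot.ne_bot_iff_exists.mp ha
    rw [← hn] at h1
    exact absurd h1.1 (by rw [two_nsmul]; exact WithBot.coe_ne_bot)
  · rw [← Polynomial.degree_eq_bot]
    by_contra ha
    obtain ⟨n, hn⟩ := WithBot.ne_bot_iff_exists.mp ha
    rw [← hn] at h1
    exact absurd h1.2 (by rw [two_nsmul]; exact WithBot.coe_ne_bot)

lemma affineEquation_neg {x y : k} (h : AffineEquation W x y) :
    AffineEquation W x (-y - W.a₁ * x - W.a₃) := by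
  simp only [AffineEquation, Algebra.algebraMap_self, RingHom.id_apply] at h ⊢
  linear_combination h

variable [IsAlgClosed k]

lemma exists_affineEquation (x : k) : ∃ y : k, AffineEquation W x y := by
  have : (Polynomial.X ^ 2 + Polynomial.C (W.a₁ * x + W.a₃) * Polynomial.X
      - Polynomial.C (x ^ 3 + W.a₂ * x ^ 2 + W.a₄ * x + W.a₆) : Polynomial k).degree ≠ 0 := by
    have : (Polynomial.X ^ 2 + Polynomial.C (W.a₁ * x + W.a₃) * Polynomial.X
      - Polynomial.C (x ^ 3 + W.a₂ * x ^ 2 + W.a₄ * x + W.a₆) : Polynomial k).degree = 2 := by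
      compute_degree!
    rw [this]
    norm_num
  obtain ⟨y, hy⟩ := IsAlgClosed.exists_root _ this
  refine ⟨y, ?_⟩
  simp only [Polynomial.IsRoot, Polynomial.eval_sub, Polynomial.eval_add, Polynomial.eval_mul,
    Polynomial.eval_pow, Polynomial.eval_X, Polynomial.eval_C] at hy
  simp only [AffineEquation, Algebra.algebraMap_self, RingHom.id_apply]
  linear_combination hy

/-- Over an algebraically closed field there is a point above every `x`, so the norm vanishes at
every `x`. -/
lemma eq_zero_of_forall_point {a b : Polynomial k}
    (h : ∀ x y : k, AffineEquation W x y → a.eval x + b.eval x * y = 0) : a = 0 ∧ b = 0 := by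
  refine eq_zero_of_normForm_eq_zero W (Polynomial.funext fun x => ?_)
  obtain ⟨y, hy⟩ := exists_affineEquation W x
  have := aeval_normForm W a b hy
  simp only [Polynomial.coe_aeval_eq_eval] at this
  rw [this, h x y hy, zero_mul, Polynomial.eval_zero]

end NormalForm

section Expand

lemma map_expand {K k : Type u} [Field K] [Field k] (φ : K →+* k) (E : WeierstrassCurve K)
    (g : MvPolynomial (Fin 3) K) :
    PowerSeries.map φ (expand E g) = expand (E.map φ) (MvPolynomial.map φ g) := by
  induction g using MvPolynomial.induction_on with
  | C c =>
    simp only [expand, MvPolynomial.map_C, MvPolynomial.aeval_C]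
    exact PowerSeries.map_C φ c
  | add p q hp hq => simp only [expand, map_add] at hp hq ⊢; rw [hp, hq]
  | mul_X p i hp =>
    simp only [expand, map_mul, MvPolynomial.map_X, MvPolynomial.aeval_X] at hp ⊢
    rw [hp]
    congr 1
    fin_cases i <;> simp [map_sSeries]

variable {k : Type u} [Field k] (W : WeierstrassCurve k)

/-- The inverse of a nonzero series without constant term is transcendental over `k`: a relation
`N(1 / y) = 0` says that the reversed polynomial vanishes at `y`, and its constant term is the
leading coefficient of `N`. -/
lemma aeval_inv_ne_zero {L : Type*} [Field L] [Algebra k L] [Algebra (PowerSeries k) L]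
    [IsScalarTower k (PowerSeries k) L] [IsFractionRing (PowerSeries k) L] {y : PowerSeries k}
    (hy : PowerSeries.constantCoeff y = 0) (hy0 : y ≠ 0) {N : Polynomial k}
    (h : Polynomial.aeval (algebraMap (PowerSeries k) L y)⁻¹ N = 0) : N = 0 := by
  have hι : algebraMap (PowerSeries k) L y ≠ 0 := by
    rwa [Ne, FaithfulSMul.algebraMap_eq_zero_iff]
  let _ : Invertible (algebraMap (PowerSeries k) L y)⁻¹ :=
    ⟨algebraMap (PowerSeries k) L y, mul_inv_cancel₀ hι, inv_mul_cancel₀ hι⟩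
  rw [Polynomial.aeval_def, ← Polynomial.eval₂_reverse_eq_zero_iff] at h
  change Polynomial.eval₂ _ (algebraMap (PowerSeries k) L y) N.reverse = 0 at h
  rw [← Polynomial.aeval_def, Polynomial.aeval_algebraMap_apply,
    FaithfulSMul.algebraMap_eq_zero_iff, Polynomial.aeval_def] at h
  have h1 := congrArg (PowerSeries.constantCoeff (R := k)) h
  rw [Polynomial.hom_eval₂, hy, map_zero, Polynomial.eval₂_at_zero] at h1
  rw [Polynomial.coeff_zero_reverse] at h1
  rw [← Polynomial.leadingCoeff_eq_zero]
  simpa using h1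

/-- In the fraction field the pair `x = τ / S`, `y = -1 / S` is an affine point of the curve, and
the expansion of `g` is `S ^ d (a(x) + b(x) y)`. If it vanishes, so does the norm at `x`; but `x` is
transcendental, so the norm is zero. -/
lemma expand_eq_zero_iff_normal_form_aux (L : Type u) [Field L] [Algebra k L]
    [Algebra (PowerSeries k) L] [IsScalarTower k (PowerSeries k) L]
    [IsFractionRing (PowerSeries k) L] {g : MvPolynomial (Fin 3) k} {d : ℕ} (hg : g.IsHomogeneous d)
    {a b : Polynomial k} (hab : ∀ {R : Type u} [CommRing R] [Algebra k R] (x y : R),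
      AffineEquation W x y →
        MvPolynomial.aeval ![x, y, 1] g = Polynomial.aeval x a + Polynomial.aeval x b * y) :
    expand W g = 0 ↔ a = 0 ∧ b = 0 := by
  let ι := algebraMap (PowerSeries k) L
  have hinj : Function.Injective ι := FaithfulSMul.algebraMap_injective _ _
  obtain ⟨y, hS, hy, hy0⟩ := exists_sSeries_eq W
  have hS0 : ι (sSeries W) ≠ 0 := (map_ne_zero_iff ι hinj).mpr (sSeries_ne_zero W)
  have hX0 : ι PowerSeries.X ≠ 0 := (map_ne_zero_iff ι hinj).mpr PowerSeries.X_ne_zero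
  have hy0' : ι y ≠ 0 := (map_ne_zero_iff ι hinj).mpr hy0
  have hx : ι PowerSeries.X / ι (sSeries W) = (ι y)⁻¹ := by
    rw [hS, map_mul]
    field_simp
  have hk : ∀ c : k, ι (PowerSeries.C c) = algebraMap k L c := fun c =>
    (IsScalarTower.algebraMap_apply k (PowerSeries k) L c).symm
  have heq : AffineEquation W (ι PowerSeries.X / ι (sSeries W)) (-1 / ι (sSeries W)) := by
    have h := congrArg ι (sStep_sSeries W)
    simp only [sStep, map_add, map_mul, map_pow, hk] at h
    rw [AffineEquation]
    field_simp
    linear_combination -h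
  have hv : (fun i => ι ((![PowerSeries.X, -1, sSeries W] : Fin 3 → PowerSeries k) i)) =
      ι (sSeries W) • ![ι PowerSeries.X / ι (sSeries W), -1 / ι (sSeries W), 1] := by
    ext i
    fin_cases i
    · simp [mul_div_cancel₀ _ hS0]
    · simp [mul_div_cancel₀ _ hS0]
    · simp
  have hexp : ι (expand W g) = ι (sSeries W) ^ d *
      (Polynomial.aeval (ι PowerSeries.X / ι (sSeries W)) a
        + Polynomial.aeval (ι PowerSeries.X / ι (sSeries W)) b * (-1 / ι (sSeries W))) := by
    rw [← hab _ _ heq, ← aeval_smul_of_isHomogeneous hg, ← hv, expand]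
    exact (MvPolynomial.aeval_algebraMap_apply L _ g).symm
  rw [← map_eq_zero_iff ι hinj, hexp, mul_eq_zero, or_iff_right (pow_ne_zero d hS0)]
  constructor
  · intro h
    have hN := aeval_normForm W a b heq
    rw [h, zero_mul, hx] at hN
    exact eq_zero_of_normForm_eq_zero W (aeval_inv_ne_zero hy hy0 hN)
  · rintro ⟨rfl, rfl⟩
    simp

lemma expand_eq_zero_iff_normal_form {g : MvPolynomial (Fin 3) k} {d : ℕ} (hg : g.IsHomogeneous d)
    {a b : Polynomial k} (hab : ∀ {R : Type u} [CommRing R] [Algebra k R] (x y : R),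
      AffineEquation W x y →
        MvPolynomial.aeval ![x, y, 1] g = Polynomial.aeval x a + Polynomial.aeval x b * y) :
    expand W g = 0 ↔ a = 0 ∧ b = 0 :=
  expand_eq_zero_iff_normal_form_aux W (FractionRing (PowerSeries k)) hg hab

lemma equation_affine {x y : k} (h : AffineEquation W x y) :
    W.toProjective.Equation ![x, y, 1] := by
  rw [AffineEquation] at h
  simp only [Algebra.algebraMap_self, RingHom.id_apply] at h
  rw [WeierstrassCurve.Projective.equation_iff]
  simp only [Matrix.cons_val]
  linear_combination h

lemma affineEquation_of_equation {q : Fin 3 → k} (h : W.toProjective.Equation q) (hz : q 2 ≠ 0) :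
    AffineEquation W (q 0 / q 2) (q 1 / q 2) := by
  rw [WeierstrassCurve.Projective.equation_iff] at h
  rw [AffineEquation]
  simp only [Algebra.algebraMap_self, RingHom.id_apply]
  field_simp
  linear_combination h

/-- The polynomial `g` vanishes on the cone over the curve. -/
def VanishesOn (g : MvPolynomial (Fin 3) k) : Prop :=
  ∀ q : Fin 3 → k, q ≠ 0 → W.toProjective.Equation q → MvPolynomial.aeval q g = 0

lemma affine_ne_zero (x y : k) : (![x, y, 1] : Fin 3 → k) ≠ 0 := fun h => by
  simpa using congrFun h 2

/-- A form vanishes on an elliptic curve over an algebraically closed field if and only if its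
expansion at the origin vanishes. -/
theorem expand_eq_zero_iff [IsAlgClosed k] {g : MvPolynomial (Fin 3) k} {d : ℕ}
    (hg : g.IsHomogeneous d) : expand W g = 0 ↔ VanishesOn W g := by
  obtain ⟨a, b, hab⟩ := exists_normal_form W g
  constructor
  · intro h0 q hq hE
    have h := (expand_eq_zero_iff_normal_form W hg hab).mp h0
    by_cases hz : q 2 = 0
    -- The normal form does not see the origin; there the constant term of the expansion gives the
    -- value up to scaling.
    · have hx := WeierstrassCurve.Projective.X_eq_zero_of_Z_eq_zero hE hz
      have hc := congrArg (PowerSeries.constantCoeff (R := k)) h0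
      have h1 : PowerSeries.constantCoeff (expand W g) = MvPolynomial.aeval ![0, -1, 0] g := by
        rw [expand, MvPolynomial.aeval_def, MvPolynomial.hom_eval₂, MvPolynomial.aeval_def]
        congr 1
        ext i
        fin_cases i <;> simp [constantCoeff_sSeries]
      rw [map_zero, h1] at hc
      rw [show q = (-q 1) • ![0, -1, 0] by ext i; fin_cases i <;> simp [hx, hz],
        aeval_smul_of_isHomogeneous hg, hc, mul_zero]
    · rw [eq_smul_affine hz, aeval_smul_of_isHomogeneous hg,
        hab _ _ (affineEquation_of_equation W hE hz), h.1, h.2]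
      simp
  · intro h
    rw [expand_eq_zero_iff_normal_form W hg hab]
    refine eq_zero_of_forall_point W fun x y e => ?_
    have := h _ (affine_ne_zero x y) (equation_affine W e)
    rw [hab x y e] at this
    simpa using this

/-- The homogeneous components of a polynomial that vanishes on the cone vanish there. -/
lemma VanishesOn.homogeneousComponent [Infinite k] {W : WeierstrassCurve k}
    {g : MvPolynomial (Fin 3) k} (h : VanishesOn W g) (n : ℕ) :
    VanishesOn W (MvPolynomial.homogeneousComponent n g) := by
  intro q hq hE
  set N := g.totalDegree + 1
  let f : Polynomial k := ∑ i ∈ Finset.range N,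
    Polynomial.C (MvPolynomial.aeval q (MvPolynomial.homogeneousComponent i g)) * Polynomial.X ^ i
  -- The factor `X` takes care of `c = 0`, where `c • q` is the zero triple and the hypothesis says
  -- nothing.
  have hf : Polynomial.X * f = 0 := by
    refine Polynomial.funext fun c => ?_
    by_cases hc : c = 0
    · simp [hc]
    · have h1 := h (c • q) (smul_ne_zero hc hq)
        ((WeierstrassCurve.Projective.equation_smul _ (Ne.isUnit hc)).mpr hE)
      rw [← MvPolynomial.sum_homogeneousComponent g, map_sum] at h1
      rw [Polynomial.eval_mul, Polynomial.eval_finsetSum, Polynomial.eval_zero]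
      rw [Finset.sum_congr rfl fun i _ => aeval_smul_of_isHomogeneous
        (MvPolynomial.homogeneousComponent_isHomogeneous i g) c q] at h1
      refine mul_eq_zero_of_right _ ?_
      rw [← h1]
      refine Finset.sum_congr rfl fun i _ => ?_
      rw [Polynomial.eval_mul, Polynomial.eval_C, Polynomial.eval_pow, Polynomial.eval_X, mul_comm]
  have hf0 : f = 0 := (mul_eq_zero.mp hf).resolve_left Polynomial.X_ne_zero
  by_cases hn : n < N
  · have h1 := congrArg (Polynomial.coeff · n) hf0
    simpa [f, Polynomial.finsetSum_coeff, Polynomial.coeff_C_mul, Polynomial.coeff_X_pow, hn]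
      using h1
  · rw [MvPolynomial.homogeneousComponent_eq_zero _ _ (by omega), map_zero]

/-- The set of coordinate triples of points is stable under nonzero scaling, so the inhomogeneous
case reduces to the homogeneous components. -/
lemma expand_eq_zero_of_vanishesOn [IsAlgClosed k] {g : MvPolynomial (Fin 3) k}
    (h : VanishesOn W g) : expand W g = 0 := by
  have := IsAlgClosed.instInfinite (K := k)
  rw [← MvPolynomial.sum_homogeneousComponent g]
  simp only [expand, map_sum]
  exact Finset.sum_eq_zero fun i _ => (expand_eq_zero_iff W
    (MvPolynomial.homogeneousComponent_isHomogeneous i g)).mpr (h.homogeneousComponent i)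

end Expand

/-! ### Algebraic maps over an algebraically closed field -/

section AlgebraicMap

variable (K : Type u) {k : Type u} [Field K] [Field k] [Algebra K k] {W W' W'' : WeierstrassCurve k}

/-- The triple `f` of forms of degree `d` over `K` represents the map `α`. -/
structure Rep (α : W.toProjective.Point → W'.toProjective.Point) (d : ℕ)
    (f : Fin 3 → MvPolynomial (Fin 3) K) : Prop where
  homogeneous : ∀ i, (f i).IsHomogeneous d
  eq_point : ∀ (Q : W.toProjective.Point) (q : Fin 3 → k), Q.point = ⟦q⟧ →
    (fun i => MvPolynomial.aeval q (f i)) ≠ 0 → (α Q).point = ⟦fun i => MvPolynomial.aeval q (f i)⟧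

/-- The map `α` is represented by forms over `K` in a neighbourhood of every point. -/
def IsAlg (α : W.toProjective.Point → W'.toProjective.Point) : Prop :=
  ∀ (P : W.toProjective.Point) (p : Fin 3 → k), P.point = ⟦p⟧ →
    ∃ (d : ℕ) (f : Fin 3 → MvPolynomial (Fin 3) K), Rep K α d f ∧
      (fun i => MvPolynomial.aeval p (f i)) ≠ 0

variable {K}

lemma exists_rep (P : W.toProjective.Point) :
    ∃ p : Fin 3 → k, P.point = ⟦p⟧ ∧ p ≠ 0 ∧ W.toProjective.Equation p := by
  obtain ⟨p, hp⟩ := Quotient.exists_rep P.point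
  have h := nonsingular_of_point hp.symm
  refine ⟨p, hp.symm, ?_, h.1⟩
  rintro rfl
  rw [WeierstrassCurve.Projective.nonsingular_iff] at h
  simp at h

lemma ne_zero_of_point {P : W.toProjective.Point} {p : Fin 3 → k} (h : P.point = ⟦p⟧) : p ≠ 0 := by
  rintro rfl
  have h := nonsingular_of_point h
  rw [WeierstrassCurve.Projective.nonsingular_iff] at h
  simp at h

lemma exists_point [W.IsElliptic] {q : Fin 3 → k} (hq : q ≠ 0) (h : W.toProjective.Equation q) :
    ∃ P : W.toProjective.Point, P.point = ⟦q⟧ :=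
  ⟨⟨(WeierstrassCurve.Projective.nonsingularLift_iff _).mpr (nonsingular_of_equation W hq h)⟩, rfl⟩

lemma mk_eq_of_cross {p q : Fin 3 → k} (hp : p ≠ 0) (hq : q ≠ 0)
    (h : ∀ i j, p i * q j = p j * q i) :
    (⟦p⟧ : WeierstrassCurve.Projective.PointClass k) = ⟦q⟧ := by
  obtain ⟨i, hi⟩ := Function.ne_iff.mp hq
  rw [Pi.zero_apply] at hi
  have hpi : p i ≠ 0 := by
    intro h0
    refine hp (funext fun j => ?_)
    have := h j i
    rw [h0, zero_mul] at this
    exact (mul_eq_zero.mp this).resolve_right hi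
  refine mk_eq_mk_iff.mpr ⟨p i / q i, div_ne_zero hpi hi, funext fun j => ?_⟩
  rw [Pi.smul_apply, smul_eq_mul]
  field_simp
  linear_combination h i j

lemma cross_of_mk_eq {p q : Fin 3 → k}
    (h : (⟦p⟧ : WeierstrassCurve.Projective.PointClass k) = ⟦q⟧) (i j : Fin 3) :
    p i * q j = p j * q i := by
  obtain ⟨u, -, rfl⟩ := mk_eq_mk_iff.mp h
  simp only [Pi.smul_apply, smul_eq_mul]
  ring

/-- Representations of two maps are proportional at points with the same image. -/
lemma Rep.cross {α β : W.toProjective.Point → W'.toProjective.Point} {K' : Type u} [Field K']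
    [Algebra K' k] {d e : ℕ} {f : Fin 3 → MvPolynomial (Fin 3) K}
    {g : Fin 3 → MvPolynomial (Fin 3) K'} (hf : Rep K α d f) (hg : Rep K' β e g)
    {P Q : W.toProjective.Point} {p q : Fin 3 → k} (hP : P.point = ⟦p⟧) (hQ : Q.point = ⟦q⟧)
    (h : α P = β Q) (i j : Fin 3) :
    MvPolynomial.aeval p (f i) * MvPolynomial.aeval q (g j) =
      MvPolynomial.aeval p (f j) * MvPolynomial.aeval q (g i) := by
  by_cases h1 : (fun i => MvPolynomial.aeval p (f i)) = 0
  · have := fun i => congrFun h1 i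
    simp only [Pi.zero_apply] at this
    rw [this, this, zero_mul, zero_mul]
  · by_cases h2 : (fun i => MvPolynomial.aeval q (g i)) = 0
    · have := fun i => congrFun h2 i
      simp only [Pi.zero_apply] at this
      rw [this, this, mul_zero, mul_zero]
    · exact cross_of_mk_eq ((hf.eq_point P p hP h1).symm.trans
        ((congrArg _ h).trans (hg.eq_point Q q hQ h2))) i j

lemma Rep.extend {α : W.toProjective.Point → W'.toProjective.Point} {d : ℕ}
    {f : Fin 3 → MvPolynomial (Fin 3) K} (hf : Rep K α d f) :
    Rep k α d fun i => MvPolynomial.map (algebraMap K k) (f i) where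
  homogeneous i := (hf.homogeneous i).map _
  eq_point Q q hQ h := by
    simp only [MvPolynomial.aeval_map_algebraMap] at h ⊢
    exact hf.eq_point Q q hQ h

lemma IsAlg.extend {α : W.toProjective.Point → W'.toProjective.Point} (h : IsAlg K α) :
    IsAlg k α := fun P p hP => by
  obtain ⟨d, f, hf, h0⟩ := h P p hP
  refine ⟨d, _, hf.extend, ?_⟩
  simpa only [MvPolynomial.aeval_map_algebraMap] using h0

lemma Rep.equation {α : W.toProjective.Point → W'.toProjective.Point} {d : ℕ}
    {f : Fin 3 → MvPolynomial (Fin 3) K} (hf : Rep K α d f) {P : W.toProjective.Point}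
    {p : Fin 3 → k} (hP : P.point = ⟦p⟧) :
    W'.toProjective.Equation fun i => MvPolynomial.aeval p (f i) := by
  by_cases h0 : (fun i => MvPolynomial.aeval p (f i)) = 0
  · rw [h0, WeierstrassCurve.Projective.equation_iff]
    simp
  · exact (nonsingular_of_point (hf.eq_point P p hP h0)).1

/-! #### Constructions -/

lemma Rep.const {R : W'.toProjective.Point} {c : Fin 3 → k} (hc : R.point = ⟦c⟧) :
    Rep k (fun _ : W.toProjective.Point => R) 0 fun i => MvPolynomial.C (c i) where
  homogeneous i := MvPolynomial.isHomogeneous_C _ _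
  eq_point Q q hQ h := by simpa using hc

lemma isAlg_const (R : W'.toProjective.Point) : IsAlg k (fun _ : W.toProjective.Point => R) := by
  intro P p hP
  obtain ⟨c, hc, hc0, -⟩ := exists_rep R
  exact ⟨_, _, Rep.const hc, by simpa using hc0⟩

lemma isAlg_zero : IsAlg K (0 : W.toProjective.Point → W'.toProjective.Point) := by
  intro P p hP
  refine ⟨0, ![0, 1, 0], ⟨fun i => ?_, fun Q q hQ h => ?_⟩, fun h => ?_⟩
  · fin_cases i
    · exact MvPolynomial.isHomogeneous_zero _ _ _
    · exact MvPolynomial.isHomogeneous_one _ _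
    · exact MvPolynomial.isHomogeneous_zero _ _ _
  · rw [Pi.zero_apply, WeierstrassCurve.Projective.Point.zero_point]
    congr 1
    ext i
    fin_cases i <;> simp
  · simpa using congrFun h 1

lemma isAlg_id : IsAlg K (id : W.toProjective.Point → W.toProjective.Point) := by
  intro P p hP
  exact ⟨1, MvPolynomial.X, ⟨fun i => MvPolynomial.isHomogeneous_X _ _, fun Q q hQ h => by simpa using hQ⟩,
    by simpa using ne_zero_of_point hP⟩

/-- At `p = 0` a form of positive degree vanishes, so the hypothesis forces `d = 0`; constant forms
take the same values at true coordinates of `P`. This allows composition of triples where the inner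
one vanishes. -/
lemma Rep.eq_point_of_ne_zero {α : W.toProjective.Point → W'.toProjective.Point} {d : ℕ}
    {f : Fin 3 → MvPolynomial (Fin 3) K} (hf : Rep K α d f) {P : W.toProjective.Point}
    {p : Fin 3 → k} (hP : p ≠ 0 → P.point = ⟦p⟧) (h : (fun i => MvPolynomial.aeval p (f i)) ≠ 0) :
    (α P).point = ⟦fun i => MvPolynomial.aeval p (f i)⟧ := by
  by_cases h0 : p = 0
  · obtain ⟨y, hy, -, -⟩ := exists_rep P
    have he : ∀ i, MvPolynomial.aeval p (f i) = 0 ^ d * MvPolynomial.aeval y (f i) := fun i => by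
      rw [← aeval_smul_of_isHomogeneous (hf.homogeneous i), zero_smul, h0]
    simp only [he] at h ⊢
    rcases Nat.eq_zero_or_pos d with rfl | hpos
    · simp only [pow_zero, one_mul] at h ⊢
      exact hf.eq_point _ _ hy h
    · exact absurd (funext fun i => by simp [hpos.ne']) h
  · exact hf.eq_point P p (hP h0) h

lemma Rep.comp {α : W.toProjective.Point → W'.toProjective.Point}
    {β : W'.toProjective.Point → W''.toProjective.Point} {d e : ℕ}
    {f g : Fin 3 → MvPolynomial (Fin 3) K} (hf : Rep K α d f) (hg : Rep K β e g) :
    Rep K (β ∘ α) (d * e) fun i => MvPolynomial.aeval f (g i) where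
  homogeneous i := (hg.homogeneous i).aeval f hf.homogeneous
  eq_point Q q hQ h := by
    have hev : ∀ i, MvPolynomial.aeval q (MvPolynomial.aeval f (g i)) =
        MvPolynomial.aeval (fun j => MvPolynomial.aeval q (f j)) (g i) := fun i =>
      MvPolynomial.comp_aeval_apply f (MvPolynomial.aeval q) (g i)
    simp only [hev] at h ⊢
    exact hg.eq_point_of_ne_zero (hf.eq_point Q q hQ) h

lemma IsAlg.comp {α : W.toProjective.Point → W'.toProjective.Point}
    {β : W'.toProjective.Point → W''.toProjective.Point} (hα : IsAlg K α) (hβ : IsAlg K β) :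
    IsAlg K (β ∘ α) := by
  intro P p hP
  obtain ⟨d, f, hf, h0⟩ := hα P p hP
  obtain ⟨e, g, hg, h1⟩ := hβ (α P) _ (hf.eq_point P p hP h0)
  refine ⟨_, _, hf.comp hg, ?_⟩
  convert h1 using 2 with i
  exact MvPolynomial.comp_aeval_apply f (MvPolynomial.aeval p) (g i)

/-- Naturality lets one addition law be evaluated on polynomials, on geometric points and on power
series. -/
lemma aeval_addLaw {e : ℕ} {L : ∀ {R : Type u} [CommRing R], WeierstrassCurve R → (Fin 3 → R) →
      (Fin 3 → R) → Fin 3 → R} (hL : IsAddLaw.{u} e L) (E : WeierstrassCurve K)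
    {R S : Type u} [CommRing R] [CommRing S] [Algebra K R] [Algebra K S] (φ : R →ₐ[K] S)
    (p q : Fin 3 → R) (i : Fin 3) :
    φ (L (E.map (algebraMap K R)) p q i) =
      L (E.map (algebraMap K S)) (fun i => φ (p i)) (fun i => φ (q i)) i := by
  have h := congrFun (hL.map (φ : R →+* S) (E.map (algebraMap K R)) p q) i
  rw [WeierstrassCurve.map_map, AlgHom.comp_algebraMap] at h
  exact h.symm

lemma addLaw_zero_left {e : ℕ} {L : ∀ {R : Type u} [CommRing R], WeierstrassCurve R →
      (Fin 3 → R) → (Fin 3 → R) → Fin 3 → R} (hL : IsAddLaw.{u} e L) {R : Type u} [CommRing R]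
    (E : WeierstrassCurve R) (q : Fin 3 → R) : L E 0 q = 0 := by
  have := hL.smul E 0 1 0 q
  rwa [zero_smul, one_smul, zero_mul, zero_pow hL.pos.ne', zero_smul] at this

lemma addLaw_zero_right {e : ℕ} {L : ∀ {R : Type u} [CommRing R], WeierstrassCurve R →
      (Fin 3 → R) → (Fin 3 → R) → Fin 3 → R} (hL : IsAddLaw.{u} e L) {R : Type u} [CommRing R]
    (E : WeierstrassCurve R) (q : Fin 3 → R) : L E q 0 = 0 := by
  have := hL.smul E 1 0 q 0
  rwa [zero_smul, one_smul, mul_zero, zero_pow hL.pos.ne', zero_smul] at this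

/-- The law is applied to the two triples inside the polynomial ring. Bihomogeneity gives the
degree, by the scaling criterion. Where the result is nonzero both triples are nonzero, because the
law vanishes if one argument does. -/
lemma Rep.add [W'.IsElliptic] {E : WeierstrassCurve K} (hE : E.map (algebraMap K k) = W') {e : ℕ}
    {L : ∀ {R : Type u} [CommRing R], WeierstrassCurve R → (Fin 3 → R) → (Fin 3 → R) → Fin 3 → R}
    (hL : IsAddLaw.{u} e L) {α β : W.toProjective.Point → W'.toProjective.Point} {d d' : ℕ}
    {f g : Fin 3 → MvPolynomial (Fin 3) K} (hf : Rep K α d f) (hg : Rep K β d' g) :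
    Rep K (α + β) ((d + d') * e) (L (E.map (algebraMap K (MvPolynomial (Fin 3) K))) f g) where
  homogeneous i := by
    apply isHomogeneous_of_scale
    set ψ : MvPolynomial (Fin 3) K →ₐ[K] Polynomial (MvPolynomial (Fin 3) K) := MvPolynomial.aeval
      ((Polynomial.X : Polynomial (MvPolynomial (Fin 3) K)) •
        fun i => Polynomial.C (MvPolynomial.X i)) with hψ
    set χ : MvPolynomial (Fin 3) K →ₐ[K] Polynomial (MvPolynomial (Fin 3) K) :=
      IsScalarTower.toAlgHom K (MvPolynomial (Fin 3) K) (Polynomial (MvPolynomial (Fin 3) K))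
      with hχ
    have hscale : ∀ {n : ℕ} {p : MvPolynomial (Fin 3) K}, p.IsHomogeneous n →
        ψ p = Polynomial.X ^ n * χ p := by
      intro n p hp
      rw [hψ, aeval_smul_of_isHomogeneous hp]
      congr 1
      have := MvPolynomial.aeval_algebraMap_apply (Polynomial (MvPolynomial (Fin 3) K))
        (fun i => (MvPolynomial.X i : MvPolynomial (Fin 3) K)) p
      rw [MvPolynomial.aeval_X_left_apply] at this
      exact this
    have h1 : (fun j => ψ (f j)) = (Polynomial.X : Polynomial (MvPolynomial (Fin 3) K)) ^ d •
        fun j => χ (f j) := funext fun j => hscale (hf.homogeneous j)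
    have h2 : (fun j => ψ (g j)) = (Polynomial.X : Polynomial (MvPolynomial (Fin 3) K)) ^ d' •
        fun j => χ (g j) := funext fun j => hscale (hg.homogeneous j)
    rw [aeval_addLaw hL, h1, h2, hL.smul, Pi.smul_apply, smul_eq_mul, ← aeval_addLaw hL, ← pow_add,
      ← pow_mul]
    rfl
  eq_point Q q hQ h := by
    simp only [aeval_addLaw hL, hE] at h ⊢
    change L W' (fun i => MvPolynomial.aeval q (f i)) (fun i => MvPolynomial.aeval q (g i)) ≠ 0 at h
    have h1 : (fun i => MvPolynomial.aeval q (f i)) ≠ 0 := fun h0 =>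
      h (by rw [h0, addLaw_zero_left hL])
    have h2 : (fun i => MvPolynomial.aeval q (g i)) ≠ 0 := fun h0 =>
      h (by rw [h0, addLaw_zero_right hL])
    exact hL.add_point W' (hf.eq_point Q q hQ h1) (hg.eq_point Q q hQ h2) h

/-- Near each `P` the sum is represented through an addition law that is defined at the pair of
images of `P`. -/
lemma IsAlg.add [W'.IsElliptic] {E : WeierstrassCurve K} (hE : E.map (algebraMap K k) = W')
    {α β : W.toProjective.Point → W'.toProjective.Point} (hα : IsAlg K α) (hβ : IsAlg K β) :
    IsAlg K (α + β) := by
  intro P p hP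
  obtain ⟨d, f, hf, h0⟩ := hα P p hP
  obtain ⟨d', g, hg, h1⟩ := hβ P p hP
  obtain ⟨e, L, hL, hne⟩ := exists_isAddLaw W' (hf.eq_point P p hP h0) (hg.eq_point P p hP h1)
  refine ⟨_, _, hf.add hE hL hg, ?_⟩
  simp only [aeval_addLaw hL, hE]
  exact hne

lemma IsAlg.neg {E : WeierstrassCurve K} (hE : E.map (algebraMap K k) = W')
    {α : W.toProjective.Point → W'.toProjective.Point} (hα : IsAlg K α) : IsAlg K (-α) := by
  intro P p hP
  obtain ⟨d, f, hf, h0⟩ := hα P p hP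
  have hev : ∀ q : Fin 3 → k, (fun i => MvPolynomial.aeval q ((![f 0, -f 1 - MvPolynomial.C E.a₁ * f 0 -
      MvPolynomial.C E.a₃ * f 2, f 2] : Fin 3 → MvPolynomial (Fin 3) K) i)) =
      W'.toProjective.neg fun i => MvPolynomial.aeval q (f i) := by
    intro q
    rw [← hE]
    ext i
    fin_cases i <;> simp [WeierstrassCurve.Projective.neg, WeierstrassCurve.Projective.negY]
  have hpt : ∀ (Q : W.toProjective.Point) (q : Fin 3 → k), Q.point = ⟦q⟧ →
      (fun i => MvPolynomial.aeval q (f i)) ≠ 0 → ((-α) Q).point =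
        ⟦W'.toProjective.neg fun i => MvPolynomial.aeval q (f i)⟧ := by
    intro Q q hQ h
    rw [Pi.neg_apply, WeierstrassCurve.Projective.Point.neg_point, hf.eq_point Q q hQ h,
      WeierstrassCurve.Projective.negMap_eq]
  refine ⟨d, ![f 0, -f 1 - MvPolynomial.C E.a₁ * f 0 - MvPolynomial.C E.a₃ * f 2, f 2],
    ⟨fun i => ?_, fun Q q hQ h => ?_⟩, ?_⟩
  · fin_cases i
    · exact hf.homogeneous 0
    · exact ((hf.homogeneous 1).neg.sub ((hf.homogeneous 0).C_mul _)).sub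
        ((hf.homogeneous 2).C_mul _)
    · exact hf.homogeneous 2
  · rw [hev] at h ⊢
    refine hpt Q q hQ fun h0 => h ?_
    rw [h0]
    ext i
    fin_cases i <;> simp [WeierstrassCurve.Projective.neg, WeierstrassCurve.Projective.negY]
  · rw [hev]
    exact ne_zero_of_point (hpt P p hP h0)

end AlgebraicMap

/-! ### Algebraic maps that take the origin to the origin are homomorphisms -/

section Rigidity

variable {k : Type u} [Field k] {W W' : WeierstrassCurve k}

lemma aeval_of_ne_zero {g : MvPolynomial (Fin 3) k} {d : ℕ} (hg : g.IsHomogeneous d)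
    {q : Fin 3 → k} (hz : q 2 ≠ 0) : MvPolynomial.aeval q g =
      q 2 ^ d * MvPolynomial.aeval ![q 0 / q 2, q 1 / q 2, 1] g := by
  rw [← aeval_smul_of_isHomogeneous hg]
  congr 2
  ext i
  fin_cases i <;> simp [field]

/-- Under these conditions negation would be trivial on points, and the discriminant would vanish.
-/
lemma not_two_torsion [W.IsElliptic] (h2 : (2 : k) = 0) (h1 : W.a₁ = 0) (h3 : W.a₃ = 0) :
    False := by
  refine W.isUnit_Δ.ne_zero ?_
  have hb2 : W.b₂ = 0 := by rw [WeierstrassCurve.b₂, h1]; linear_combination 2 * W.a₂ * h2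
  have hb4 : W.b₄ = 0 := by rw [WeierstrassCurve.b₄, h1]; linear_combination W.a₄ * h2
  have hb6 : W.b₆ = 0 := by rw [WeierstrassCurve.b₆, h3]; linear_combination 2 * W.a₆ * h2
  rw [WeierstrassCurve.Δ, hb2, hb4, hb6]
  ring

variable [IsAlgClosed k]

/-- Irreducibility of the curve, deduced from the fact that the power series ring is a domain. -/
lemma vanishesOn_mul {g h : MvPolynomial (Fin 3) k} {d e : ℕ} (hg : g.IsHomogeneous d)
    (hh : h.IsHomogeneous e) (hgh : VanishesOn W (g * h)) : VanishesOn W g ∨ VanishesOn W h := by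
  rw [← expand_eq_zero_iff W hg, ← expand_eq_zero_iff W hh, ← mul_eq_zero, expand, expand,
    ← map_mul]
  exact expand_eq_zero_of_vanishesOn W hgh

lemma not_vanishesOn_Z : ¬ VanishesOn W (MvPolynomial.X 2) := by
  rw [← expand_eq_zero_iff W (MvPolynomial.isHomogeneous_X k 2)]
  simpa [expand] using sSeries_ne_zero W

/-- Algebraic maps that agree on a dense open set are equal. -/
lemma eq_of_agree [W.IsElliptic] {α β : W.toProjective.Point → W'.toProjective.Point}
    (hα : IsAlg k α) (hβ : IsAlg k β) {h : MvPolynomial (Fin 3) k} {e : ℕ}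
    (hh : h.IsHomogeneous e) (h0 : ¬ VanishesOn W h)
    (hag : ∀ (P : W.toProjective.Point) (p : Fin 3 → k), P.point = ⟦p⟧ →
      MvPolynomial.aeval p h ≠ 0 → α P = β P) : α = β := by
  funext P
  obtain ⟨p, hp, hp0, hpE⟩ := exists_rep P
  obtain ⟨d, f, hf, hfp⟩ := hα P p hp
  obtain ⟨d', g, hg, hgp⟩ := hβ P p hp
  refine point_eq_iff.mpr ?_
  rw [hf.eq_point P p hp hfp, hg.eq_point P p hp hgp]
  refine mk_eq_of_cross hfp hgp fun i j => ?_
  -- The cross differences vanish wherever `h` does not; irreducibility removes the factor `h`.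
  have hv : VanishesOn W ((f i * g j - f j * g i) * h) := by
    intro q hq hE
    obtain ⟨Q, hQ⟩ := exists_point hq hE
    rw [map_mul]
    by_cases hqh : MvPolynomial.aeval q h = 0
    · rw [hqh, mul_zero]
    · rw [map_sub, map_mul, map_mul, hf.cross hg hQ hQ (hag Q q hQ hqh) i j, sub_self, zero_mul]
  have := (vanishesOn_mul (((hf.homogeneous i).mul (hg.homogeneous j)).sub
    ((hf.homogeneous j).mul (hg.homogeneous i))) hh hv).resolve_right h0 p hp0 hpE
  rwa [map_sub, map_mul, map_mul, sub_eq_zero] at this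

/-- An even algebraic map is constant. -/
theorem eq_const_of_even [W.IsElliptic] [W'.IsElliptic]
    {α : W.toProjective.Point → W'.toProjective.Point} (hα : IsAlg k α)
    (heven : ∀ P, α (-P) = α P) (P : W.toProjective.Point) : α P = α 0 := by
  obtain ⟨d, f, hf, hf0⟩ := hα 0 ![0, 1, 0] WeierstrassCurve.Projective.Point.zero_point
  choose a b hab using fun i => exists_normal_form W (f i)
  have hab' : ∀ i (x y : k), AffineEquation W x y →
      MvPolynomial.aeval ![x, y, 1] (f i) = (a i).eval x + (b i).eval x * y := by
    intro i x y h
    simpa [Polynomial.coe_aeval_eq_eval] using hab i x y h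
  -- the normal forms are proportional
  have hD : ∀ i j, a i * b j = a j * b i := by
    intro i j
    -- Evenness compares `a + b y` with its conjugate: `a i * b j - a j * b i` times `2 y + a₁ x +
    -- a₃` vanishes on the curve. The second factor is not identically zero, in characteristic 2 by
    -- `not_two_torsion`.
    have key := eq_zero_of_forall_point W
      (a := (a i * b j - a j * b i) * (Polynomial.C W.a₁ * Polynomial.X + Polynomial.C W.a₃))
      (b := (a i * b j - a j * b i) * Polynomial.C 2) ?_
    · by_contra hne
      have hne := sub_ne_zero.mpr hne
      have h1 := (mul_eq_zero.mp key.1).resolve_left hne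
      have h2 := (mul_eq_zero.mp key.2).resolve_left hne
      refine not_two_torsion (W := W) ?_ ?_ ?_
      · simpa only [Polynomial.C_eq_zero] using h2
      · simpa using congrArg (Polynomial.coeff · 1) h1
      · simpa using congrArg (Polynomial.coeff · 0) h1
    · intro x y h
      have hn := affineEquation_neg W h
      obtain ⟨Q, hQ⟩ := exists_point (affine_ne_zero x y) (equation_affine W h)
      have hQ' : (-Q).point = ⟦![x, -y - W.a₁ * x - W.a₃, 1]⟧ := by
        rw [WeierstrassCurve.Projective.Point.neg_point, hQ,
          WeierstrassCurve.Projective.negMap_eq]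
        simp [WeierstrassCurve.Projective.neg, WeierstrassCurve.Projective.negY]
      have := hf.cross hf hQ hQ' (heven Q).symm i j
      rw [hab' _ _ _ h, hab' _ _ _ h, hab' _ _ _ hn, hab' _ _ _ hn] at this
      simp only [Polynomial.eval_mul, Polynomial.eval_sub, Polynomial.eval_add, Polynomial.eval_C,
        Polynomial.eval_X]
      linear_combination -this
  -- hence they are proportional to a triple of polynomials in `x`
  obtain ⟨l, hl⟩ : ∃ l, ¬ VanishesOn W (f l) := by
    by_contra! hall
    exact hf0 (funext fun i => hall i _ (by simp) (by
      rw [WeierstrassCurve.Projective.equation_iff]; simp))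
  have hl' : ¬ (a l = 0 ∧ b l = 0) := by
    rwa [← expand_eq_zero_iff_normal_form W (hf.homogeneous l) (hab l),
      expand_eq_zero_iff W (hf.homogeneous l)]
  -- Since `a` and `b` are proportional, whichever of them is nonzero can serve as `v`.
  obtain ⟨v, hv0, hva, hvb⟩ : ∃ v : Fin 3 → Polynomial k, v ≠ 0 ∧
      (∀ i j, v i * a j = v j * a i) ∧ ∀ i j, v i * b j = v j * b i := by
    by_cases ha : a = 0
    · refine ⟨b, fun hb => hl' ⟨congrFun ha l, congrFun hb l⟩, fun i j => ?_, fun i j => mul_comm _ _⟩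
      simp [ha]
    · exact ⟨a, ha, fun i j => mul_comm _ _, hD⟩
  have hvf : ∀ i j (x y : k), AffineEquation W x y →
      (v i).eval x * MvPolynomial.aeval ![x, y, 1] (f j) =
        (v j).eval x * MvPolynomial.aeval ![x, y, 1] (f i) := by
    intro i j x y h
    rw [hab' _ _ _ h, hab' _ _ _ h]
    have h1 := congrArg (Polynomial.eval x) (hva i j)
    have h2 := congrArg (Polynomial.eval x) (hvb i j)
    simp only [Polynomial.eval_mul] at h1 h2
    linear_combination h1 + y * h2
  have hvl : v l ≠ 0 := by
    intro h
    obtain ⟨i, hi⟩ := Function.ne_iff.mp hv0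
    refine hl' ⟨?_, ?_⟩
    · have := hva i l
      rw [h, zero_mul] at this
      exact (mul_eq_zero.mp this).resolve_left hi
    · have := hvb i l
      rw [h, zero_mul] at this
      exact (mul_eq_zero.mp this).resolve_left hi
  have hvE : (W'.map Polynomial.C).toProjective.Equation v := by
    rw [WeierstrassCurve.Projective.equation_iff]
    simp only [WeierstrassCurve.map_a₁, WeierstrassCurve.map_a₂, WeierstrassCurve.map_a₃,
      WeierstrassCurve.map_a₄, WeierstrassCurve.map_a₆]
    set G : Polynomial k := v 1 ^ 2 * v 2 + Polynomial.C W'.a₁ * v 0 * v 1 * v 2 +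
      Polynomial.C W'.a₃ * v 1 * v 2 ^ 2 - (v 0 ^ 3 + Polynomial.C W'.a₂ * v 0 ^ 2 * v 2 +
      Polynomial.C W'.a₄ * v 0 * v 2 ^ 2 + Polynomial.C W'.a₆ * v 2 ^ 3) with hG
    by_contra hG0
    have key := eq_zero_of_forall_point W (a := G * a l) (b := G * b l) ?_
    · exact hl' ⟨(mul_eq_zero.mp key.1).resolve_left hG0, (mul_eq_zero.mp key.2).resolve_left hG0⟩
    · intro x y h
      obtain ⟨Q, hQ⟩ := exists_point (affine_ne_zero x y) (equation_affine W h)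
      have hE := hf.equation hQ
      rw [WeierstrassCurve.Projective.equation_iff] at hE
      have h0 := hvf l 0 x y h
      have h1 := hvf l 1 x y h
      have h2 := hvf l 2 x y h
      have hsplit : (G * a l).eval x + (G * b l).eval x * y =
          G.eval x * MvPolynomial.aeval ![x, y, 1] (f l) := by
        rw [hab' _ _ _ h, Polynomial.eval_mul, Polynomial.eval_mul]
        ring
      rw [hsplit]
      -- The relations `v i * f l = v l * f i` turn the equation for `v`, times the cube of `f l`,
      -- into `v l ^ 3` times the equation satisfied by `f`.
      have hcube : G.eval x * MvPolynomial.aeval ![x, y, 1] (f l) ^ 3 = 0 := by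
        have e0 := h0.symm
        have e1 := h1.symm
        have e2 := h2.symm
        have : G.eval x * MvPolynomial.aeval ![x, y, 1] (f l) ^ 3 = (v l).eval x ^ 3 * 0 := by
          rw [← hE, hG]
          simp only [Polynomial.eval_sub, Polynomial.eval_add, Polynomial.eval_mul,
            Polynomial.eval_pow, Polynomial.eval_C]
          generalize MvPolynomial.aeval ![x, y, 1] (f 0) = g0 at *
          generalize MvPolynomial.aeval ![x, y, 1] (f 1) = g1 at *
          generalize MvPolynomial.aeval ![x, y, 1] (f 2) = g2 at *
          generalize MvPolynomial.aeval ![x, y, 1] (f l) = gl at *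
          generalize Polynomial.eval x (v 0) = v0 at *
          generalize Polynomial.eval x (v 1) = v1 at *
          generalize Polynomial.eval x (v 2) = v2 at *
          generalize Polynomial.eval x (v l) = vl at *
          calc _ = (v1 * gl) ^ 2 * (v2 * gl) + W'.a₁ * (v0 * gl) * (v1 * gl) * (v2 * gl) +
              W'.a₃ * (v1 * gl) * (v2 * gl) ^ 2 - ((v0 * gl) ^ 3 +
              W'.a₂ * (v0 * gl) ^ 2 * (v2 * gl) + W'.a₄ * (v0 * gl) * (v2 * gl) ^ 2 +
              W'.a₆ * (v2 * gl) ^ 3) := by ring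
            _ = _ := by rw [e0, e1, e2]; ring
        rw [this, mul_zero]
      rcases mul_eq_zero.mp hcube with h | h
      · rw [h, zero_mul]
      · rw [pow_eq_zero_iff three_ne_zero |>.mp h, mul_zero]
  -- which is a multiple of a constant triple
  obtain ⟨c, w, hc0, hw0, hcw⟩ := exists_const_of_equation W' hv0 hvE
  have hcf : ∀ i j (x y : k), AffineEquation W x y →
      c i * MvPolynomial.aeval ![x, y, 1] (f j) = c j * MvPolynomial.aeval ![x, y, 1] (f i) := by
    intro i j x y h
    have h1 : Polynomial.C (c i) * a j = Polynomial.C (c j) * a i := by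
      have := hva i j
      rw [hcw, hcw] at this
      exact mul_left_cancel₀ hw0 (by linear_combination this)
    have h2 : Polynomial.C (c i) * b j = Polynomial.C (c j) * b i := by
      have := hvb i j
      rw [hcw, hcw] at this
      exact mul_left_cancel₀ hw0 (by linear_combination this)
    rw [hab' _ _ _ h, hab' _ _ _ h]
    have h1 := congrArg (Polynomial.eval x) h1
    have h2 := congrArg (Polynomial.eval x) h2
    simp only [Polynomial.eval_mul, Polynomial.eval_C] at h1 h2
    linear_combination h1 + y * h2
  have hcE : W'.toProjective.Equation c := by
    rw [WeierstrassCurve.Projective.equation_iff] at hvE ⊢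
    simp only [WeierstrassCurve.map_a₁, WeierstrassCurve.map_a₂, WeierstrassCurve.map_a₃,
      WeierstrassCurve.map_a₄, WeierstrassCurve.map_a₆, hcw] at hvE
    rw [← Polynomial.C_eq_zero]
    simp only [map_add, map_sub, map_mul, map_pow]
    refine mul_left_cancel₀ (pow_ne_zero 3 hw0) ?_
    rw [mul_zero]
    linear_combination hvE
  obtain ⟨R, hR⟩ := exists_point hc0 hcE
  -- The constant is attained off the zeros of `f l` and `Z`, which is a dense set.
  have hconst : α = fun _ => R := by
    refine eq_of_agree hα (isAlg_const R)
      ((hf.homogeneous l).mul (MvPolynomial.isHomogeneous_X k 2)) (fun hv => ?_) ?_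
    · rcases vanishesOn_mul (hf.homogeneous l) (MvPolynomial.isHomogeneous_X k 2) hv with h | h
      exacts [hl h, not_vanishesOn_Z h]
    · intro Q q hQ hne
      rw [map_mul, MvPolynomial.aeval_X] at hne
      have hz := right_ne_zero_of_mul hne
      have hA := affineEquation_of_equation W (nonsingular_of_point hQ).1 hz
      have hne' : (fun i => MvPolynomial.aeval q (f i)) ≠ 0 := fun h0 =>
        left_ne_zero_of_mul hne (congrFun h0 l)
      rw [point_eq_iff, hf.eq_point Q q hQ hne', hR]
      refine mk_eq_of_cross hne' hc0 fun i j => ?_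
      rw [aeval_of_ne_zero (hf.homogeneous i) hz, aeval_of_ne_zero (hf.homogeneous j) hz]
      linear_combination q 2 ^ d * hcf j i _ _ hA
  rw [hconst]

/-- An algebraic map that takes the origin to the origin is a homomorphism. -/
theorem map_add_of_map_zero [W.IsElliptic] [W'.IsElliptic]
    {α : W.toProjective.Point → W'.toProjective.Point} (hα : IsAlg k α) (h0 : α 0 = 0)
    (P Q : W.toProjective.Point) : α (P + Q) = α P + α Q := by
  have hid : ∀ V : WeierstrassCurve k, V.map (algebraMap k k) = V := fun V => V.map_id
  have htr : ∀ Q : W.toProjective.Point, IsAlg k fun P => α (Q + P) := fun Q =>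
    ((isAlg_const Q).add (hid W) isAlg_id).comp hα
  have hneg : IsAlg k fun P : W.toProjective.Point => -P := isAlg_id.neg (hid W)
  -- The left side is even in `P`, hence equal to its value at `P = 0`.
  have hsum : ∀ Q P, α (Q + P) + α (Q - P) = α Q + α Q := by
    intro Q P
    have := eq_const_of_even (α := fun P => α (Q + P) + α (Q + -P))
      ((htr Q).add (hid W') (hneg.comp (htr Q))) (fun P => by rw [neg_neg, add_comm]) P
    simpa [sub_eq_add_neg] using this
  have hodd : ∀ P, α (-P) = -α P := by
    intro P
    have := hsum 0 P
    rw [zero_add, zero_sub, h0, add_zero] at this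
    exact eq_neg_of_add_eq_zero_right this
  have hdouble : ∀ P, α (P + P) = α P + α P := by
    intro P
    have := hsum P P
    rwa [sub_self, h0, add_zero] at this
  have hdiff : ∀ P, α (P + Q) - α P - α Q = 0 := by
    intro P
    -- Applying `hsum` to `P + Q` and `P - Q`, whose sum and difference are `2P` and `2Q`, shows
    -- that twice the defect is zero.
    have htwo : ∀ P, (α (P + Q) - α P - α Q) + (α (P + Q) - α P - α Q) = 0 := by
      intro P
      have h1 := hsum (P + Q) (P - Q)
      rw [show P + Q + (P - Q) = P + P by abel, show P + Q - (P - Q) = Q + Q by abel,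
        hdouble, hdouble] at h1
      rw [show (α (P + Q) - α P - α Q) + (α (P + Q) - α P - α Q) =
        (α (P + Q) + α (P + Q)) - (α P + α P + (α Q + α Q)) by abel, ← h1, sub_self]
    -- Replacing `P` by `-P` negates the defect, by `hsum` and oddness; as it is 2-torsion, it is
    -- even. Its value at `P = 0` is zero.
    have := eq_const_of_even (α := fun P => α (Q + P) + -α P + -α Q)
      (((htr Q).add (hid W') (hα.neg (hid W'))).add (hid W') (isAlg_const _)) (fun P => ?_) P
    · simpa [h0, sub_eq_add_neg, add_comm P Q] using this
    · have h1 := htwo P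
      have h2 := hsum Q P
      rw [add_comm P Q] at h1
      rw [hodd, ← sub_eq_add_neg Q P, eq_sub_of_add_eq' h2]
      rw [← sub_eq_zero, ← neg_eq_zero, ← h1]
      abel
  have := hdiff P
  rwa [sub_sub, sub_eq_zero] at this

end Rigidity

/-! ### Transfer of identities from geometric points to power series -/

section Transfer

variable {σ : Type} {K : Type u} [Field K]

/-- The point `(g, -1, S(g))` of the curve with power series coordinates. -/
def chartPoint (E : WeierstrassCurve K) (g : MvPowerSeries σ K) : Fin 3 → MvPowerSeries σ K :=
  ![g, -1, PowerSeries.subst g (sSeries E)]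

lemma aeval_chartPoint (E : WeierstrassCurve K) {g : MvPowerSeries σ K}
    (hg : PowerSeries.HasSubst g) (h : MvPolynomial (Fin 3) K) :
    MvPolynomial.aeval (chartPoint E g) h = PowerSeries.subst g (expand E h) := by
  rw [expand, ← PowerSeries.coe_substAlgHom hg, MvPolynomial.comp_aeval_apply]
  congr 2
  ext i : 1
  fin_cases i
  · simp [chartPoint, PowerSeries.coe_substAlgHom, PowerSeries.subst_X hg]
  · simp [chartPoint]
  · simp [chartPoint, PowerSeries.coe_substAlgHom]

lemma map_chartPoint {k : Type u} [Field k] (φ : K →+* k) (E : WeierstrassCurve K)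
    {g : MvPowerSeries σ K} (hg : PowerSeries.HasSubst g) (i : Fin 3) :
    MvPowerSeries.map φ (chartPoint E g i) =
      chartPoint (E.map φ) (MvPowerSeries.map φ g) i := by
  fin_cases i
  · simp [chartPoint]
  · simp [chartPoint]
  · simp [chartPoint, PowerSeries.map_subst hg, ← map_sSeries]

variable {k : Type u} [Field k] [IsAlgClosed k] {W : WeierstrassCurve k}

/-- A polynomial with power series coefficients that vanishes at the points of the curve vanishes at
the points of the curve with power series coordinates. -/
lemma aeval_chartPoint_eq_zero {H : MvPolynomial (Fin 3) (MvPowerSeries σ k)}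
    (hH : ∀ q : Fin 3 → k, q ≠ 0 → W.toProjective.Equation q →
      MvPolynomial.aeval (fun i => MvPowerSeries.C (σ := σ) (q i)) H = 0)
    {g : MvPowerSeries σ k} (hg : PowerSeries.HasSubst g) :
    MvPolynomial.aeval (chartPoint W g) H = 0 := by
  classical
  -- Taking the coefficient at `e` of each coefficient of `H` gives a polynomial over `k`. Each of
  -- these vanishes on the curve, hence at the power series point, and together they recover `H`.
  let c : (σ →₀ ℕ) → MvPolynomial (Fin 3) k := fun e =>
    ∑ m ∈ H.support, MvPolynomial.monomial m (MvPowerSeries.coeff e (H.coeff m))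
  have hc : ∀ e {R : Type u} [CommRing R] [Algebra k R] (q : Fin 3 → R),
      MvPolynomial.aeval q (c e) = ∑ m ∈ H.support,
        algebraMap k R (MvPowerSeries.coeff e (H.coeff m)) * ∏ i, q i ^ m i := by
    intro e R _ _ q
    simp only [c, map_sum, MvPolynomial.aeval_monomial, Finsupp.prod_fintype, pow_zero,
      implies_true]
  have hv : ∀ e, VanishesOn W (c e) := by
    intro e q hq hE
    have := congrArg (MvPowerSeries.coeff e) (hH q hq hE)
    rw [MvPolynomial.aeval_def, MvPolynomial.eval₂_eq', map_sum, map_zero] at this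
    rw [hc, ← this]
    refine Finset.sum_congr rfl fun m _ => ?_
    simp only [← map_pow, ← map_prod, Algebra.algebraMap_self, RingHom.id_apply,
      MvPowerSeries.coeff_mul_C]
  have hz : ∀ e, MvPolynomial.aeval (chartPoint W g) (c e) = 0 := fun e => by
    rw [aeval_chartPoint W hg, expand_eq_zero_of_vanishesOn W (hv e),
      ← PowerSeries.coe_substAlgHom hg, map_zero]
  ext e
  rw [MvPolynomial.aeval_def, MvPolynomial.eval₂_eq', map_sum, map_zero]
  simp only [Algebra.algebraMap_self, RingHom.id_apply, MvPowerSeries.coeff_mul]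
  rw [Finset.sum_comm]
  refine Finset.sum_eq_zero fun x _ => ?_
  have := congrArg (MvPowerSeries.coeff x.2) (hz x.1)
  rw [hc, map_sum, map_zero] at this
  rw [← this]
  refine Finset.sum_congr rfl fun m _ => ?_
  rw [← Algebra.smul_def, map_smul, smul_eq_mul]

/-- The geometric points are replaced one at a time. At each stage the coordinates of the other
points, series or constants, are absorbed into the coefficients of a polynomial in a single point.
-/
lemma aeval_chartPoints_eq_zero {ι : Type} [Finite ι] {G : MvPolynomial (ι × Fin 3) k}
    (hG : ∀ q : ι → Fin 3 → k, (∀ i, q i ≠ 0 ∧ W.toProjective.Equation (q i)) →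
      MvPolynomial.aeval (fun ij => q ij.1 ij.2) G = 0)
    {g : ι → MvPowerSeries σ k} (hg : ∀ i, PowerSeries.HasSubst (g i)) :
    MvPolynomial.aeval (fun ij => chartPoint W (g ij.1) ij.2) G = 0 := by
  classical
  have := Fintype.ofFinite ι
  have key : ∀ (s : Finset ι) (q : ι → Fin 3 → k),
      (∀ i, q i ≠ 0 ∧ W.toProjective.Equation (q i)) →
      MvPolynomial.aeval (fun ij => if ij.1 ∈ s then chartPoint W (g ij.1) ij.2 else
        MvPowerSeries.C (q ij.1 ij.2)) G = 0 := by
    intro s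
    induction s using Finset.induction_on with
    | empty =>
      intro q hq
      have := congrArg (algebraMap k (MvPowerSeries σ k)) (hG q hq)
      rw [map_zero, ← MvPolynomial.aeval_algebraMap_apply] at this
      simp only [Finset.notMem_empty, if_false]
      exact this
    | insert j s hj ih =>
      intro q hq
      let H : MvPolynomial (Fin 3) (MvPowerSeries σ k) := MvPolynomial.aeval (fun ij =>
        if ij.1 = j then MvPolynomial.X ij.2 else MvPolynomial.C
          (if ij.1 ∈ s then chartPoint W (g ij.1) ij.2 else MvPowerSeries.C (q ij.1 ij.2))) G
      have hH : ∀ r : Fin 3 → MvPowerSeries σ k, MvPolynomial.aeval r H =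
          MvPolynomial.aeval (fun ij => if ij.1 = j then r ij.2 else
            if ij.1 ∈ s then chartPoint W (g ij.1) ij.2 else MvPowerSeries.C (q ij.1 ij.2)) G := by
        intro r
        have := MvPolynomial.comp_aeval_apply (fun ij : ι × Fin 3 =>
          if ij.1 = j then MvPolynomial.X ij.2 else MvPolynomial.C
          (if ij.1 ∈ s then chartPoint W (g ij.1) ij.2 else MvPowerSeries.C (q ij.1 ij.2)))
          ((MvPolynomial.aeval r : MvPolynomial (Fin 3) (MvPowerSeries σ k) →ₐ[_] _).restrictScalars
            k) G
        refine this.trans ?_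
        congr 2
        ext ij : 1
        by_cases h : ij.1 = j <;> simp [h]
      have h0 := aeval_chartPoint_eq_zero (W := W) (H := H) (fun r hr hE => ?_) (hg j)
      · rw [hH] at h0
        rw [← h0]
        congr 2
        ext ij : 1
        by_cases h : ij.1 = j
        · simp [h]
        · simp [h]
      · rw [hH, ← ih (Function.update q j r) fun i => ?_]
        · congr 2
          ext ij : 1
          by_cases h : ij.1 = j
          · simp [h, hj]
          · simp [h]
        · by_cases h : i = j
          · subst h
            simpa using ⟨hr, hE⟩
          · simpa [h] using hq i
  by_cases hq : ∃ q : Fin 3 → k, q ≠ 0 ∧ W.toProjective.Equation q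
  · obtain ⟨q, hq⟩ := hq
    simpa using key Finset.univ (fun _ => q) fun _ => hq
  · exact absurd ⟨![0, 1, 0], by simp, by simp [WeierstrassCurve.Projective.equation_iff]⟩ hq

/-- A polynomial relation over `K` between geometric points of an elliptic curve holds for the points
with power series coordinates. -/
theorem aeval_chartPoints_eq_zero_of_geometric [Algebra K k] {ι : Type} [Finite ι]
    {E : WeierstrassCurve K} {G : MvPolynomial (ι × Fin 3) K}
    (hG : ∀ q : ι → Fin 3 → k,
      (∀ i, q i ≠ 0 ∧ (E.map (algebraMap K k)).toProjective.Equation (q i)) →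
      MvPolynomial.aeval (fun ij => q ij.1 ij.2) G = 0)
    {g : ι → MvPowerSeries σ K} (hg : ∀ i, MvPowerSeries.constantCoeff (g i) = 0) :
    MvPolynomial.aeval (fun ij => chartPoint E (g ij.1) ij.2) G = 0 := by
  have hg' := fun i => PowerSeries.HasSubst.of_constantCoeff_zero (hg i)
  have h := aeval_chartPoints_eq_zero (σ := σ) (W := E.map (algebraMap K k))
    (G := MvPolynomial.map (algebraMap K k) G)
    (g := fun i => MvPowerSeries.map (algebraMap K k) (g i)) (fun q hq => by
      rw [MvPolynomial.aeval_map_algebraMap]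
      exact hG q hq) (fun i => PowerSeries.HasSubst.of_constantCoeff_zero (by simp [hg i]))
  have hinj : Function.Injective (MvPowerSeries.map (σ := σ) (algebraMap K k)) := by
    intro x y hxy
    ext e
    have := congrArg (MvPowerSeries.coeff e) hxy
    simpa using this
  refine hinj ?_
  rw [map_zero, ← h]
  simp only [← map_chartPoint _ _ (hg' _)]
  rw [MvPolynomial.aeval_def, MvPolynomial.aeval_def, MvPolynomial.eval₂_map,
    ← MvPolynomial.coe_eval₂Hom, ← MvPolynomial.coe_eval₂Hom, MvPolynomial.map_eval₂Hom]
  congr 2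
  ext x
  simp [MvPowerSeries.algebraMap_apply]

end Transfer

/-! ### The addition law near the origin and the formal group law -/

section OriginAdd

variable {K : Type u} [Field K] (E : WeierstrassCurve K)

/-- The addition law near the origin over a `K`-algebra. -/
def originAdd {R : Type u} [CommRing R] [Algebra K R] (p q : Fin 3 → R) : Fin 3 → R :=
  originLaw (E.map (algebraMap K R)) p q

lemma map_originAdd {R S : Type u} [CommRing R] [CommRing S] [Algebra K R] [Algebra K S]
    (φ : R →ₐ[K] S) (p q : Fin 3 → R) (i : Fin 3) :
    φ (originAdd E p q i) = originAdd E (fun i => φ (p i)) (fun i => φ (q i)) i :=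
  aeval_addLaw isAddLaw_originLaw E φ p q i

lemma originAdd_smul {R : Type u} [CommRing R] [Algebra K R] (a b : R) (p q : Fin 3 → R) :
    originAdd E (a • p) (b • q) = (a * b) ^ 18 • originAdd E p q :=
  originLaw_smul _ a b p q

lemma originAdd_origin {R : Type u} [CommRing R] [Algebra K R] :
    originAdd E (![0, 1, 0] : Fin 3 → R) ![0, 1, 0] = ![0, 1, 0] :=
  originLaw_origin _

end OriginAdd

/-! ### Points with power series coordinates near the origin. -/

section ChartPoint

variable {σ : Type} {K : Type u} [Field K] (E : WeierstrassCurve K)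

lemma chartPoint_equation {g : MvPowerSeries σ K} (hg : PowerSeries.HasSubst g) :
    PowerSeries.subst g (sSeries E) = g ^ 3
      + MvPowerSeries.C E.a₁ * g * PowerSeries.subst g (sSeries E)
      + MvPowerSeries.C E.a₂ * g ^ 2 * PowerSeries.subst g (sSeries E)
      + MvPowerSeries.C E.a₃ * PowerSeries.subst g (sSeries E) ^ 2
      + MvPowerSeries.C E.a₄ * g * PowerSeries.subst g (sSeries E) ^ 2
      + MvPowerSeries.C E.a₆ * PowerSeries.subst g (sSeries E) ^ 3 := by
  have hC : ∀ a : K, PowerSeries.substAlgHom hg (PowerSeries.C a) = MvPowerSeries.C a := fun a => by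
    rw [PowerSeries.coe_substAlgHom hg, PowerSeries.subst_C]
  have h := congrArg (PowerSeries.substAlgHom hg) (sStep_sSeries E)
  simp only [sStep, map_add, map_mul, map_pow, hC, PowerSeries.substAlgHom_X] at h
  simp only [PowerSeries.coe_substAlgHom] at h
  exact h.symm

lemma constantCoeff_subst_sSeries {g : MvPowerSeries σ K} (hg : MvPowerSeries.constantCoeff g = 0) :
    MvPowerSeries.constantCoeff (PowerSeries.subst g (sSeries E)) = 0 :=
  PowerSeries.constantCoeff_subst_eq_zero hg _ (constantCoeff_sSeries E)

/-- A point of the curve with power series coordinates that reduces to the origin. -/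
lemma eq_smul_chartPoint {v : Fin 3 → MvPowerSeries σ K} {g : MvPowerSeries σ K}
    (hE : (E.map (algebraMap K (MvPowerSeries σ K))).toProjective.Equation v)
    (h0 : MvPowerSeries.constantCoeff (v 0) = 0) (h1 : MvPowerSeries.constantCoeff (v 1) ≠ 0)
    (h2 : MvPowerSeries.constantCoeff (v 2) = 0) (hg : g * v 1 = -v 0) :
    v = (-v 1) • chartPoint E g := by
  have hinv := MvPowerSeries.mul_inv_cancel _ h1
  set w := (v 1)⁻¹ with hw
  have hg' : g = -v 0 * w := by linear_combination w * hg - g * hinv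
  have hg0 : MvPowerSeries.constantCoeff g = 0 := by rw [hg']; simp [h0]
  -- Both sides solve the Weierstrass equation in the chart over the parameter `g` and have no
  -- constant term.
  have key : -v 2 * w = PowerSeries.subst g (sSeries E) := by
    refine eq_of_chart_equation E.a₁ E.a₂ E.a₃ E.a₄ E.a₆ hg0 (by simp [h2])
      (constantCoeff_subst_sSeries E hg0) ?_
      (chartPoint_equation E (PowerSeries.HasSubst.of_constantCoeff_zero hg0))
    rw [WeierstrassCurve.Projective.equation_iff] at hE
    simp only [WeierstrassCurve.map_a₁, WeierstrassCurve.map_a₂, WeierstrassCurve.map_a₃,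
      WeierstrassCurve.map_a₄, WeierstrassCurve.map_a₆, MvPowerSeries.algebraMap_apply,
      Algebra.algebraMap_self, RingHom.id_apply] at hE
    rw [hg']
    have hE' : (v 1 * w) ^ 2 * (v 2 * w) + MvPowerSeries.C E.a₁ * (v 0 * w) * (v 1 * w) * (v 2 * w)
        + MvPowerSeries.C E.a₃ * (v 1 * w) * (v 2 * w) ^ 2 - ((v 0 * w) ^ 3
        + MvPowerSeries.C E.a₂ * (v 0 * w) ^ 2 * (v 2 * w)
        + MvPowerSeries.C E.a₄ * (v 0 * w) * (v 2 * w) ^ 2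
        + MvPowerSeries.C E.a₆ * (v 2 * w) ^ 3) = 0 := by
      linear_combination w ^ 3 * hE
    rw [hinv] at hE'
    linear_combination -hE'
  ext i : 1
  rw [Pi.smul_apply, smul_eq_mul, chartPoint, ← key]
  fin_cases i
  · simp only [Fin.zero_eta, Matrix.cons_val]
    linear_combination hg
  · simp
  · simp only [Fin.reduceFinMk, Matrix.cons_val]
    linear_combination -v 2 * hinv

/-- The relation `N (t₁ - t₂) = D (s₁ - s₂)` for the slope `N / D`. -/
lemma chartNum_mul {R : Type u} [CommRing R] (W : WeierstrassCurve R) {t₁ s₁ t₂ s₂ : R}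
    (h₁ : s₁ = t₁ ^ 3 + W.a₁ * t₁ * s₁ + W.a₂ * t₁ ^ 2 * s₁ + W.a₃ * s₁ ^ 2 + W.a₄ * t₁ * s₁ ^ 2
      + W.a₆ * s₁ ^ 3)
    (h₂ : s₂ = t₂ ^ 3 + W.a₁ * t₂ * s₂ + W.a₂ * t₂ ^ 2 * s₂ + W.a₃ * s₂ ^ 2 + W.a₄ * t₂ * s₂ ^ 2
      + W.a₆ * s₂ ^ 3) :
    chartNum W ![t₁, -1, s₁] ![t₂, -1, s₂] * (t₁ - t₂) =
      chartDen W ![t₁, -1, s₁] ![t₂, -1, s₂] * (s₁ - s₂) := by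
  simp only [chartDen, chartNum, Matrix.cons_val]
  linear_combination h₂ - h₁

/-- The addition law in terms of the slope of the line. -/
lemma originLaw_chart {R : Type u} [CommRing R] (W : WeierstrassCurve R) {t₁ s₁ t₂ s₂ m b A A' : R}
    (hm : chartDen W ![t₁, -1, s₁] ![t₂, -1, s₂] * m = chartNum W ![t₁, -1, s₁] ![t₂, -1, s₂])
    (hb : b = s₁ - m * t₁) (hA : A = 1 + W.a₂ * m + W.a₄ * m ^ 2 + W.a₆ * m ^ 3) (hA' : A * A' = 1)
    {t₃ s₃ : R} (ht₃ : t₃ = -t₁ - t₂ - (W.a₁ * m + W.a₂ * b + W.a₃ * m ^ 2 + 2 * W.a₄ * m * b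
      + 3 * W.a₆ * m ^ 2 * b) * A') (hs₃ : s₃ = m * t₃ + b) :
    originLaw W ![t₁, -1, s₁] ![t₂, -1, s₂] =
      (A * chartDen W ![t₁, -1, s₁] ![t₂, -1, s₂] ^ 4) ^ 2 •
        ![t₃, 1 - W.a₁ * t₃ - W.a₃ * s₃, s₃] := by
  set D := chartDen W ![t₁, -1, s₁] ![t₂, -1, s₂] with hD
  have hlead : chartLead W ![t₁, -1, s₁] ![t₂, -1, s₂] = D ^ 3 * A := by
    rw [chartLead, ← hm, ← hD, hA]
    ring
  have hint : chartIntercept W ![t₁, -1, s₁] ![t₂, -1, s₂] = -D * b := by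
    rw [chartIntercept, ← hm, ← hD, hb]
    simp only [Matrix.cons_val]
    ring
  have hthird : chartThird W ![t₁, -1, s₁] ![t₂, -1, s₂] = D ^ 3 * A * t₃ := by
    rw [chartThird, hint, hlead, ← hm, ← hD, ht₃]
    simp only [Matrix.cons_val]
    linear_combination D ^ 3 * (W.a₁ * m + W.a₂ * b + W.a₃ * m ^ 2 + 2 * W.a₄ * m * b
      + 3 * W.a₆ * m ^ 2 * b) * hA'
  have hthird' : chartThird' W ![t₁, -1, s₁] ![t₂, -1, s₂] = D ^ 4 * A * s₃ := by
    rw [chartThird', hint, hlead, hthird, ← hm, hs₃]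
    simp only [Matrix.cons_val]
    ring
  rw [originLaw, hlead, hthird, hthird', ← hD]
  ext i
  fin_cases i <;> simp only [Fin.zero_eta, Fin.mk_one, Fin.reduceFinMk, Matrix.cons_val,
    Pi.smul_apply, smul_eq_mul] <;> ring

/-- The divided difference `(f(X₀) - f(X₁)) / (X₀ - X₁)`. -/
def dividedDifference (f : PowerSeries K) : MvPowerSeries (Fin 2) K :=
  fun e => PowerSeries.coeff (e 0 + e 1 + 1) f

/-- This is the expansion of `(X₀ ^ n - X₁ ^ n) / (X₀ - X₁)` for all `n` at once: multiplication by
`X₀ - X₁` telescopes, leaving only the pure powers. -/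
lemma dividedDifference_mul (f : PowerSeries K) :
    dividedDifference f * (MvPowerSeries.X 0 - MvPowerSeries.X 1) =
      PowerSeries.subst (MvPowerSeries.X 0 : MvPowerSeries (Fin 2) K) f -
        PowerSeries.subst (MvPowerSeries.X 1 : MvPowerSeries (Fin 2) K) f := by
  classical
  ext e
  have hm : ∀ e, MvPowerSeries.coeff e (dividedDifference f) =
      PowerSeries.coeff (e 0 + e 1 + 1) f := fun e => rfl
  rw [mul_sub, map_sub, map_sub, PowerSeries.coeff_subst_single, PowerSeries.coeff_subst_single,
    MvPowerSeries.X, MvPowerSeries.X, MvPowerSeries.coeff_mul_monomial,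
    MvPowerSeries.coeff_mul_monomial, hm, hm]
  simp only [Finsupp.single_le_iff, mul_one, Finsupp.ext_iff, Fin.forall_fin_two,
    Finsupp.single_eq_same, Finsupp.tsub_apply]
  rcases Nat.eq_zero_or_pos (e 0) with h0 | h0 <;> rcases Nat.eq_zero_or_pos (e 1) with h1 | h1
  · simp [h0, h1]
  · have : e 1 - 1 + 1 = e 1 := by omega
    simp [h0, h1.ne', this, Nat.one_le_iff_ne_zero]
  · have : e 0 - 1 + 1 = e 0 := by omega
    simp [h0.ne', h1, this, Nat.one_le_iff_ne_zero]
  · have h2 : e 0 - 1 + e 1 + 1 = e 0 + e 1 := by omega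
    have h3 : e 0 + (e 1 - 1) + 1 = e 0 + e 1 := by omega
    simp [h0.ne', h1.ne', h2, h3, Nat.one_le_iff_ne_zero]

end ChartPoint

/-! ### Formulas whose value may be the zero triple, and transfer of their relations. -/

section Coords

variable {K k : Type u} [Field K] [Field k] [Algebra K k]

/-- The triple `p` is zero or a triple of homogeneous coordinates of `P`. -/
def Coords {W : WeierstrassCurve k} (P : W.toProjective.Point) (p : Fin 3 → k) : Prop :=
  p ≠ 0 → P.point = ⟦p⟧

variable {E E' : WeierstrassCurve K}

lemma Coords.equation {W : WeierstrassCurve k} {P : W.toProjective.Point} {p : Fin 3 → k}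
    (h : Coords P p) : W.toProjective.Equation p := by
  by_cases h0 : p = 0
  · rw [h0, WeierstrassCurve.Projective.equation_iff]
    simp
  · exact (nonsingular_of_point (h h0)).1

/-- As zero triples are allowed, equality of points yields a relation without exceptions, to which
the transfer from geometric points applies. -/
lemma Coords.cross {W : WeierstrassCurve k} {P Q : W.toProjective.Point} {p q : Fin 3 → k}
    (hp : Coords P p) (hq : Coords Q q) (h : P = Q) (i j : Fin 3) : p i * q j = p j * q i := by
  by_cases hp0 : p = 0
  · simp [hp0]
  · by_cases hq0 : q = 0
    · simp [hq0]
    · exact cross_of_mk_eq ((hp hp0).symm.trans ((congrArg _ h).trans (hq hq0))) i j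

lemma Coords.add [E.IsElliptic] {P Q : (E.map (algebraMap K k)).toProjective.Point}
    {p q : Fin 3 → k} (hp : Coords P p) (hq : Coords Q q) : Coords (P + Q) (originAdd E p q) := by
  intro h
  refine isAddLaw_originLaw.add_point _ (hp fun h0 => h ?_) (hq fun h0 => h ?_) h
  · rw [h0]
    exact addLaw_zero_left isAddLaw_originLaw _ q
  · rw [h0]
    exact addLaw_zero_right isAddLaw_originLaw _ p

lemma Coords.neg {W : WeierstrassCurve k} {P : W.toProjective.Point} {p : Fin 3 → k}
    (hp : Coords P p) : Coords (-P) (W.toProjective.neg p) := by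
  intro h
  rw [WeierstrassCurve.Projective.Point.neg_point, hp, WeierstrassCurve.Projective.negMap_eq]
  rintro rfl
  refine h ?_
  ext i
  fin_cases i <;> simp [WeierstrassCurve.Projective.neg, WeierstrassCurve.Projective.negY]

lemma Rep.coords {W W' : WeierstrassCurve k} {α : W.toProjective.Point → W'.toProjective.Point}
    {d : ℕ} {f : Fin 3 → MvPolynomial (Fin 3) K} (hf : Rep K α d f) {P : W.toProjective.Point}
    {p : Fin 3 → k} (hp : Coords P p) : Coords (α P) fun i => MvPolynomial.aeval p (f i) :=
  hf.eq_point_of_ne_zero hp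

variable {σ ι : Type} [IsAlgClosed k] [Finite ι]

variable (k) in
/-- Proportionality of two vectors of formulas transfers from geometric points. -/
lemma cross_chartPoints [E.IsElliptic] {v w : Fin 3 → MvPolynomial (ι × Fin 3) K}
    (h : ∀ (P : ι → (E.map (algebraMap K k)).toProjective.Point) (q : ι → Fin 3 → k),
      (∀ i, Coords (P i) (q i)) → ∀ i j,
        MvPolynomial.aeval (fun l => q l.1 l.2) (v i) * MvPolynomial.aeval (fun l => q l.1 l.2) (w j) =
        MvPolynomial.aeval (fun l => q l.1 l.2) (v j) * MvPolynomial.aeval (fun l => q l.1 l.2) (w i))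
    {g : ι → MvPowerSeries σ K} (hg : ∀ i, MvPowerSeries.constantCoeff (g i) = 0) (i j : Fin 3) :
    MvPolynomial.aeval (fun l => chartPoint E (g l.1) l.2) (v i) *
        MvPolynomial.aeval (fun l => chartPoint E (g l.1) l.2) (w j) =
      MvPolynomial.aeval (fun l => chartPoint E (g l.1) l.2) (v j) *
        MvPolynomial.aeval (fun l => chartPoint E (g l.1) l.2) (w i) := by
  have := aeval_chartPoints_eq_zero_of_geometric (k := k) (E := E)
    (G := v i * w j - v j * w i) (fun q hq => ?_) hg
  · rwa [map_sub, map_mul, map_mul, sub_eq_zero] at this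
  · choose P hP using fun i => exists_point (hq i).1 (hq i).2
    rw [map_sub, map_mul, map_mul, sub_eq_zero]
    exact h P q (fun i _ => hP i) i j

variable (k) in
/-- The Weierstrass equation transfers from geometric points. -/
lemma equation_chartPoints [E.IsElliptic] {v : Fin 3 → MvPolynomial (ι × Fin 3) K}
    (h : ∀ (P : ι → (E.map (algebraMap K k)).toProjective.Point) (q : ι → Fin 3 → k),
      (∀ i, Coords (P i) (q i)) → (E'.map (algebraMap K k)).toProjective.Equation
        fun i => MvPolynomial.aeval (fun l => q l.1 l.2) (v i))
    {g : ι → MvPowerSeries σ K} (hg : ∀ i, MvPowerSeries.constantCoeff (g i) = 0) :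
    (E'.map (algebraMap K (MvPowerSeries σ K))).toProjective.Equation
      fun i => MvPolynomial.aeval (fun l => chartPoint E (g l.1) l.2) (v i) := by
  have := aeval_chartPoints_eq_zero_of_geometric (k := k) (E := E)
    (G := v 1 ^ 2 * v 2 + MvPolynomial.C E'.a₁ * v 0 * v 1 * v 2
      + MvPolynomial.C E'.a₃ * v 1 * v 2 ^ 2 - (v 0 ^ 3 + MvPolynomial.C E'.a₂ * v 0 ^ 2 * v 2
      + MvPolynomial.C E'.a₄ * v 0 * v 2 ^ 2 + MvPolynomial.C E'.a₆ * v 2 ^ 3)) (fun q hq => ?_) hg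
  · rw [WeierstrassCurve.Projective.equation_iff]
    simp only [map_sub, map_add, map_mul, map_pow, MvPolynomial.aeval_C] at this ⊢
    exact this
  · choose P hP using fun i => exists_point (hq i).1 (hq i).2
    have := h P q (fun i _ => hP i)
    rw [WeierstrassCurve.Projective.equation_iff] at this
    simp only [map_sub, map_add, map_mul, map_pow, MvPolynomial.aeval_C] at this ⊢
    exact this

end Coords

/-! ### The formal group law computes the addition near the origin. -/

section FormalGroupLaw

variable {σ : Type} {K : Type u} [Field K] (E : WeierstrassCurve K)

lemma coeff_one_sSeries : PowerSeries.coeff 1 (sSeries E) = 0 := by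
  obtain ⟨y, h, hy, -⟩ := exists_sSeries_eq E
  rw [h, show 1 = 0 + 1 from rfl, PowerSeries.coeff_succ_X_mul,
    PowerSeries.coeff_zero_eq_constantCoeff_apply, hy]

lemma chartPoint_injective {g h : MvPowerSeries σ K} (hc : ∀ i j,
    chartPoint E g i * chartPoint E h j = chartPoint E g j * chartPoint E h i) : g = h := by
  have := hc 0 1
  simp only [chartPoint, Matrix.cons_val] at this
  linear_combination -this

/-- The generic pair of points of the curve. -/
lemma aeval_originAdd_X {R : Type u} [CommRing R] [Algebra K R] {ι : Type} (q : ι → Fin 3 → R)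
    (a b : ι) (i : Fin 3) :
    MvPolynomial.aeval (fun l => q l.1 l.2) (originAdd E (fun j => MvPolynomial.X (a, j))
      (fun j => (MvPolynomial.X (b, j) : MvPolynomial (ι × Fin 3) K)) i) =
      originAdd E (q a) (q b) i := by
  rw [map_originAdd]
  simp

lemma hasSubst_pair {g h : MvPowerSeries σ K}
    (hg : MvPowerSeries.constantCoeff g = 0) (hh : MvPowerSeries.constantCoeff h = 0) :
    MvPowerSeries.HasSubst ![g, h] :=
  MvPowerSeries.hasSubst_of_constantCoeff_zero (by simp [Fin.forall_fin_two, hg, hh])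

lemma subst_chartPoint {τ : Type} {a : σ → MvPowerSeries τ K} (ha : MvPowerSeries.HasSubst a)
    {g : MvPowerSeries σ K} (hg : PowerSeries.HasSubst g) (i : Fin 3) :
    MvPowerSeries.substAlgHom ha (chartPoint E g i) =
      chartPoint E (MvPowerSeries.subst a g) i := by
  fin_cases i
  · simp [chartPoint, MvPowerSeries.substAlgHom_apply]
  · simp only [chartPoint, Fin.mk_one, Matrix.cons_val, map_neg, map_one]
  · simp only [chartPoint, Fin.reduceFinMk, Matrix.cons_val, MvPowerSeries.substAlgHom_apply]
    rw [PowerSeries.subst, MvPowerSeries.subst_comp_subst_apply hg.const ha]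
    rfl

variable [E.IsElliptic]

lemma originAdd_chartPoint_equation {g h : MvPowerSeries σ K}
    (hg : MvPowerSeries.constantCoeff g = 0) (hh : MvPowerSeries.constantCoeff h = 0) :
    (E.map (algebraMap K (MvPowerSeries σ K))).toProjective.Equation
      (originAdd E (chartPoint E g) (chartPoint E h)) := by
  have := equation_chartPoints (AlgebraicClosure K) (E := E) (E' := E) (ι := Fin 2)
    (v := originAdd E (fun j => MvPolynomial.X (0, j)) (fun j => MvPolynomial.X (1, j)))
    (fun P q hq => by
      simp only [aeval_originAdd_X]
      exact ((hq 0).add (hq 1)).equation) (g := ![g, h]) (by simp [Fin.forall_fin_two, hg, hh])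
  simp only [aeval_originAdd_X E (fun i => chartPoint E ((![g, h] : Fin 2 → _) i)),
    Matrix.cons_val] at this
  exact this

/-- At the generic pair of points the slope in the addition law is the divided difference `m`. The
law is then a unit times the negative `(t₃, B, s₃)` of the third intersection point. This lies on
the curve and reduces to the origin, so it is a unit times the point with parameter `-t₃ / B`. -/
lemma originAdd_chartPoint_X : ∃ u : MvPowerSeries (Fin 2) K, IsUnit u ∧
    MvPowerSeries.constantCoeff (formalGroupLaw E) = 0 ∧
    originAdd E (chartPoint E (MvPowerSeries.X 0)) (chartPoint E (MvPowerSeries.X 1)) =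
      u • chartPoint E (formalGroupLaw E) := by
  set t₁ : MvPowerSeries (Fin 2) K := MvPowerSeries.X 0 with ht₁
  set t₂ : MvPowerSeries (Fin 2) K := MvPowerSeries.X 1 with ht₂
  have h₁ : MvPowerSeries.constantCoeff t₁ = 0 := by simp [ht₁]
  have h₂ : MvPowerSeries.constantCoeff t₂ = 0 := by simp [ht₂]
  set s₁ := PowerSeries.subst t₁ (sSeries E) with hs₁
  set s₂ := PowerSeries.subst t₂ (sSeries E) with hs₂
  have hc₁ : MvPowerSeries.constantCoeff s₁ = 0 := constantCoeff_subst_sSeries E h₁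
  have hc₂ : MvPowerSeries.constantCoeff s₂ = 0 := constantCoeff_subst_sSeries E h₂
  set W := E.map (algebraMap K (MvPowerSeries (Fin 2) K)) with hW
  set m := dividedDifference (sSeries E) with hm
  set b := s₁ - m * t₁ with hb
  set A : MvPowerSeries (Fin 2) K := 1 + MvPowerSeries.C E.a₂ * m + MvPowerSeries.C E.a₄ * m ^ 2
    + MvPowerSeries.C E.a₆ * m ^ 3 with hA
  set t₃ : MvPowerSeries (Fin 2) K := -t₁ - t₂ - (MvPowerSeries.C E.a₁ * m
    + MvPowerSeries.C E.a₂ * b + MvPowerSeries.C E.a₃ * m ^ 2 + 2 * MvPowerSeries.C E.a₄ * m * b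
    + 3 * MvPowerSeries.C E.a₆ * m ^ 2 * b) * A⁻¹ with ht₃
  set s₃ := m * t₃ + b with hs₃
  set B : MvPowerSeries (Fin 2) K := 1 - MvPowerSeries.C E.a₁ * t₃ - MvPowerSeries.C E.a₃ * s₃
    with hB
  have hF : formalGroupLaw E = -t₃ * B⁻¹ := rfl
  have hmc : MvPowerSeries.constantCoeff m = 0 := by
    rw [← MvPowerSeries.coeff_zero_eq_constantCoeff_apply]
    exact coeff_one_sSeries E
  have hbc : MvPowerSeries.constantCoeff b = 0 := by simp [hb, hc₁, hmc]
  have hAc : MvPowerSeries.constantCoeff A = 1 := by simp [hA, hmc]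
  have htc : MvPowerSeries.constantCoeff t₃ = 0 := by simp [ht₃, h₁, h₂, hmc, hbc]
  have hsc : MvPowerSeries.constantCoeff s₃ = 0 := by simp [hs₃, hmc, hbc]
  have hBc : MvPowerSeries.constantCoeff B = 1 := by simp [hB, htc, hsc]
  have hBB : B * B⁻¹ = 1 := MvPowerSeries.mul_inv_cancel _ (by simp [hBc])
  have he₁ := chartPoint_equation E (PowerSeries.HasSubst.of_constantCoeff_zero h₁)
  have he₂ := chartPoint_equation E (PowerSeries.HasSubst.of_constantCoeff_zero h₂)
  set D := chartDen W ![t₁, -1, s₁] ![t₂, -1, s₂] with hD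
  have hDc : MvPowerSeries.constantCoeff D = 1 := by
    simp [hD, chartDen, h₂, hc₁, hc₂]
  -- Both sides agree after multiplication by `t₁ - t₂`, which is not a zero divisor.
  have hslope : D * m = chartNum W ![t₁, -1, s₁] ![t₂, -1, s₂] := by
    have ht : t₁ - t₂ ≠ 0 := by
      rw [ht₁, ht₂, sub_ne_zero]
      intro h
      have := congrArg (MvPowerSeries.coeff (Finsupp.single 0 1)) h
      simp [MvPowerSeries.coeff_X, Finsupp.single_left_inj] at this
    refine mul_right_cancel₀ ht ?_
    rw [chartNum_mul W he₁ he₂, mul_assoc, dividedDifference_mul]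
  have hlaw := originLaw_chart W hslope hb hA (MvPowerSeries.mul_inv_cancel A (by simp [hAc])) ht₃
    hs₃
  set c := (A * D ^ 4) ^ 2 with hc
  have hcu : IsUnit c := by
    rw [MvPowerSeries.isUnit_iff_constantCoeff]
    simp [hc, hAc, hDc]
  have hE := originAdd_chartPoint_equation E h₁ h₂
  have hlaw' : originAdd E (chartPoint E t₁) (chartPoint E t₂) = c • ![t₃, B, s₃] := hlaw
  rw [hlaw', WeierstrassCurve.Projective.equation_smul _ hcu] at hE
  have hv := eq_smul_chartPoint E (g := formalGroupLaw E) hE (by simpa using htc) (by simp [hBc])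
    (by simpa using hsc) (by
      rw [hF]
      simp only [Matrix.cons_val]
      linear_combination -t₃ * hBB)
  refine ⟨c * -B, hcu.mul (IsUnit.neg ?_), by simp [hF, htc], ?_⟩
  · rw [MvPowerSeries.isUnit_iff_constantCoeff]
    simp [hBc]
  · rw [hlaw', hv, smul_smul]
    simp

lemma constantCoeff_formalGroupLaw : MvPowerSeries.constantCoeff (formalGroupLaw E) = 0 := by
  obtain ⟨u, -, h, -⟩ := originAdd_chartPoint_X E
  exact h

lemma constantCoeff_subst_formalGroupLaw {g h : MvPowerSeries σ K}
    (hg : MvPowerSeries.constantCoeff g = 0) (hh : MvPowerSeries.constantCoeff h = 0) :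
    MvPowerSeries.constantCoeff (MvPowerSeries.subst ![g, h] (formalGroupLaw E)) = 0 :=
  MvPowerSeries.constantCoeff_subst_eq_zero (hasSubst_pair hg hh)
    (by simp [Fin.forall_fin_two, hg, hh]) (constantCoeff_formalGroupLaw E)

/-- The addition law near the origin is given by the formal group law. -/
theorem originAdd_chartPoint {g h : MvPowerSeries σ K}
    (hg : MvPowerSeries.constantCoeff g = 0) (hh : MvPowerSeries.constantCoeff h = 0) :
    ∃ u : MvPowerSeries σ K, IsUnit u ∧ originAdd E (chartPoint E g) (chartPoint E h) =
      u • chartPoint E (MvPowerSeries.subst ![g, h] (formalGroupLaw E)) := by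
  obtain ⟨u, hu, hF, h0⟩ := originAdd_chartPoint_X E
  have ha := hasSubst_pair hg hh
  refine ⟨_, hu.map (MvPowerSeries.substAlgHom ha), funext fun i => ?_⟩
  have h1 := congrArg (MvPowerSeries.substAlgHom ha) (congrFun h0 i)
  have hX : ∀ i : Fin 2, PowerSeries.HasSubst (MvPowerSeries.X i : MvPowerSeries (Fin 2) K) :=
    fun i => PowerSeries.HasSubst.X i
  rw [map_originAdd, Pi.smul_apply, smul_eq_mul, map_mul, subst_chartPoint E ha
    (PowerSeries.HasSubst.of_constantCoeff_zero hF)] at h1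
  simp only [subst_chartPoint E ha (hX _), MvPowerSeries.subst_X ha, Matrix.cons_val] at h1
  exact h1

end FormalGroupLaw

/-! ### The axioms of a formal group law, inherited from the curve. -/

section FormalGroup

variable {σ : Type} {K : Type u} [Field K] (E : WeierstrassCurve K)

/-- Proportionality of triples becomes equality of parameters, since the middle coordinate is
normalized to `-1`. -/
lemma eq_of_cross_smul {v w : Fin 3 → MvPowerSeries σ K} {a b g h : MvPowerSeries σ K}
    (ha : IsUnit a) (hb : IsUnit b) (hv : v = a • chartPoint E g) (hw : w = b • chartPoint E h)
    (hc : ∀ i j, v i * w j = v j * w i) : g = h := by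
  refine chartPoint_injective E fun i j => (ha.mul hb).mul_left_cancel ?_
  have := hc i j
  rw [hv, hw] at this
  simp only [Pi.smul_apply, smul_eq_mul] at this
  linear_combination this

lemma chartPoint_zero : chartPoint E (0 : MvPowerSeries σ K) = (-1 : MvPowerSeries σ K) • ![0, 1, 0] := by
  ext i : 1
  fin_cases i <;>
    simp [chartPoint, PowerSeries.subst_zero_of_constantCoeff_zero (constantCoeff_sSeries E)]

lemma coords_origin {k : Type u} [Field k] {W : WeierstrassCurve k} :
    Coords (0 : W.toProjective.Point) ![0, 1, 0] :=
  fun _ => WeierstrassCurve.Projective.Point.zero_point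

/-- The negative of a triple of coordinates. -/
def negTriple {R : Type u} [CommRing R] [Algebra K R] (p : Fin 3 → R) : Fin 3 → R :=
  (E.map (algebraMap K R)).toProjective.neg p

lemma map_negTriple {R S : Type u} [CommRing R] [CommRing S] [Algebra K R] [Algebra K S]
    (φ : R →ₐ[K] S) (p : Fin 3 → R) (i : Fin 3) :
    φ (negTriple E p i) = negTriple E (fun i => φ (p i)) i := by
  fin_cases i <;> simp [negTriple, WeierstrassCurve.Projective.neg, WeierstrassCurve.Projective.negY]

variable [E.IsElliptic]

/-- Both iterated laws are unit multiples of chart points, and they are proportional because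
addition of geometric points is associative. -/
lemma formalGroupLaw_assoc {f g h : MvPowerSeries σ K} (hf : MvPowerSeries.constantCoeff f = 0)
    (hg : MvPowerSeries.constantCoeff g = 0) (hh : MvPowerSeries.constantCoeff h = 0) :
    MvPowerSeries.subst ![MvPowerSeries.subst ![f, g] (formalGroupLaw E), h] (formalGroupLaw E) =
      MvPowerSeries.subst ![f, MvPowerSeries.subst ![g, h] (formalGroupLaw E)]
        (formalGroupLaw E) := by
  obtain ⟨u, hu, hu'⟩ := originAdd_chartPoint E hf hg
  obtain ⟨v, hv, hv'⟩ := originAdd_chartPoint E (constantCoeff_subst_formalGroupLaw E hf hg) hh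
  obtain ⟨w, hw, hw'⟩ := originAdd_chartPoint E hg hh
  obtain ⟨x, hx, hx'⟩ := originAdd_chartPoint E hf (constantCoeff_subst_formalGroupLaw E hg hh)
  have h1 := originAdd_smul E u 1 (chartPoint E (MvPowerSeries.subst ![f, g] (formalGroupLaw E)))
    (chartPoint E h)
  rw [one_smul, mul_one, ← hu', hv', smul_smul] at h1
  have h2 := originAdd_smul E 1 w (chartPoint E f)
    (chartPoint E (MvPowerSeries.subst ![g, h] (formalGroupLaw E)))
  rw [one_smul, one_mul, ← hw', hx', smul_smul] at h2
  refine eq_of_cross_smul E ((hu.pow 18).mul hv) ((hw.pow 18).mul hx) h1 h2 ?_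
  have := cross_chartPoints (AlgebraicClosure K) (E := E) (ι := Fin 3)
    (v := originAdd E (originAdd E (fun j => MvPolynomial.X (0, j)) fun j => MvPolynomial.X (1, j))
      fun j => MvPolynomial.X (2, j))
    (w := originAdd E (fun j => MvPolynomial.X (0, j))
      (originAdd E (fun j => MvPolynomial.X (1, j)) fun j => MvPolynomial.X (2, j)))
    (fun P q hq => by
      simp only [map_originAdd, MvPolynomial.aeval_X]
      exact (((hq 0).add (hq 1)).add (hq 2)).cross ((hq 0).add ((hq 1).add (hq 2)))
        (add_assoc _ _ _)) (g := ![f, g, h]) (by simp [Fin.forall_fin_succ, hf, hg, hh])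
  simpa only [map_originAdd, MvPolynomial.aeval_X, Matrix.cons_val] using this

lemma formalGroupLaw_comm {f g : MvPowerSeries σ K} (hf : MvPowerSeries.constantCoeff f = 0)
    (hg : MvPowerSeries.constantCoeff g = 0) :
    MvPowerSeries.subst ![f, g] (formalGroupLaw E) =
      MvPowerSeries.subst ![g, f] (formalGroupLaw E) := by
  obtain ⟨u, hu, hu'⟩ := originAdd_chartPoint E hf hg
  obtain ⟨v, hv, hv'⟩ := originAdd_chartPoint E hg hf
  refine eq_of_cross_smul E hu hv hu' hv' ?_
  have := cross_chartPoints (AlgebraicClosure K) (E := E) (ι := Fin 2)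
    (v := originAdd E (fun j => MvPolynomial.X (0, j)) fun j => MvPolynomial.X (1, j))
    (w := originAdd E (fun j => MvPolynomial.X (1, j)) fun j => MvPolynomial.X (0, j))
    (fun P q hq => by
      simp only [map_originAdd, MvPolynomial.aeval_X]
      exact ((hq 0).add (hq 1)).cross ((hq 1).add (hq 0)) (add_comm _ _))
    (g := ![f, g]) (by simp [Fin.forall_fin_succ, hf, hg])
  simpa only [map_originAdd, MvPolynomial.aeval_X, Matrix.cons_val] using this

lemma map_origin {R S : Type u} [CommRing R] [CommRing S] [Algebra K R] [Algebra K S]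
    (φ : R →ₐ[K] S) (i : Fin 3) : φ ((![0, 1, 0] : Fin 3 → R) i) = (![0, 1, 0] : Fin 3 → S) i := by
  fin_cases i <;> simp

lemma formalGroupLaw_add_zero {f : MvPowerSeries σ K} (hf : MvPowerSeries.constantCoeff f = 0) :
    MvPowerSeries.subst ![f, 0] (formalGroupLaw E) = f := by
  obtain ⟨u, hu, hu'⟩ := originAdd_chartPoint E hf (map_zero _)
  -- The chart point with parameter zero is `-(0, 1, 0)`; the sign disappears because the bidegree
  -- of the law, `18`, is even.
  have h1 := originAdd_smul E 1 (-1) (chartPoint E f) ![0, 1, 0]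
  rw [one_smul, ← chartPoint_zero E, hu', one_mul, Even.neg_one_pow (by decide), one_smul] at h1
  refine eq_of_cross_smul E hu isUnit_one h1.symm (one_smul _ _).symm ?_
  have := cross_chartPoints (AlgebraicClosure K) (E := E) (ι := Fin 1)
    (v := originAdd E (fun j => MvPolynomial.X (0, j)) ![0, 1, 0])
    (w := fun j => MvPolynomial.X (0, j))
    (fun P q hq => by
      simp only [map_originAdd, MvPolynomial.aeval_X, map_origin]
      exact ((hq 0).add coords_origin).cross (hq 0) (add_zero _))
    (g := ![f]) (by simp [hf])
  simpa only [map_originAdd, MvPolynomial.aeval_X, map_origin, Matrix.cons_val] using this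

/-- The negative of `(f, -1, s)` is `(f, B, s)` with `B = 1 - a₁ f - a₃ s`, so the inverse is its
parameter `-f / B`. -/
lemma exists_formalGroupLaw_eq_zero {f : MvPowerSeries σ K}
    (hf : MvPowerSeries.constantCoeff f = 0) : ∃ g : MvPowerSeries σ K,
      MvPowerSeries.constantCoeff g = 0 ∧
        MvPowerSeries.subst ![f, g] (formalGroupLaw E) = 0 := by
  set s := PowerSeries.subst f (sSeries E) with hs
  have hsc : MvPowerSeries.constantCoeff s = 0 := constantCoeff_subst_sSeries E hf
  set B : MvPowerSeries σ K := 1 - MvPowerSeries.C E.a₁ * f - MvPowerSeries.C E.a₃ * s with hB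
  have hBc : MvPowerSeries.constantCoeff B = 1 := by simp [hB, hf, hsc]
  have hBB : B * B⁻¹ = 1 := MvPowerSeries.mul_inv_cancel _ (by simp [hBc])
  have hn : negTriple E (chartPoint E f) = ![f, B, s] := by
    ext i : 1
    fin_cases i
    · rfl
    · simp [negTriple, WeierstrassCurve.Projective.neg, WeierstrassCurve.Projective.negY, chartPoint,
        hB, ← hs, MvPowerSeries.algebraMap_apply]
    · rfl
  have hE := equation_chartPoints (AlgebraicClosure K) (E := E) (E' := E) (ι := Fin 1)
    (v := negTriple E fun j => MvPolynomial.X (0, j)) (fun P q hq => by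
      simp only [map_negTriple, MvPolynomial.aeval_X]
      exact (hq 0).neg.equation) (g := ![f]) (by simp [hf])
  simp only [map_negTriple, MvPolynomial.aeval_X, Matrix.cons_val] at hE
  have hg : MvPowerSeries.constantCoeff (-f * B⁻¹) = 0 := by simp [hf]
  have h1 := eq_smul_chartPoint E (g := -f * B⁻¹) hE (by simp [hn, hf]) (by simp [hn, hBc])
    (by simp [hn, hsc]) (by
      simp only [hn, Matrix.cons_val]
      linear_combination -f * hBB)
  refine ⟨-f * B⁻¹, hg, ?_⟩
  obtain ⟨u, hu, hu'⟩ := originAdd_chartPoint E hf hg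
  set c := -negTriple E (chartPoint E f) 1 with hc
  have hcu : IsUnit c := by
    rw [MvPowerSeries.isUnit_iff_constantCoeff]
    simp [hc, hn, hBc]
  have h2 := originAdd_smul E 1 c (chartPoint E f) (chartPoint E (-f * B⁻¹))
  change negTriple E (chartPoint E f) = _ at h1
  rw [one_smul, one_mul, ← h1, hu', smul_smul] at h2
  have h3 : (![0, 1, 0] : Fin 3 → MvPowerSeries σ K) = (-1 : MvPowerSeries σ K) • chartPoint E 0 := by
    rw [chartPoint_zero, smul_smul, neg_one_mul, neg_neg, one_smul]
  refine eq_of_cross_smul E ((hcu.pow 18).mul hu) isUnit_one.neg h2 h3 ?_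
  have := cross_chartPoints (AlgebraicClosure K) (E := E) (ι := Fin 1)
    (v := originAdd E (fun j => MvPolynomial.X (0, j)) (negTriple E fun j => MvPolynomial.X (0, j)))
    (w := ![0, 1, 0])
    (fun P q hq => by
      simp only [map_originAdd, map_negTriple, MvPolynomial.aeval_X, map_origin]
      exact ((hq 0).add (hq 0).neg).cross coords_origin (add_neg_cancel _))
    (g := ![f]) (by simp [hf])
  simpa only [map_originAdd, map_negTriple, MvPolynomial.aeval_X, map_origin, Matrix.cons_val]
    using this

/-- In `F(X, 0) = X` only the monomial `X₀` contributes to degree one. -/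
lemma coeff_single_zero_formalGroupLaw :
    MvPowerSeries.coeff (Finsupp.single 0 1) (formalGroupLaw E) = 1 := by
  have h := formalGroupLaw_add_zero E (f := (PowerSeries.X : PowerSeries K))
    (PowerSeries.constantCoeff_X)
  have h1 := congrArg (PowerSeries.coeff 1) h
  rw [PowerSeries.coeff_one_X] at h1
  rw [← h1, PowerSeries.coeff, MvPowerSeries.coeff_subst, finsum_eq_single _ (Finsupp.single 0 1)]
  · simp
  · intro d hd
    by_cases hd₁ : d 1 = 0
    · by_cases hd₀ : d 0 = 0
      · simp [hd₀, hd₁]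
      simp [hd₁, PowerSeries.coeff_X_pow]
      grind
    simp [hd₁]
  · exact MvPowerSeries.HasSubst.X_zero

lemma coeff_single_one_formalGroupLaw :
    MvPowerSeries.coeff (Finsupp.single 1 1) (formalGroupLaw E) = 1 := by
  have h := formalGroupLaw_comm E (f := (PowerSeries.X : PowerSeries K))
    (PowerSeries.constantCoeff_X) (map_zero _)
  rw [formalGroupLaw_add_zero E PowerSeries.constantCoeff_X] at h
  have h1 := congrArg (PowerSeries.coeff 1) h.symm
  rw [PowerSeries.coeff_one_X] at h1
  rw [← h1, PowerSeries.coeff, MvPowerSeries.coeff_subst, finsum_eq_single _ (Finsupp.single 1 1)]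
  · simp
  · intro d hd
    by_cases hd₁ : d 0 = 0
    · by_cases hd₀ : d 1 = 0
      · simp [hd₀, hd₁]
      simp [hd₁, PowerSeries.coeff_X_pow]
      grind
    simp [hd₁]
  · exact MvPowerSeries.HasSubst.zero_X

/-- The formal group law of an elliptic curve. -/
def formalGroup : FormalGroup K where
  toPowerSeries := formalGroupLaw E
  zero_constantCoeff := constantCoeff_formalGroupLaw E
  lin_coeff_X := coeff_single_zero_formalGroupLaw E
  lin_coeff_Y := coeff_single_one_formalGroupLaw E
  assoc := formalGroupLaw_assoc E (by simp) (by simp) (by simp)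

instance isComm_formalGroup : (formalGroup E).IsComm where
  comm := by
    have h := formalGroupLaw_comm E (MvPowerSeries.constantCoeff_X (R := K) (0 : Fin 2))
      (MvPowerSeries.constantCoeff_X (1 : Fin 2))
    refine Eq.trans ?_ h
    have hX : (![MvPowerSeries.X 0, MvPowerSeries.X 1] : Fin 2 → MvPowerSeries (Fin 2) K) =
        MvPowerSeries.X := by
      ext i : 1
      fin_cases i <;> rfl
    rw [hX, MvPowerSeries.subst_self]
    rfl

lemma isCommFormalGroupLaw_formalGroupLaw : IsCommFormalGroupLaw (formalGroupLaw E) :=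
  ⟨formalGroup E, rfl, inferInstance⟩

end FormalGroup

/-! ### The group of homomorphisms of formal group laws -/

section FormalHom

variable {σ τ : Type} {K : Type u} [Field K]

lemma subst_subst_pair {a : σ → MvPowerSeries τ K} (ha : MvPowerSeries.HasSubst a)
    {g h : MvPowerSeries σ K} (hg : MvPowerSeries.constantCoeff g = 0)
    (hh : MvPowerSeries.constantCoeff h = 0) (F : MvPowerSeries (Fin 2) K) :
    MvPowerSeries.subst a (MvPowerSeries.subst ![g, h] F) =
      MvPowerSeries.subst ![MvPowerSeries.subst a g, MvPowerSeries.subst a h] F := by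
  rw [MvPowerSeries.subst_comp_subst_apply (hasSubst_pair hg hh) ha]
  congr 1
  ext i : 1
  fin_cases i <;> rfl

lemma subst_subst_powerSeries {a : σ → MvPowerSeries τ K} (ha : MvPowerSeries.HasSubst a)
    {g : MvPowerSeries σ K} (hg : MvPowerSeries.constantCoeff g = 0) (U : K⟦X⟧) :
    MvPowerSeries.subst a (PowerSeries.subst g U) =
      PowerSeries.subst (MvPowerSeries.subst a g) U :=
  MvPowerSeries.subst_comp_subst_apply (PowerSeries.HasSubst.of_constantCoeff_zero hg).const ha U

lemma subst_formalAdd {g : MvPowerSeries σ K} (hg : MvPowerSeries.constantCoeff g = 0) {U V : K⟦X⟧}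
    (hU : PowerSeries.constantCoeff U = 0) (hV : PowerSeries.constantCoeff V = 0)
    (F : MvPowerSeries (Fin 2) K) :
    PowerSeries.subst g (formalAdd F U V) =
      MvPowerSeries.subst ![PowerSeries.subst g U, PowerSeries.subst g V] F :=
  subst_subst_pair (PowerSeries.HasSubst.of_constantCoeff_zero hg).const hU hV F

lemma subst_zero' {g : MvPowerSeries σ K} (hg : MvPowerSeries.constantCoeff g = 0) :
    PowerSeries.subst g (0 : K⟦X⟧) = 0 := by
  rw [← PowerSeries.coe_substAlgHom (PowerSeries.HasSubst.of_constantCoeff_zero hg), map_zero]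

variable {F F' F'' : MvPowerSeries (Fin 2) K}

/-- The identity in the two variables specializes to any pair of series without constant term. -/
lemma FormalHom.subst_pair {U : K⟦X⟧} (hU : U ∈ FormalHom F F')
    (hF : MvPowerSeries.constantCoeff F = 0) {g h : MvPowerSeries σ K}
    (hg : MvPowerSeries.constantCoeff g = 0) (hh : MvPowerSeries.constantCoeff h = 0) :
    PowerSeries.subst (MvPowerSeries.subst ![g, h] F) U =
      MvPowerSeries.subst ![PowerSeries.subst g U, PowerSeries.subst h U] F' := by
  have ha := hasSubst_pair hg hh
  have hX : ∀ i : Fin 2, MvPowerSeries.constantCoeff (MvPowerSeries.X i : MvPowerSeries (Fin 2) K) =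
      0 := fun i => MvPowerSeries.constantCoeff_X i
  have := congrArg (MvPowerSeries.subst ![g, h]) hU.2
  rw [subst_subst_powerSeries ha hF, subst_subst_pair ha
    (PowerSeries.constantCoeff_subst_eq_zero (hX 0) _ hU.1)
    (PowerSeries.constantCoeff_subst_eq_zero (hX 1) _ hU.1), subst_subst_powerSeries ha (hX 0),
    subst_subst_powerSeries ha (hX 1), MvPowerSeries.subst_X ha, MvPowerSeries.subst_X ha] at this
  exact this

/-- The composite of homomorphisms of formal group laws. -/
lemma FormalHom.comp {U U' : K⟦X⟧} (hU : U ∈ FormalHom F F') (hU' : U' ∈ FormalHom F' F'')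
    (hF : MvPowerSeries.constantCoeff F = 0) (hF' : MvPowerSeries.constantCoeff F' = 0) :
    PowerSeries.subst U U' ∈ FormalHom F F'' := by
  have hUs := PowerSeries.HasSubst.of_constantCoeff_zero' hU.1
  have hX : ∀ i : Fin 2, MvPowerSeries.constantCoeff (MvPowerSeries.X i : MvPowerSeries (Fin 2) K) =
      0 := fun i => MvPowerSeries.constantCoeff_X i
  refine ⟨PowerSeries.constantCoeff_subst_eq_zero hU.1 _ hU'.1, ?_⟩
  rw [PowerSeries.subst_comp_subst_apply hUs (PowerSeries.HasSubst.of_constantCoeff_zero hF),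
    PowerSeries.subst_comp_subst_apply hUs (PowerSeries.HasSubst.of_constantCoeff_zero (hX 0)),
    PowerSeries.subst_comp_subst_apply hUs (PowerSeries.HasSubst.of_constantCoeff_zero (hX 1)),
    hU.2, FormalHom.subst_pair hU' hF']
  · exact PowerSeries.constantCoeff_subst_eq_zero (hX 0) _ hU.1
  · exact PowerSeries.constantCoeff_subst_eq_zero (hX 1) _ hU.1

variable (G : FormalGroup K)

lemma constantCoeff_formalAdd {U V : K⟦X⟧} (hU : PowerSeries.constantCoeff U = 0)
    (hV : PowerSeries.constantCoeff V = 0) :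
    PowerSeries.constantCoeff (formalAdd G.toPowerSeries U V) = 0 :=
  MvPowerSeries.constantCoeff_subst_eq_zero (hasSubst_pair hU hV)
    (by simp only [Fin.forall_fin_two]; exact ⟨hU, hV⟩) G.zero_constantCoeff

/-- A power series without constant term as a point of a formal group. -/
def toPoint {f : MvPowerSeries σ K} (hf : MvPowerSeries.constantCoeff f = 0) : G.Point σ :=
  ⟨f, PowerSeries.HasSubst.of_constantCoeff_zero hf⟩

variable {G}

lemma FormalHom.zero_mem (hF : MvPowerSeries.constantCoeff F = 0) :
    (0 : K⟦X⟧) ∈ FormalHom F G.toPowerSeries := by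
  refine ⟨map_zero _, ?_⟩
  rw [subst_zero' hF, subst_zero' (MvPowerSeries.constantCoeff_X 0),
    subst_zero' (MvPowerSeries.constantCoeff_X 1)]
  exact (congrArg Subtype.val (add_zero (0 : G.Point (Fin 2)))).symm

variable [G.IsComm]

/-- The interchange law `(a + b) + (c + d) = (a + c) + (b + d)` in the group of points of `G`;
commutativity is essential. -/
lemma FormalHom.add_mem (hF : MvPowerSeries.constantCoeff F = 0) {U V : K⟦X⟧}
    (hU : U ∈ FormalHom F G.toPowerSeries) (hV : V ∈ FormalHom F G.toPowerSeries) :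
    formalAdd G.toPowerSeries U V ∈ FormalHom F G.toPowerSeries := by
  have hX : ∀ i : Fin 2, MvPowerSeries.constantCoeff (MvPowerSeries.X i : MvPowerSeries (Fin 2) K) =
      0 := fun i => MvPowerSeries.constantCoeff_X i
  refine ⟨constantCoeff_formalAdd G hU.1 hV.1, ?_⟩
  rw [subst_formalAdd hF hU.1 hV.1, subst_formalAdd (hX 0) hU.1 hV.1,
    subst_formalAdd (hX 1) hU.1 hV.1, hU.2, hV.2]
  exact congrArg Subtype.val (add_add_add_comm
    (toPoint G (PowerSeries.constantCoeff_subst_eq_zero (hX 0) _ hU.1))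
    (toPoint G (PowerSeries.constantCoeff_subst_eq_zero (hX 1) _ hU.1))
    (toPoint G (PowerSeries.constantCoeff_subst_eq_zero (hX 0) _ hV.1))
    (toPoint G (PowerSeries.constantCoeff_subst_eq_zero (hX 1) _ hV.1)))

/-- Both `V(F(X, Y))` and the formal sum of `V(X)` and `V(Y)` are inverses of `U(F(X, Y))`, so they
agree. -/
lemma FormalHom.neg_mem (hF : MvPowerSeries.constantCoeff F = 0) {U V : K⟦X⟧}
    (hU : U ∈ FormalHom F G.toPowerSeries) (hV : PowerSeries.constantCoeff V = 0)
    (hUV : formalAdd G.toPowerSeries U V = 0) : V ∈ FormalHom F G.toPowerSeries := by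
  have hX : ∀ i : Fin 2, MvPowerSeries.constantCoeff (MvPowerSeries.X i : MvPowerSeries (Fin 2) K) =
      0 := fun i => MvPowerSeries.constantCoeff_X i
  let pt : ∀ (g : MvPowerSeries (Fin 2) K), MvPowerSeries.constantCoeff g = 0 →
      ∀ W : K⟦X⟧, PowerSeries.constantCoeff W = 0 → G.Point (Fin 2) := fun g hg W hW =>
    toPoint G (PowerSeries.constantCoeff_subst_eq_zero hg W hW)
  have hzero : ∀ g hg, pt g hg U hU.1 + pt g hg V hV = 0 := by
    intro g hg
    refine Subtype.ext ?_
    have := subst_formalAdd hg hU.1 hV G.toPowerSeries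
    rw [hUV, subst_zero' hg] at this
    exact this.symm
  have h1 : pt F hF U hU.1 = pt _ (hX 0) U hU.1 + pt _ (hX 1) U hU.1 := Subtype.ext hU.2
  have h2 : (pt _ (hX 0) V hV + pt _ (hX 1) V hV) + pt F hF U hU.1 = 0 := by
    rw [h1, add_comm, add_add_add_comm, hzero _ (hX 0), hzero _ (hX 1), add_zero]
  have h3 := left_neg_eq_right_neg h2 (hzero F hF)
  exact ⟨hV, (congrArg Subtype.val h3).symm⟩

/-- The homomorphisms to a commutative formal group law with inverses are an abelian group. -/
abbrev formalHomAddCommGroup (hF : MvPowerSeries.constantCoeff F = 0)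
    (hinv : ∀ U : K⟦X⟧, PowerSeries.constantCoeff U = 0 →
      ∃ V : K⟦X⟧, PowerSeries.constantCoeff V = 0 ∧ formalAdd G.toPowerSeries U V = 0) :
    AddCommGroup (FormalHom F G.toPowerSeries) :=
  let _ : Add (FormalHom F G.toPowerSeries) := ⟨fun U V => ⟨_, FormalHom.add_mem hF U.2 V.2⟩⟩
  let _ : Zero (FormalHom F G.toPowerSeries) := ⟨⟨0, FormalHom.zero_mem hF⟩⟩
  let _ : Neg (FormalHom F G.toPowerSeries) := ⟨fun U => ⟨(hinv U.1 U.2.1).choose,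
    FormalHom.neg_mem hF U.2 (hinv U.1 U.2.1).choose_spec.1 (hinv U.1 U.2.1).choose_spec.2⟩⟩
  have hsub : ∀ U : FormalHom F G.toPowerSeries, PowerSeries.HasSubst U.1 := fun U =>
    PowerSeries.HasSubst.of_constantCoeff_zero' U.2.1
  have hcomm : ∀ U V : FormalHom F G.toPowerSeries, U + V = V + U := fun U V =>
    Subtype.ext (G.comm' (hsub U) (hsub V))
  { AddGroup.ofLeftAxioms (fun U V W => Subtype.ext (G.assoc' (hsub U) (hsub V) (hsub W)))
      (fun U => Subtype.ext (G.zero_add (hsub U)))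
      (fun U => (hcomm _ _).trans (Subtype.ext (hinv U.1 U.2.1).choose_spec.2)) with
    add_comm := hcomm }

end FormalHom

/-! ### Isogenies and their expansions -/

section Isogeny

variable {K : Type u} [Field K] {E E' E'' : WeierstrassCurve K}

lemma represents_iff {α : GeomPoint E → GeomPoint E'} {d : ℕ}
    {f : Fin 3 → MvPolynomial (Fin 3) K} : Represents E E' α d f ↔ Rep K α d f :=
  ⟨fun h => ⟨h.1, h.2⟩, fun h => ⟨h.1, h.2⟩⟩

lemma isAlgebraicMap_iff {α : GeomPoint E → GeomPoint E'} : IsAlgebraicMap E E' α ↔ IsAlg K α := by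
  simp only [IsAlgebraicMap, IsAlg, represents_iff]
  rfl

/-- A constant map that preserves the origin is zero, so the two cases of the definition merge into
one closed condition. -/
lemma mem_isog_iff {α : GeomPoint E → GeomPoint E'} :
    α ∈ Isog E E' ↔ IsAlg K α ∧ α 0 = 0 := by
  constructor
  · rintro (h | rfl)
    · exact ⟨isAlgebraicMap_iff.mp h.algebraic, h.map_origin⟩
    · exact ⟨isAlg_zero, rfl⟩
  · rintro ⟨h, h0⟩
    by_cases hc : ∃ P Q, α P ≠ α Q
    · exact Or.inl ⟨isAlgebraicMap_iff.mpr h, h0, hc⟩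
    · push Not at hc
      exact Or.inr (funext fun P => (hc P 0).trans h0)

lemma exists_representsAtOrigin {α : GeomPoint E → GeomPoint E'} (hα : α ∈ Isog E E') :
    ∃ d f, RepresentsAtOrigin E E' α d f := by
  obtain ⟨d, f, hf, h0⟩ := (mem_isog_iff.mp hα).1 0 ![0, 1, 0]
    WeierstrassCurve.Projective.Point.zero_point
  exact ⟨d, f, represents_iff.mpr hf, h0⟩

lemma isog_add [E.IsElliptic] [E'.IsElliptic] {α : GeomPoint E → GeomPoint E'} (hα : α ∈ Isog E E')
    (P Q : GeomPoint E) : α (P + Q) = α P + α Q :=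
  map_add_of_map_zero (mem_isog_iff.mp hα).1.extend (mem_isog_iff.mp hα).2 P Q

/-- The isogenies together with the zero map as a subgroup. -/
def isogSubgroup (E E' : WeierstrassCurve K) [E'.IsElliptic] :
    AddSubgroup (GeomPoint E → GeomPoint E') where
  carrier := Isog E E'
  zero_mem' := Or.inr rfl
  add_mem' {α β} hα hβ := by
    rw [mem_isog_iff] at hα hβ ⊢
    refine ⟨hα.1.add rfl hβ.1, ?_⟩
    rw [Pi.add_apply, hα.2, hβ.2, add_zero]
  neg_mem' {α} hα := by
    change -α ∈ Isog E E'
    rw [mem_isog_iff] at hα ⊢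
    refine ⟨hα.1.neg rfl, ?_⟩
    rw [Pi.neg_apply, hα.2, neg_zero]

lemma isog_comp {α : GeomPoint E → GeomPoint E'} {β : GeomPoint E' → GeomPoint E''}
    (hα : α ∈ Isog E E') (hβ : β ∈ Isog E' E'') : β ∘ α ∈ Isog E E'' := by
  rw [mem_isog_iff] at hα hβ ⊢
  refine ⟨hα.1.comp hβ.1, ?_⟩
  rw [Function.comp_apply, hα.2, hβ.2]

/-! #### The expansion at the origin -/

variable {α : GeomPoint E → GeomPoint E'} {d : ℕ} {f : Fin 3 → MvPolynomial (Fin 3) K}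

/-- At `τ = 0` the chart point is `(0, -1, 0)`; passing to `(0, 1, 0)` costs the sign. -/
lemma constantCoeff_expand {g : MvPolynomial (Fin 3) K} (hg : g.IsHomogeneous d) :
    algebraMap K (AlgebraicClosure K) (PowerSeries.constantCoeff (expand E g)) =
      (-1) ^ d * MvPolynomial.aeval ![0, 1, 0] g := by
  rw [← aeval_smul_of_isHomogeneous hg]
  have h : PowerSeries.constantCoeff (expand E g) = MvPolynomial.aeval (![0, -1, 0] : Fin 3 → K) g := by
    have h1 := MvPolynomial.map_aeval (![PowerSeries.X, -1, sSeries E] : Fin 3 → K⟦X⟧)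
      (PowerSeries.constantCoeff (R := K)) g
    rw [expand, h1, MvPolynomial.aeval_def]
    have h2 : (PowerSeries.constantCoeff (R := K)).comp (algebraMap K K⟦X⟧) = algebraMap K K := by
      ext a
      simp
    rw [h2, MvPolynomial.coe_eval₂Hom]
    congr 1
    ext i
    fin_cases i <;> simp [constantCoeff_sSeries]
  rw [h, ← MvPolynomial.aeval_algebraMap_apply]
  congr 2
  ext i
  fin_cases i <;> simp

lemma RepresentsAtOrigin.origin_coords (h0 : α 0 = 0) (hf : RepresentsAtOrigin E E' α d f) :
    evalTriple f ![0, 1, 0] 0 = 0 ∧ evalTriple f ![0, 1, 0] 1 ≠ 0 ∧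
      evalTriple f ![0, 1, 0] 2 = 0 := by
  have h := hf.1.eq_point 0 _ WeierstrassCurve.Projective.Point.zero_point hf.2
  rw [h0, WeierstrassCurve.Projective.Point.zero_point] at h
  obtain ⟨u, hu, h⟩ := mk_eq_mk_iff.mp h
  have e0 := congrFun h 0
  have e1 := congrFun h 1
  have e2 := congrFun h 2
  simp only [Pi.smul_apply, smul_eq_mul, Matrix.cons_val] at e0 e1 e2
  refine ⟨(mul_eq_zero.mp e0).resolve_left hu, fun h1 => ?_, (mul_eq_zero.mp e2).resolve_left hu⟩
  rw [h1, mul_zero] at e1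
  exact zero_ne_one e1

lemma RepresentsAtOrigin.constantCoeff (h0 : α 0 = 0) (hf : RepresentsAtOrigin E E' α d f) :
    PowerSeries.constantCoeff (expand E (f 0)) = 0 ∧
      PowerSeries.constantCoeff (expand E (f 1)) ≠ 0 ∧
      PowerSeries.constantCoeff (expand E (f 2)) = 0 := by
  obtain ⟨e0, e1, e2⟩ := hf.origin_coords h0
  simp only [evalTriple] at e0 e1 e2
  have hinj : ∀ a : K, algebraMap K (AlgebraicClosure K) a = 0 ↔ a = 0 := fun a =>
    map_eq_zero _
  refine ⟨?_, ?_, ?_⟩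
  · rw [← hinj, constantCoeff_expand (hf.1.homogeneous 0), e0, mul_zero]
  · rw [Ne, ← hinj, constantCoeff_expand (hf.1.homogeneous 1)]
    exact mul_ne_zero (pow_ne_zero _ (neg_ne_zero.mpr one_ne_zero)) e1
  · rw [← hinj, constantCoeff_expand (hf.1.homogeneous 2), e2, mul_zero]

lemma constantCoeff_localExpansion (h0 : α 0 = 0) (hf : RepresentsAtOrigin E E' α d f) :
    PowerSeries.constantCoeff (localExpansion E f) = 0 := by
  simp [localExpansion, (hf.constantCoeff h0).1]

lemma chartPoint_X (E : WeierstrassCurve K) :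
    chartPoint E (PowerSeries.X : K⟦X⟧) = ![PowerSeries.X, -1, sSeries E] := by
  rw [chartPoint, PowerSeries.X_subst]

lemma localExpansion_eq {u U : K⟦X⟧} (hu : IsUnit u)
    (h : (fun i => expand E (f i)) = u • chartPoint E' (U : MvPowerSeries Unit K)) :
    localExpansion E f = U := by
  have h0 := congrFun h 0
  have h1 := congrFun h 1
  simp only [Pi.smul_apply, smul_eq_mul, chartPoint, Matrix.cons_val] at h0 h1
  have hc : PowerSeries.constantCoeff (expand E (f 1)) ≠ 0 := by
    rw [h1]
    have := (PowerSeries.isUnit_iff_constantCoeff.mp hu).ne_zero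
    simpa using this
  have hinv := PowerSeries.mul_inv_cancel _ hc
  rw [localExpansion]
  have h2 : expand E (f 0) = -U * expand E (f 1) := by
    rw [h1]
    refine h0.trans ?_
    change u * U = -U * (u * -1)
    ring
  rw [h2]
  linear_combination U * hinv

variable [E.IsElliptic] {σ : Type}

/-- The image of a point with power series coordinates. -/
theorem RepresentsAtOrigin.aeval_chartPoint (h0 : α 0 = 0) (hf : RepresentsAtOrigin E E' α d f)
    {g : MvPowerSeries σ K} (hg : MvPowerSeries.constantCoeff g = 0) :
    ∃ u : MvPowerSeries σ K, IsUnit u ∧ (fun i => MvPolynomial.aeval (chartPoint E g) (f i)) =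
      u • chartPoint E' (PowerSeries.subst g (localExpansion E f)) := by
  have hgs := PowerSeries.HasSubst.of_constantCoeff_zero hg
  obtain ⟨c0, c1, c2⟩ := hf.constantCoeff h0
  have hv : ∀ i, MvPolynomial.aeval (chartPoint E g) (f i) =
      PowerSeries.substAlgHom hgs (expand E (f i)) := fun i => by
    rw [EllipticFormal.aeval_chartPoint E hgs, PowerSeries.coe_substAlgHom]
  have hz : ∀ i, PowerSeries.constantCoeff (expand E (f i)) = 0 →
      MvPowerSeries.constantCoeff (MvPolynomial.aeval (chartPoint E g) (f i)) = 0 := fun i hi => by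
    rw [hv, PowerSeries.coe_substAlgHom]
    exact PowerSeries.constantCoeff_subst_eq_zero hg _ hi
  have hunit : IsUnit (MvPolynomial.aeval (chartPoint E g) (f 1)) := by
    rw [hv]
    exact (PowerSeries.isUnit_iff_constantCoeff.mpr c1.isUnit).map _
  have hE := equation_chartPoints (AlgebraicClosure K) (E := E) (E' := E') (ι := Fin 1)
    (v := fun i => MvPolynomial.aeval (fun j => MvPolynomial.X (0, j)) (f i)) (fun P q hq => by
      simp only [MvPolynomial.comp_aeval_apply, MvPolynomial.aeval_X]
      exact ((represents_iff.mp hf.1).coords (hq 0)).equation) (g := ![g]) (by simp [hg])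
  simp only [MvPolynomial.comp_aeval_apply, MvPolynomial.aeval_X, Matrix.cons_val] at hE
  -- The image triple satisfies the equation of `E'` and reduces to the origin, so its parameter
  -- `-X/Y` determines it.
  have h := eq_smul_chartPoint E' (g := PowerSeries.subst g (localExpansion E f)) hE (hz 0 c0)
    (MvPowerSeries.isUnit_iff_constantCoeff.mp hunit).ne_zero (hz 2 c2) (by
      rw [hv, hv, ← PowerSeries.coe_substAlgHom hgs, ← map_mul, ← map_neg]
      congr 1
      rw [localExpansion, mul_assoc, PowerSeries.inv_mul_cancel _ c1, mul_one])
  exact ⟨_, hunit.neg, h⟩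

lemma RepresentsAtOrigin.expand_eq (h0 : α 0 = 0) (hf : RepresentsAtOrigin E E' α d f) :
    ∃ u : K⟦X⟧, IsUnit u ∧ (fun i => expand E (f i)) =
      u • chartPoint E' (localExpansion E f : MvPowerSeries Unit K) := by
  obtain ⟨u, hu, h⟩ := hf.aeval_chartPoint h0 (g := (PowerSeries.X : K⟦X⟧))
    PowerSeries.constantCoeff_X
  refine ⟨u, hu, ?_⟩
  rw [PowerSeries.X_subst] at h
  rw [← h]
  simp only [chartPoint_X]
  rfl

/-- The expansion depends only on the map. -/
theorem localExpansion_unique {e : ℕ} {f' : Fin 3 → MvPolynomial (Fin 3) K} (h0 : α 0 = 0)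
    (hf : RepresentsAtOrigin E E' α d f) (hf' : RepresentsAtOrigin E E' α e f') :
    localExpansion E f = localExpansion E f' := by
  have hX : PowerSeries.constantCoeff (PowerSeries.X : K⟦X⟧) = 0 := PowerSeries.constantCoeff_X
  obtain ⟨u, hu, h⟩ := hf.aeval_chartPoint h0 (g := (PowerSeries.X : K⟦X⟧)) hX
  obtain ⟨u', hu', h'⟩ := hf'.aeval_chartPoint h0 (g := (PowerSeries.X : K⟦X⟧)) hX
  rw [PowerSeries.X_subst] at h h'
  refine eq_of_cross_smul E' hu hu' h h' ?_
  have := cross_chartPoints (AlgebraicClosure K) (E := E) (ι := Fin 1)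
    (v := fun i => MvPolynomial.aeval (fun j => MvPolynomial.X (0, j)) (f i))
    (w := fun i => MvPolynomial.aeval (fun j => MvPolynomial.X (0, j)) (f' i))
    (fun P q hq => by
      simp only [MvPolynomial.comp_aeval_apply, MvPolynomial.aeval_X]
      exact ((represents_iff.mp hf.1).coords (hq 0)).cross
        ((represents_iff.mp hf'.1).coords (hq 0)) rfl) (g := fun _ => (PowerSeries.X : K⟦X⟧))
    (fun _ => hX)
  simpa only [MvPolynomial.comp_aeval_apply, MvPolynomial.aeval_X, Matrix.cons_val] using this

/-- A map whose expansion vanishes is zero. -/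
theorem eq_zero_of_isExpansion_zero (hα : α ∈ Isog E E') (h : IsExpansion E E' α 0) : α = 0 := by
  obtain ⟨d, f, hf, hU⟩ := h
  have h0 := (mem_isog_iff.mp hα).2
  have hrep := (represents_iff.mp hf.1).extend
  obtain ⟨u, hu, h⟩ := hf.expand_eq h0
  rw [← hU] at h
  have hz : chartPoint E' ((0 : K⟦X⟧) : MvPowerSeries Unit K) = (-1 : K⟦X⟧) • ![0, 1, 0] :=
    chartPoint_zero E'
  rw [hz] at h
  have hvan : ∀ i, expand E (f i) = 0 → VanishesOn (E.map (algebraMap K (AlgebraicClosure K)))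
      (MvPolynomial.map (algebraMap K (AlgebraicClosure K)) (f i)) := fun i hi => by
    rw [← expand_eq_zero_iff _ (hrep.homogeneous i), ← map_expand, hi, map_zero]
  -- A vanishing expansion forces the outer two forms to vanish on the whole curve; where the middle
  -- form is nonzero, the image is the origin.
  have v0 := hvan 0 (by simpa using congrFun h 0)
  have v2 := hvan 2 (by simpa using congrFun h 2)
  refine eq_of_agree (mem_isog_iff.mp hα).1.extend isAlg_zero (hrep.homogeneous 1) (fun hv => ?_) ?_
  · rw [← expand_eq_zero_iff _ (hrep.homogeneous 1), ← map_expand] at hv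
    have := (PowerSeries.map_injective _ (algebraMap K (AlgebraicClosure K)).injective)
      (hv.trans (map_zero _).symm)
    refine (hf.constantCoeff h0).2.1 ?_
    rw [this, map_zero]
  · intro P p hP hne
    have hp := ne_zero_of_point hP
    have hE := (nonsingular_of_point hP).1
    have hpt := hrep.eq_point P p hP fun h => hne (congrFun h 1)
    exact eq_zero_of_Z_eq_zero hpt (v2 p hp hE)

variable [E'.IsElliptic]

/-- The expansion of an isogeny is a homomorphism of formal group laws. -/
theorem localExpansion_mem_formalHom (hα : α ∈ Isog E E') (hf : RepresentsAtOrigin E E' α d f) :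
    localExpansion E f ∈ FormalHom (formalGroupLaw E) (formalGroupLaw E') := by
  have h0 := (mem_isog_iff.mp hα).2
  have hrep := represents_iff.mp hf.1
  have hU := constantCoeff_localExpansion h0 hf
  have hX : ∀ i : Fin 2, MvPowerSeries.constantCoeff (MvPowerSeries.X i : MvPowerSeries (Fin 2) K) =
      0 := fun i => MvPowerSeries.constantCoeff_X i
  refine ⟨hU, ?_⟩
  obtain ⟨u, hu, hu'⟩ := originAdd_chartPoint E (hX 0) (hX 1)
  obtain ⟨v, hv, hv'⟩ := hf.aeval_chartPoint h0 (constantCoeff_subst_formalGroupLaw E (hX 0) (hX 1))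
  obtain ⟨a, ha, ha'⟩ := hf.aeval_chartPoint h0 (hX 0)
  obtain ⟨b, hb, hb'⟩ := hf.aeval_chartPoint h0 (hX 1)
  obtain ⟨w, hw, hw'⟩ := originAdd_chartPoint E'
    (PowerSeries.constantCoeff_subst_eq_zero (hX 0) _ hU)
    (PowerSeries.constantCoeff_subst_eq_zero (hX 1) _ hU)
  have h1 : (fun i => MvPolynomial.aeval (originAdd E (chartPoint E (MvPowerSeries.X 0))
      (chartPoint E (MvPowerSeries.X 1))) (f i)) = (u ^ d * v) • chartPoint E' (PowerSeries.subst
        (MvPowerSeries.subst ![(MvPowerSeries.X 0 : MvPowerSeries (Fin 2) K), MvPowerSeries.X 1]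
          (formalGroupLaw E)) (localExpansion E f)) := by
    rw [mul_smul, ← hv', hu']
    ext i : 1
    rw [aeval_smul_of_isHomogeneous (hf.1.homogeneous i), Pi.smul_apply, smul_eq_mul]
  have h2 := originAdd_smul E' a b
    (chartPoint E' (PowerSeries.subst (MvPowerSeries.X 0) (localExpansion E f)))
    (chartPoint E' (PowerSeries.subst (MvPowerSeries.X 1) (localExpansion E f)))
  rw [← ha', ← hb', hw', smul_smul] at h2
  -- Additivity of the isogeny on geometric points, transferred to the generic pair of chart points.
  have hcross := cross_chartPoints (AlgebraicClosure K) (E := E) (ι := Fin 2)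
    (v := fun i => MvPolynomial.aeval (originAdd E (fun j => MvPolynomial.X (0, j))
      fun j => MvPolynomial.X (1, j)) (f i))
    (w := originAdd E' (fun i => MvPolynomial.aeval (fun j => MvPolynomial.X (0, j)) (f i))
      fun i => MvPolynomial.aeval (fun j => MvPolynomial.X (1, j)) (f i))
    (fun P q hq => by
      simp only [MvPolynomial.comp_aeval_apply, map_originAdd, MvPolynomial.aeval_X]
      exact (hrep.coords ((hq 0).add (hq 1))).cross ((hrep.coords (hq 0)).add (hrep.coords (hq 1)))
        (isog_add hα _ _)) (g := MvPowerSeries.X) hX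
  simp only [MvPolynomial.comp_aeval_apply, map_originAdd, MvPolynomial.aeval_X] at hcross
  have h3 := eq_of_cross_smul E' ((hu.pow d).mul hv) (((ha.mul hb).pow 18).mul hw) h1 h2 hcross
  have hXX : (![MvPowerSeries.X 0, MvPowerSeries.X 1] : Fin 2 → MvPowerSeries (Fin 2) K) =
      MvPowerSeries.X := by
    ext i : 1
    fin_cases i <;> rfl
  rw [hXX, MvPowerSeries.subst_self] at h3
  exact h3

/-- The expansion of a sum. -/
theorem isExpansion_add {β : GeomPoint E → GeomPoint E'} (hα : α 0 = 0) (hβ : β 0 = 0)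
    {U V : K⟦X⟧} (hU : IsExpansion E E' α U) (hV : IsExpansion E E' β V) :
    IsExpansion E E' (α + β) (formalAdd (formalGroupLaw E') U V) := by
  obtain ⟨d, f, hf, rfl⟩ := hU
  obtain ⟨e, g, hg, rfl⟩ := hV
  have hrep := (represents_iff.mp hf.1).add rfl isAddLaw_originLaw (represents_iff.mp hg.1)
  refine ⟨_, _, ⟨represents_iff.mpr hrep, fun h => ?_⟩, ?_⟩
  -- At the origin both triples are nonzero multiples of `(0, 1, 0)`, which the addition law
  -- reproduces up to a nonzero scalar.
  · have h1 : _ = (0 : AlgebraicClosure K) := congrFun h 1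
    obtain ⟨a0, a1, a2⟩ := hf.origin_coords hα
    obtain ⟨b0, b1, b2⟩ := hg.origin_coords hβ
    have hfO : evalTriple f ![0, 1, 0] = evalTriple f ![0, 1, 0] 1 • ![0, 1, 0] := by
      ext i; fin_cases i <;> simp [a0, a2]
    have hgO : evalTriple g ![0, 1, 0] = evalTriple g ![0, 1, 0] 1 • ![0, 1, 0] := by
      ext i; fin_cases i <;> simp [b0, b2]
    have h2 : originAdd E' (evalTriple f ![0, 1, 0]) (evalTriple g ![0, 1, 0]) 1 = 0 :=
      (map_originAdd E' (MvPolynomial.aeval ![0, 1, 0]) f g 1).symm.trans h1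
    rw [hfO, hgO, originAdd_smul, originAdd_origin] at h2
    simp only [Pi.smul_apply, smul_eq_mul, Matrix.cons_val, mul_one] at h2
    exact pow_ne_zero _ (mul_ne_zero a1 b1) h2
  · obtain ⟨u, hu, hu'⟩ := hf.expand_eq hα
    obtain ⟨v, hv, hv'⟩ := hg.expand_eq hβ
    obtain ⟨w, hw, hw'⟩ := originAdd_chartPoint (σ := Unit) E' (constantCoeff_localExpansion hα hf)
      (constantCoeff_localExpansion hβ hg)
    refine (localExpansion_eq (E' := E') (((hu.mul hv).pow 18).mul hw) ?_).symm
    have h2 := originAdd_smul E' (R := K⟦X⟧) u v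
      (chartPoint E' (localExpansion E f : MvPowerSeries Unit K))
      (chartPoint E' (localExpansion E g : MvPowerSeries Unit K))
    rw [← hu', ← hv'] at h2
    have h3 : originAdd E' (R := K⟦X⟧) (chartPoint E' (localExpansion E f : MvPowerSeries Unit K))
      (chartPoint E' (localExpansion E g : MvPowerSeries Unit K)) = _ := hw'
    rw [h3, smul_smul] at h2
    rw [formalAdd, ← h2]
    ext i : 1
    exact map_originAdd E' (MvPolynomial.aeval _) f g i

/-- The expansion of a composite. -/
theorem isExpansion_comp [E''.IsElliptic] {β : GeomPoint E' → GeomPoint E''} (hα : α 0 = 0)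
    (hβ : β 0 = 0) {U U' : K⟦X⟧} (hU : IsExpansion E E' α U) (hU' : IsExpansion E' E'' β U') :
    IsExpansion E E'' (β ∘ α) (PowerSeries.subst U U') := by
  obtain ⟨d, f, hf, rfl⟩ := hU
  obtain ⟨e, g, hg, rfl⟩ := hU'
  have hrep := (represents_iff.mp hf.1).comp (represents_iff.mp hg.1)
  refine ⟨_, _, ⟨represents_iff.mpr hrep, fun h => ?_⟩, ?_⟩
  · obtain ⟨a0, a1, a2⟩ := hf.origin_coords hα
    obtain ⟨b0, b1, b2⟩ := hg.origin_coords hβ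
    have hfO : evalTriple f ![0, 1, 0] = evalTriple f ![0, 1, 0] 1 • ![0, 1, 0] := by
      ext i; fin_cases i <;> simp [a0, a2]
    have h1 : _ = (0 : AlgebraicClosure K) := congrFun h 1
    have h2 : MvPolynomial.aeval (evalTriple f ![0, 1, 0]) (g 1) = 0 :=
      (MvPolynomial.comp_aeval_apply f (MvPolynomial.aeval ![0, 1, 0]) (g 1)).symm.trans h1
    rw [hfO, aeval_smul_of_isHomogeneous (hg.1.homogeneous 1)] at h2
    exact mul_ne_zero (pow_ne_zero _ a1) b1 h2
  · obtain ⟨u, hu, hu'⟩ := hf.expand_eq hα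
    obtain ⟨v, hv, hv'⟩ := hg.aeval_chartPoint (σ := Unit) hβ (constantCoeff_localExpansion hα hf)
    refine (localExpansion_eq (E' := E'') ((hu.pow e).mul hv) ?_).symm
    ext i : 1
    -- Expanding the composite form means evaluating `g` at the expansion of `f`, a unit times the
    -- chart point with parameter `U`.
    have h1 : expand E (MvPolynomial.aeval f (g i)) =
        MvPolynomial.aeval (fun j => expand E (f j)) (g i) :=
      MvPolynomial.comp_aeval_apply f (MvPolynomial.aeval _) (g i)
    rw [h1, hu', aeval_smul_of_isHomogeneous (hg.1.homogeneous i), mul_smul, Pi.smul_apply,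
      smul_eq_mul]
    congr 1
    exact congrFun hv' i

end Isogeny

end EllipticFormal

end

/-! ### Proof of the proposition. -/

open EllipticFormal in
theorem proposition5p1 {K : Type*} [Field K] (E E' E'' : WeierstrassCurve K)
    [E.IsElliptic] [E'.IsElliptic] [E''.IsElliptic] :
    -- the power series attached to the three curves are commutative formal group laws
    (IsCommFormalGroupLaw (formalGroupLaw E) ∧ IsCommFormalGroupLaw (formalGroupLaw E') ∧
      IsCommFormalGroupLaw (formalGroupLaw E'')) ∧
    -- the quotient that defines `U` makes sense for all choices of polynomials,
    -- and it is a homomorphism of formal group laws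
    (∀ I ∈ Isog E E', ∀ d f, RepresentsAtOrigin E E' I d f →
      IsUnit (expand E (f 1)) ∧
        localExpansion E f ∈ FormalHom (formalGroupLaw E) (formalGroupLaw E')) ∧
    -- `U` depends only on `I`
    (∀ I ∈ Isog E E', ∃! U, IsExpansion E E' I U) ∧
    -- `Isog(E, E')` is a group under pointwise addition, `Hom(F, F')` is an abelian group under
    -- `(U, V) ↦ F'(U, V)`, and `I ↦ U` is an injective group homomorphism
    (∃ A : AddSubgroup (GeomPoint E → GeomPoint E'), (A : Set (GeomPoint E → GeomPoint E')) =
        Isog E E' ∧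
      ∃ _ : AddCommGroup (FormalHom (formalGroupLaw E) (formalGroupLaw E')),
        (∀ U V : FormalHom (formalGroupLaw E) (formalGroupLaw E'),
          (U + V).val = formalAdd (formalGroupLaw E') U.val V.val) ∧
        ∃ Φ : A →+ FormalHom (formalGroupLaw E) (formalGroupLaw E'),
          Function.Injective Φ ∧ ∀ I : A, IsExpansion E E' I.val (Φ I).val) ∧
    -- compatibility with composition
    (∀ I ∈ Isog E E', ∀ I' ∈ Isog E' E'', ∀ U U' : PowerSeries K,
      IsExpansion E E' I U → IsExpansion E' E'' I' U' →
        I' ∘ I ∈ Isog E E'' ∧ IsExpansion E E'' (I' ∘ I) (PowerSeries.subst U U') ∧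
          PowerSeries.subst U U' ∈ FormalHom (formalGroupLaw E) (formalGroupLaw E'')) := by
  have hex : ∀ I ∈ Isog E E', ∃ U, IsExpansion E E' I U := fun I hI => by
    obtain ⟨d, f, hf⟩ := exists_representsAtOrigin hI
    exact ⟨_, d, f, hf, rfl⟩
  have huniq : ∀ I ∈ Isog E E', ∀ U V, IsExpansion E E' I U → IsExpansion E E' I V → U = V := by
    rintro I hI _ _ ⟨d, f, hf, rfl⟩ ⟨e, g, hg, rfl⟩
    exact localExpansion_unique (mem_isog_iff.mp hI).2 hf hg
  have hmem : ∀ I ∈ Isog E E', ∀ U, IsExpansion E E' I U →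
      U ∈ FormalHom (formalGroupLaw E) (formalGroupLaw E') := by
    rintro I hI _ ⟨d, f, hf, rfl⟩
    exact localExpansion_mem_formalHom hI hf
  refine ⟨⟨isCommFormalGroupLaw_formalGroupLaw E, isCommFormalGroupLaw_formalGroupLaw E',
    isCommFormalGroupLaw_formalGroupLaw E''⟩, fun I hI d f hf => ⟨?_,
    localExpansion_mem_formalHom hI hf⟩, fun I hI => ?_, ?_, ?_⟩
  · exact PowerSeries.isUnit_iff_constantCoeff.mpr
      (hf.constantCoeff (mem_isog_iff.mp hI).2).2.1.isUnit
  · obtain ⟨U, hU⟩ := hex I hI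
    exact ⟨U, hU, fun V hV => huniq I hI V U hV hU⟩
  · refine ⟨isogSubgroup E E', rfl, formalHomAddCommGroup (G := formalGroup E')
      (constantCoeff_formalGroupLaw E) (fun U hU => exists_formalGroupLaw_eq_zero E' hU),
      fun U V => rfl, ?_⟩
    let _ : AddCommGroup (FormalHom (formalGroupLaw E) (formalGroupLaw E')) :=
      formalHomAddCommGroup (G := formalGroup E')
        (constantCoeff_formalGroupLaw E) (fun U hU => exists_formalGroupLaw_eq_zero E' hU)
    choose φ hφ using fun I : isogSubgroup E E' => hex I.1 I.2
    refine ⟨AddMonoidHom.mk' (fun I => ⟨φ I, hmem I.1 I.2 _ (hφ I)⟩) fun I J => Subtype.ext ?_, ?_,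
      hφ⟩
    -- Additivity follows from uniqueness: the formal sum of the two expansions is an expansion of
    -- the sum.
    · exact huniq _ (I + J).2 _ _ (hφ (I + J)) (isExpansion_add (mem_isog_iff.mp I.2).2
        (mem_isog_iff.mp J.2).2 (hφ I) (hφ J))
    · refine (injective_iff_map_eq_zero _).mpr fun I hI => Subtype.ext ?_
      have h0 : φ I = 0 := congrArg Subtype.val hI
      exact eq_zero_of_isExpansion_zero I.2 (h0 ▸ hφ I)
  · intro I hI I' hI' U U' hU hU'
    refine ⟨isog_comp hI hI', isExpansion_comp (mem_isog_iff.mp hI).2 (mem_isog_iff.mp hI').2 hU hU',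
      FormalHom.comp (hmem I hI U hU) ?_ (constantCoeff_formalGroupLaw E)
        (constantCoeff_formalGroupLaw E')⟩
    obtain ⟨d, f, hf, rfl⟩ := hU'
    exact localExpansion_mem_formalHom hI' hf
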